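/- Attributes have the countably infinite domain $\mathbb N$. A relation name $R$ comes with a finite set $A_R$ of attributes; an $A$-tuple is a map $A\to\mathbb N$. A join query is an expression $Q=R_1(A_1)\bowtie\cdots\bowtie R_m(A_m)$ with $m\ge 1$, where $A_i$ is the attribute set of $R_i$; its schema is $\sigma_Q=\{R_1,\dots,R_m\}$ and its attribute set is $A_Q=\bigcup_i A_i$. An instance $D$ for $Q$ assigns to each $R\in\sigma_Q$ a finite set $R(D)$ of $A_R$-tuples; $|D|=\sum_{R\in\sigma_Q}|R(D)|$. The answer $Q(D)$ is the set of all $A_Q$-tuples $t$ with $t|_{A_i}\in R_i(D)$ for all $i\in\{1,\dots,m\}$. The fractional edge cover number $\rho^*(Q)$ is the minimum of $\sum_{R\in\sigma_Q}x_R$ over all real $x_R\ge 0$ with $\sum_{R:\,a\in A_R}x_R\ge 1$ for every $a\in A_Q$. A join-project plan over $\sigma_Q$ is a term built from the relation names in $\sigma_Q$ by binary (natural) joins and projections $\pi_B$ (where $\pi_B$ restricts the tuples of an $A$-relation to $B\cap A$); its value in $D$ is $\varphi(D)$, and $\varphi$ is a plan for $Q$ if $\varphi(D)=Q(D)$ (as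 relations with the same attribute set) for every instance $D$. Running times refer to random access machines with addition, subtraction and indirect addressing, under the uniform cost measure; queries, instances (as tables), and plans are encoded in the natural way as finite sequences of natural numbers, and time is measured as a function of the length of the input sequence. **Theorem.** Let $\mathcal Q$ be a class of join queries. Then the following statements are equivalent: 1. Queries in $\mathcal Q$ have answers of polynomial size: there is a constant $c>0$ such that $|Q(D)|\le|D|^c$ for every $Q\in\mathcal Q$ and every instance $D$ for $Q$. 2. Queries in $\mathcal Q$ can be evaluated in polynomial time: there is one algorithm which, given any $Q\in\mathcal Q$ and any instance $D$ for $Q$, computes $Q(D)$ in time polynomial in the length of the input. 3. Queries in $\mathcal Q$ can be evaluated in polynomial time by an explicit join-project plan: there is an assignment of a join-project plan $\varphi_Q$ for $Q$ to every $Q\in\mathcal Q$ such that $\varphi_Q$ can be computed from $Q$ in polynomial time, and such that one algorithm, given any $Q\in\mathcal Q$ and any instance $D$ for $Q$, evaluates $\varphi_Q$ in $D$ node by node, outputting the relations $\psi(D)$ for all subplans $\psi$ of $\varphi_Q$ in postfix order, in time polynomial in the length of the input. 4. $\mathcal Q$ has bounded fractional edge cover number: there is a constant $c$ such that $\rho^*(Q)\le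 c$ for every $Q\in\mathcal Q$. -/

import Mathlib

namespace JoinQuery

/-! ### Attributes, tuples, relations, queries -/

/-- An `A`-tuple: a map from the finite set `A` of attributes to the domain `ℕ`. Attributes are
symbols coded by natural numbers, and every attribute has the countably infinite domain `ℕ`. -/
abbrev Tup (A : Finset ℕ) : Type := A → ℕ

/-- The projection (restriction) of an `A`-tuple to a subset `B ⊆ A`. -/
def Tup.proj {A B : Finset ℕ} (h : B ⊆ A) (t : Tup A) : Tup B := fun a => t ⟨a.1, h a.2⟩

/-- The entry of a tuple in column `a` (used only for `a ∈ A`). -/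
def Tup.entry {A : Finset ℕ} (t : Tup A) (a : ℕ) : ℕ := if h : a ∈ A then t ⟨a, h⟩ else 0

/-- A relation name: a symbol with an associated finite set of attributes. -/
structure RelName where
  name : ℕ
  attrs : Finset ℕ
deriving DecidableEq

/-- A join query `R₁(A₁) ⋈ ⋯ ⋈ Rₘ(Aₘ)`, `m ≥ 1`. -/
structure Query where
  rels : List RelName
  rels_ne_nil : rels ≠ []

/-- The schema of a query, the set `{R₁, …, Rₘ}`. -/
def Query.schema (Q : Query) : Finset RelName := Q.rels.toFinset

/-- The set of attributes `A_Q = A₁ ∪ ⋯ ∪ Aₘ`. -/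
def Query.attrs (Q : Query) : Finset ℕ := Q.schema.biUnion RelName.attrs

theorem Query.attrs_subset (Q : Query) {R : RelName} (hR : R ∈ Q.schema) : R.attrs ⊆ Q.attrs :=
  Finset.subset_biUnion_of_mem RelName.attrs hR

/-- A database instance of schema `σ`: a finite `A`-relation for every relation name `R(A)`
in `σ`. -/
def Instance (σ : Finset RelName) : Type := (R : σ) → Finset (Tup R.1.attrs)

/-- `|D|`, the total number of tuples. -/
def Instance.size {σ : Finset RelName} (D : Instance σ) : ℕ := ∑ R, (D R).card

/-- The answer `Q(D)`: all `A_Q`-tuples whose projection to the attributes of `R` is in `R(D)`,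
for every relation name `R` of the query. -/
def Query.answer (Q : Query) (D : Instance Q.schema) : Set (Tup Q.attrs) :=
  {t | ∀ R : Q.schema, t.proj (Q.attrs_subset R.2) ∈ D R}

/-! ### Fractional edge covers -/

/-- Fractional edge covers of the hypergraph of `Q`. -/
def Query.IsFractionalEdgeCover (Q : Query) (x : Q.schema → ℝ) : Prop :=
  (∀ R, 0 ≤ x R) ∧ ∀ a ∈ Q.attrs, 1 ≤ ∑ R with a ∈ R.1.attrs, x R

/-- The fractional edge cover number `ρ*(Q)`: the minimum cost of a fractional edge cover. -/
noncomputable def Query.fractionalEdgeCoverNumber (Q : Query) : ℝ :=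
  sInf {c | ∃ x : Q.schema → ℝ, Q.IsFractionalEdgeCover x ∧ c = ∑ R, x R}

/-! ### Join-project plans -/

/-- Join-project plans over the schema `σ`. -/
inductive Plan (σ : Finset RelName) : Type
  | rel (R : σ) : Plan σ
  | join (φ ψ : Plan σ) : Plan σ
  | proj (B : Finset ℕ) (φ : Plan σ) : Plan σ

/-- The (free) attributes of the relation computed by a plan. The node `π_B` applied to an
`A`-relation is the projection to `B ∩ A`; so it is the usual one when `B ⊆ A`. -/
def Plan.attrs {σ : Finset RelName} : Plan σ → Finset ℕ
  | .rel R => R.1.attrs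
  | .join φ ψ => φ.attrs ∪ ψ.attrs
  | .proj B φ => B ∩ φ.attrs

/-- The relation `φ(D)` computed by a plan. -/
def Plan.eval {σ : Finset RelName} (D : Instance σ) : (φ : Plan σ) → Set (Tup φ.attrs)
  | .rel R => {t | t ∈ D R}
  | .join φ ψ => {t : Tup (φ.attrs ∪ ψ.attrs) |
      t.proj Finset.subset_union_left ∈ φ.eval D ∧ t.proj Finset.subset_union_right ∈ ψ.eval D}
  | .proj B φ => {t : Tup (B ∩ φ.attrs) |
      ∃ s ∈ φ.eval D, t = s.proj Finset.inter_subset_right}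

/-- `φ` is a plan for `Q`: `φ(D) = Q(D)` for every instance `D`, as relations together with their
sets of attributes. -/
def Plan.IsPlanFor (Q : Query) (φ : Plan Q.schema) : Prop :=
  ∀ D : Instance Q.schema,
    (⟨φ.attrs, φ.eval D⟩ : Σ A : Finset ℕ, Set (Tup A)) = ⟨Q.attrs, Q.answer D⟩

/-! ### Random access machines with the uniform cost measure

A random access machine has an infinite memory of cells holding natural numbers, a read-only input
tape and a write-only output tape. Its programs are given in structured form (sequencing,
conditionals and while loops instead of jumps). Every elementary instruction and every evaluation
of a test costs one time unit. -/

namespace RAM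

structure State where
  mem : ℕ → ℕ
  input : List ℕ
  output : List ℕ

/-- Operands: a constant, a cell, or the cell whose address is stored in a given cell. -/
inductive Operand : Type
  | const (c : ℕ)
  | cell (i : ℕ)
  | indirect (i : ℕ)

/-- Targets of assignments: a cell, or the cell whose address is stored in a given cell. -/
inductive Target : Type
  | cell (i : ℕ)
  | indirect (i : ℕ)

inductive Test : Type
  | lt (a b : Operand)
  | eq (a b : Operand)

inductive Program : Type
  | skip
  | assign (x : Target) (a : Operand)
  | add (x : Target) (a b : Operand)
  | sub (x : Target) (a b : Operand)
  | read (x : Target)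
  | write (a : Operand)
  | seq (p q : Program)
  | ite (b : Test) (p q : Program)
  | loop (b : Test) (p : Program)

def State.val (s : State) : Operand → ℕ
  | .const c => c
  | .cell i => s.mem i
  | .indirect i => s.mem (s.mem i)

def State.address (s : State) : Target → ℕ
  | .cell i => i
  | .indirect i => s.mem i

def State.store (s : State) (x : Target) (v : ℕ) : State :=
  { s with mem := Function.update s.mem (s.address x) v }

def State.holds (s : State) : Test → Prop
  | .lt a b => s.val a < s.val b
  | .eq a b => s.val a = s.val b

/-- `Exec p s s' t`: started in state `s`, the program `p` terminates in state `s'` after exactly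
`t` time units. Subtraction is truncated at `0`, and reading past the end of the input gives `0`. -/
inductive Exec : Program → State → State → ℕ → Prop
  | skip (s : State) : Exec .skip s s 1
  | assign (s : State) (x : Target) (a : Operand) : Exec (.assign x a) s (s.store x (s.val a)) 1
  | add (s : State) (x : Target) (a b : Operand) :
      Exec (.add x a b) s (s.store x (s.val a + s.val b)) 1
  | sub (s : State) (x : Target) (a b : Operand) :
      Exec (.sub x a b) s (s.store x (s.val a - s.val b)) 1
  | read (s : State) (x : Target) :
      Exec (.read x) s { s.store x (s.input.headD 0) with input := s.input.tail } 1
  | write (s : State) (a : Operand) :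
      Exec (.write a) s { s with output := s.output ++ [s.val a] } 1
  | seq {p q : Program} {s s' s'' : State} {t t' : ℕ} :
      Exec p s s' t → Exec q s' s'' t' → Exec (.seq p q) s s'' (t + t')
  | iteTrue {b : Test} {p q : Program} {s s' : State} {t : ℕ} :
      s.holds b → Exec p s s' t → Exec (.ite b p q) s s' (t + 1)
  | iteFalse {b : Test} {p q : Program} {s s' : State} {t : ℕ} :
      ¬ s.holds b → Exec q s s' t → Exec (.ite b p q) s s' (t + 1)
  | loopTrue {b : Test} {p : Program} {s s' s'' : State} {t t' : ℕ} :
      s.holds b → Exec p s s' t → Exec (.loop b p) s' s'' t' →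
        Exec (.loop b p) s s'' (t + t' + 1)
  | loopFalse {b : Test} {p : Program} {s : State} :
      ¬ s.holds b → Exec (.loop b p) s s 1

/-- On input `w`, with all memory cells initially `0`, the program halts after `t` time units
having written `v`. -/
def Program.Outputs (p : Program) (w v : List ℕ) (t : ℕ) : Prop :=
  ∃ s' : State, Exec p ⟨fun _ => 0, w, []⟩ s' t ∧ s'.output = v

/-- One program, on each encoding `w` of each `x : α`, writes some encoding of the desired result
for `x`, in time polynomial in the length of `w`. -/
def PolyTime {α : Type} (isInput isOutput : α → List ℕ → Prop) : Prop :=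
  ∃ (p : Program) (q : Polynomial ℕ), ∀ (x : α) (w : List ℕ), isInput x w →
    ∃ (v : List ℕ) (t : ℕ), p.Outputs w v t ∧ t ≤ q.eval w.length ∧ isOutput x v

end RAM

/-! ### Encodings as sequences of natural numbers -/

/-- A relation name is encoded by its symbol, its arity and its attributes in increasing order. -/
def RelName.code (R : RelName) : List ℕ := R.name :: R.attrs.card :: R.attrs.sort (· ≤ ·)

/-- A query is encoded by `m` followed by the encodings of `R₁(A₁), …, Rₘ(Aₘ)`. -/
def Query.code (Q : Query) : List ℕ := Q.rels.length :: Q.rels.flatMap RelName.code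

/-- `w` encodes the `A`-relation `S` as a table: the number of columns, the attributes labelling
the columns (in some order), the number of rows, and the rows (in some order, each tuple of `S`
exactly once). -/
def IsTable {A : Finset ℕ} (S : Set (Tup A)) (w : List ℕ) : Prop :=
  ∃ (cols : List ℕ) (rows : List (Tup A)),
    cols.Nodup ∧ cols.toFinset = A ∧ rows.Nodup ∧ (∀ t, t ∈ rows ↔ t ∈ S) ∧
    w = cols.length :: cols ++ rows.length :: rows.flatMap (fun t => cols.map t.entry)

/-- `w` encodes the query `Q` together with the instance `D`: the code of `Q`, followed by tables
of the relations `R₁(D), …, Rₘ(D)`. -/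
def IsInputCode (Q : Query) (D : Instance Q.schema) (w : List ℕ) : Prop :=
  ∃ tables : List (List ℕ),
    List.Forall₂ (fun (R : Q.schema) v => IsTable {t | t ∈ D R} v)
      (Q.rels.attach.map fun R => ⟨R.1, List.mem_toFinset.2 R.2⟩) tables ∧
    w = Q.code ++ tables.flatten

/-- `φ.IsCode w`: `w` is the plan `φ` written in postfix notation. The codes of the three kinds of
nodes start with `0`, `1`, `2`; the attributes of a projection are listed in some order. -/
inductive Plan.IsCode {σ : Finset RelName} : Plan σ → List ℕ → Prop
  | rel (R : σ) : IsCode (.rel R) (0 :: R.1.code)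
  | join {φ ψ : Plan σ} {u v : List ℕ} :
      IsCode φ u → IsCode ψ v → IsCode (.join φ ψ) (u ++ v ++ [1])
  | proj {φ : Plan σ} {B : Finset ℕ} {u l : List ℕ} :
      IsCode φ u → l.Nodup → l.toFinset = B → IsCode (.proj B φ) (u ++ 2 :: l.length :: l)

/-- `φ.IsEvaluation D w`: `w` is a record of the evaluation of the plan `φ` in `D`, bottom-up: for
every node of the plan, in postfix order, a table of the relation `ψ(D)` computed by the subplan
`ψ` at that node. The last table is that of `φ(D)`. -/
inductive Plan.IsEvaluation {σ : Finset RelName} (D : Instance σ) : Plan σ → List ℕ → Prop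
  | rel {R : σ} {w : List ℕ} :
      IsTable ((Plan.rel R).eval D) w → IsEvaluation D (.rel R) w
  | join {φ ψ : Plan σ} {u v w : List ℕ} :
      IsEvaluation D φ u → IsEvaluation D ψ v → IsTable ((Plan.join φ ψ).eval D) w →
        IsEvaluation D (.join φ ψ) (u ++ v ++ w)
  | proj {φ : Plan σ} {B : Finset ℕ} {u w : List ℕ} :
      IsEvaluation D φ u → IsTable ((Plan.proj B φ).eval D) w →
        IsEvaluation D (.proj B φ) (u ++ w)

/-! ### The four properties of a class of join queries -/

/-- There is a constant `c > 0` with `|Q(D)| ≤ |D| ^ c` for all queries of the class and all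
instances. -/
def HasPolySizeAnswers (𝒬 : Set Query) : Prop :=
  ∃ c : ℕ, 0 < c ∧ ∀ Q ∈ 𝒬, ∀ D : Instance Q.schema,
    (Q.answer D).encard ≤ ((D.size ^ c : ℕ) : ℕ∞)

/-- A single program computes `Q(D)` from `Q` and `D` in polynomial time, for all queries `Q` of
the class and all instances `D`. -/
def PolyTimeEvaluable (𝒬 : Set Query) : Prop :=
  RAM.PolyTime (α := Σ Q : 𝒬, Instance Q.1.schema)
    (fun x w => IsInputCode x.1.1 x.2 w) (fun x v => IsTable (x.1.1.answer x.2) v)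

/-- Every query `Q` of the class has a join-project plan `Φ Q` which is computable from `Q` in
polynomial time and which can be evaluated in `D` (operation by operation, computing the values of
all subplans) in time polynomial in the size of `Q` and `D`. -/
def PolyTimeEvaluableByPlan (𝒬 : Set Query) : Prop :=
  ∃ Φ : (Q : Query) → Plan Q.schema,
    (∀ Q ∈ 𝒬, (Φ Q).IsPlanFor Q) ∧
    RAM.PolyTime (α := 𝒬) (fun Q w => w = Q.1.code) (fun Q v => (Φ Q.1).IsCode v) ∧
    RAM.PolyTime (α := Σ Q : 𝒬, Instance Q.1.schema)
      (fun x w => IsInputCode x.1.1 x.2 w) (fun x v => (Φ x.1.1).IsEvaluation x.2 v)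

/-- The class has bounded fractional edge cover number. -/
def BoundedFractionalEdgeCoverNumber (𝒬 : Set Query) : Prop :=
  ∃ c : ℝ, ∀ Q ∈ 𝒬, Q.fractionalEdgeCoverNumber ≤ c

end JoinQuery

/-! Everything passes through property 4. For a fixed query only exponents matter, not constants.

Towards 4: by linear programming duality (`Query.exists_independent`, a separation of convex sets),
a query with ρ* > k + 1 has nonnegative attribute weights z of total more than k + 1, with at most 1
on every relation. The product instance with about N ^ z_a values for each attribute a has relations
of size O(N) and at least N ^ (k + 1) answers. This contradicts any bound K * (|D| + 1) ^ k, even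
with K depending on the query (`Query.fractionalEdgeCoverNumber_le_of_encard_le`). A machine writes
at most one number per time unit, and for a fixed query the input length is linear in |D| + 1, so
polynomial time evaluation yields such a bound with the degree of the polynomial as k.

From 4: the plan treats the attributes one after the other. For every initial list B of attributes
it joins the current result with π_B(R) for all relations R. In the middle of a round all relations
have been joined on the previous list, and at most one further attribute a is present, whose values
come from a single relation. Removing a from all edges and adding the edge {a} with weight 1 turns a
cover of cost at most k into one of cost at most k + 1, so every intermediate result has at most N ^
(k + 1) tuples (`Query.ncard_eval_prefix_le`). The underlying product bound `card_le_prod_rpow`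
follows by induction on the attributes from a form of Hölder's inequality (`sum_prod_rpow_le`).

For the machine model, `PolyReads` and `PolyFun` form a small calculus of polynomial time programs,
closed under composition, pairing, conditionals, loops and folds. Values are immutable trees on a
heap that only grows, so later computations leave them intact. A fold is polynomial as soon as its
intermediate values are of polynomial size (`PolyFun.foldl`); here the bound on intermediate results
enters. -/

namespace JoinQuery.RAM

/-! ### Values in memory

Cell `0` holds the heap pointer, an odd number; the cells `2 * d` with `d ≥ 1` are registers, the
odd cells below the heap pointer hold immutable data. -/

/-- The heap of `m'` extends the heap of `m`. -/
def HeapLE (m m' : ℕ → ℕ) : Prop := m 0 ≤ m' 0 ∧ ∀ i, i % 2 = 1 → i < m 0 → m' i = m i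

theorem HeapLE.refl (m : ℕ → ℕ) : HeapLE m m := ⟨le_rfl, fun _ _ _ => rfl⟩

theorem HeapLE.trans {m m' m'' : ℕ → ℕ} (h : HeapLE m m') (h' : HeapLE m' m'') :
    HeapLE m m'' :=
  ⟨h.1.trans h'.1, fun i hi hl => (h'.2 i hi (hl.trans_le h.1)).trans (h.2 i hi hl)⟩

/-- Types whose elements are represented by words: `rep m w a` says that the word `w` represents
`a` in the memory `m`. -/
class Rep (α : Type) where
  rep : (ℕ → ℕ) → ℕ → α → Prop
  size : α → ℕ
  mono : ∀ {m m' : ℕ → ℕ} {w : ℕ} {a : α}, HeapLE m m' → rep m w a → rep m' w a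

open JoinQuery.RAM.Rep

/-- Under the uniform cost measure the magnitude of a number is irrelevant, hence size 1. -/
instance : Rep ℕ where
  rep _ w n := w = n
  size _ := 1
  mono _ h := h

instance : Rep Bool where
  rep _ w b := w = b.toNat
  size _ := 1
  mono _ h := h

instance : Rep Unit where
  rep _ _ _ := True
  size _ := 1
  mono _ h := h

/-- A promise: the representation is unchanged, so the same program serves, but polynomial bounds
are needed only for elements satisfying `P`. In this way membership in a class of queries is used
without being decided. -/
instance {α : Type} [Rep α] (P : α → Prop) : Rep {a // P a} where
  rep m w a := rep m w a.1
  size a := size a.1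
  mono h h' := mono h h'

section

variable {α β : Type} [Rep α] [Rep β]

def IsBlock (m : ℕ → ℕ) (w : ℕ) : Prop := w % 2 = 1 ∧ w + 2 < m 0

theorem IsBlock.mono {m m' : ℕ → ℕ} {w : ℕ} (h : HeapLE m m') (hb : IsBlock m w) :
    IsBlock m' w ∧ m' w = m w ∧ m' (w + 2) = m (w + 2) := by
  obtain ⟨h1, h2⟩ := hb
  refine ⟨⟨h1, by have := h.1; omega⟩, h.2 _ h1 (by omega), h.2 _ (by omega) h2⟩

instance : Rep (α × β) where
  rep m w p := IsBlock m w ∧ rep m (m w) p.1 ∧ rep m (m (w + 2)) p.2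
  size p := size p.1 + size p.2 + 1
  mono := by
    rintro m m' w a h ⟨hb, h1, h2⟩
    obtain ⟨hb', e1, e2⟩ := hb.mono h
    exact ⟨hb', e1 ▸ mono h h1, e2 ▸ mono h h2⟩

/-- Blocks are at odd addresses, so the word 0 for the empty list is unambiguous. A nonempty list
has the layout of the pair of its head and tail. -/
def repList (m : ℕ → ℕ) : ℕ → List α → Prop
  | w, [] => w = 0
  | w, a :: l => IsBlock m w ∧ rep m (m w) a ∧ repList m (m (w + 2)) l

theorem repList_mono {m m' : ℕ → ℕ} (h : HeapLE m m') :
    ∀ {w : ℕ} {l : List α}, repList m w l → repList m' w l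
  | _, [], hw => hw
  | _, _ :: _, ⟨hb, h1, h2⟩ => by
    obtain ⟨hb', e1, e2⟩ := hb.mono h
    exact ⟨hb', e1 ▸ mono h h1, e2 ▸ repList_mono h h2⟩

instance : Rep (List α) where
  rep := repList
  size l := (l.map fun a => size a + 1).sum + 1
  mono h h' := repList_mono h h'

theorem size_nat (n : ℕ) : size n = 1 := rfl
theorem size_bool (b : Bool) : size b = 1 := rfl
theorem size_unit (b : Unit) : size b = 1 := rfl
theorem size_subtype {P : α → Prop} (a : {a // P a}) : size a = size a.1 := rfl
theorem size_pair (p : α × β) : size p = size p.1 + size p.2 + 1 := rfl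
theorem size_list (l : List α) : size l = (l.map fun a => size a + 1).sum + 1 := rfl
theorem size_nil : size ([] : List α) = 1 := rfl
theorem size_cons (a : α) (l : List α) : size (a :: l) = size a + size l + 1 := by
  simp [size_list]; omega
theorem size_append (l l' : List α) : size (l ++ l') + 1 = size l + size l' := by
  simp [size_list]; omega

end

/-- The coefficients are natural numbers, so polynomial bounds are monotone and can be composed. -/
theorem eval_mono (q : Polynomial ℕ) {m n : ℕ} (h : m ≤ n) : q.eval m ≤ q.eval n := by
  simp only [Polynomial.eval_eq_sum_range]
  gcongr

/-- The effect of a program on everything except the input and the registers from `d` on. -/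
structure Frame (d : ℕ) (s s' : State) : Prop where
  output : s'.output = s.output
  odd : s'.mem 0 % 2 = 1
  heap : HeapLE s.mem s'.mem
  regs : ∀ e, 1 ≤ e → e < d → s'.mem (2 * e) = s.mem (2 * e)

theorem Frame.refl {d : ℕ} {s : State} (h : s.mem 0 % 2 = 1) : Frame d s s :=
  ⟨rfl, h, .refl _, fun _ _ _ => rfl⟩

theorem Frame.trans {d d' : ℕ} {s s' s'' : State} (h : Frame d s s') (h' : Frame d' s' s'')
    (hd : d ≤ d') : Frame d s s'' :=
  ⟨h'.output.trans h.output, h'.odd, h.heap.trans h'.heap, fun e h1 h2 =>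
    (h'.regs e h1 (h2.trans_le hd)).trans (h.regs e h1 h2)⟩

theorem Frame.weaken {d d' : ℕ} {s s' : State} (h : Frame d' s s') (hd : d ≤ d') :
    Frame d s s' :=
  ⟨h.output, h.odd, h.heap, fun e h1 h2 => h.regs e h1 (h2.trans_le hd)⟩

theorem HeapLE.update {m : ℕ → ℕ} {d v : ℕ} (hd : 1 ≤ d) :
    HeapLE m (Function.update m (2 * d) v) := by
  refine ⟨?_, fun i hi _ => ?_⟩
  · rw [Function.update_of_ne (by omega)]
  · rw [Function.update_of_ne (by omega)]

theorem Frame.store {d e v : ℕ} {s : State} (h : s.mem 0 % 2 = 1) (hd : 1 ≤ e) (he : d ≤ e) :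
    Frame d s (s.store (.cell (2 * e)) v) := by
  refine ⟨rfl, ?_, .update hd, fun i h1 h2 => ?_⟩
  · simp only [State.store, State.address]
    rwa [Function.update_of_ne (by omega)]
  · simp only [State.store, State.address]
    rw [Function.update_of_ne (by omega)]

theorem store_cell_same (s : State) (i v : ℕ) : (s.store (.cell i) v).mem i = v := by
  simp [State.store, State.address]

theorem store_cell_ne (s : State) {i j : ℕ} (v : ℕ) (h : j ≠ i) :
    (s.store (.cell i) v).mem j = s.mem j := by
  simp [State.store, State.address, h]

/-! ### Polynomial time readers and functions -/

section

variable {α β γ δ σ : Type} [Rep α] [Rep β] [Rep γ] [Rep δ] [Rep σ]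

/-- A program, usable with any number of reserved registers, which for `R a w b` transforms `a`
into `b` while reading `w` from the input, in time polynomial in the sizes of `a` and `w`. -/
def PolyReads (R : α → List ℕ → β → Prop) : Prop :=
  ∃ (p : ℕ → Program) (q : Polynomial ℕ), ∀ d a w b, 1 ≤ d → R a w b →
    size b ≤ q.eval (size a + w.length) ∧
    ∀ (s : State) (rest : List ℕ), s.input = w ++ rest → s.mem 0 % 2 = 1 →
      rep s.mem (s.mem (2 * d)) a →
      ∃ s' t, Exec (p d) s s' t ∧ t ≤ q.eval (size a + w.length) ∧ Frame d s s' ∧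
        s'.input = rest ∧ rep s'.mem (s'.mem (2 * d)) b

/-- Functions computable in polynomial time. -/
@[fun_prop]
def PolyFun (f : α → β) : Prop := PolyReads fun a w b => w = [] ∧ b = f a

theorem PolyReads.mono {R R' : α → List ℕ → β → Prop} (h : PolyReads R)
    (h' : ∀ a w b, R' a w b → R a w b) : PolyReads R' := by
  obtain ⟨p, q, H⟩ := h
  exact ⟨p, q, fun d a w b hd hR => H d a w b hd (h' a w b hR)⟩

theorem PolyReads.comp {R : α → List ℕ → β → Prop} {R' : β → List ℕ → γ → Prop}
    (h : PolyReads R) (h' : PolyReads R') :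
    PolyReads fun a w c => ∃ u v b, w = u ++ v ∧ R a u b ∧ R' b v c := by
  obtain ⟨p, q, H⟩ := h
  obtain ⟨p', q', H'⟩ := h'
  refine ⟨fun d => (p d).seq (p' d), q + q'.comp (q + .X), ?_⟩
  rintro d a w c hd ⟨u, v, b, rfl, hu, hv⟩
  obtain ⟨hs, H⟩ := H d a u b hd hu
  obtain ⟨hs', H'⟩ := H' d b v c hd hv
  simp only [Polynomial.eval_add, Polynomial.eval_comp, Polynomial.eval_X, List.length_append]
  have e1 := eval_mono q (show size a + u.length ≤ size a + (u.length + v.length) by omega)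
  have e2 := eval_mono q' (show size b + v.length ≤
    q.eval (size a + (u.length + v.length)) + (size a + (u.length + v.length)) by omega)
  refine ⟨by omega, fun s rest hi hm hr => ?_⟩
  obtain ⟨s', t, x, ht, hf, hi', hr'⟩ := H s (v ++ rest) (by simpa using hi) hm hr
  obtain ⟨s'', t', x', ht', hf', hi'', hr''⟩ := H' s' rest hi' hf.odd hr'
  exact ⟨s'', t + t', x.seq x', by omega, hf.trans hf' le_rfl, hi'', hr''⟩

theorem PolyFun.of_eq {f g : α → β} (h : PolyFun f) (e : ∀ a, g a = f a) : PolyFun g := by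
  rw [show g = f from funext e]; exact h

theorem PolyFun.comp_reads {R : α → List ℕ → β → Prop} {f : β → γ}
    (hf : PolyFun f) (h : PolyReads R) : PolyReads fun a w c => ∃ b, R a w b ∧ c = f b := by
  refine (h.comp hf).mono ?_
  rintro a w c ⟨b, hb, rfl⟩
  exact ⟨w, [], b, by simp, hb, rfl, rfl⟩

theorem PolyReads.comp_fun {f : α → β} {R : β → List ℕ → γ → Prop}
    (h : PolyReads R) (hf : PolyFun f) : PolyReads fun a w c => R (f a) w c := by
  refine (PolyReads.comp hf h).mono ?_
  rintro a w c hb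
  exact ⟨[], w, f a, by simp, ⟨rfl, rfl⟩, hb⟩

@[fun_prop]
theorem PolyFun.comp {f : β → γ} {g : α → β} (hf : PolyFun f) (hg : PolyFun g) :
    PolyFun fun a => f (g a) :=
  PolyReads.comp_fun hf hg

/-- Programs that change nothing but the registers from `d` on and take bounded time. -/
theorem PolyReads.of_register {R : α → List ℕ → β → Prop} (p : ℕ → Program) (c : ℕ)
    (hc : ∀ a w b, R a w b → w = [] ∧ size b ≤ size a + c)
    (H : ∀ d a w b s, 1 ≤ d → R a w b → s.mem 0 % 2 = 1 → rep s.mem (s.mem (2 * d)) a →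
      ∃ s' t, Exec (p d) s s' t ∧ t ≤ c ∧ Frame d s s' ∧ s'.input = s.input ∧
        rep s'.mem (s'.mem (2 * d)) b) : PolyReads R := by
  refine ⟨p, .X + .C c, fun d a w b hd hR => ?_⟩
  obtain ⟨rfl, hs⟩ := hc a w b hR
  simp only [Polynomial.eval_add, Polynomial.eval_C, Polynomial.eval_X, List.length_nil]
  refine ⟨by omega, fun s rest hi hm hr => ?_⟩
  obtain ⟨s', t, x, ht, hf, hi', hr'⟩ := H d a [] b s hd hR hm hr
  exact ⟨s', t, x, by omega, hf, by simpa [hi'] using hi, hr'⟩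

/-- For conversions in which one word represents both values, as with an element of a subtype and
its value, or a nonempty list and the pair of its head and tail. -/
theorem PolyReads.of_skip {R : α → List ℕ → β → Prop}
    (hc : ∀ a w b, R a w b → w = [] ∧ size b ≤ size a + 1)
    (H : ∀ m w a v b, R a v b → rep m w a → rep m w b) : PolyReads R :=
  .of_register (fun _ => .skip) 1 hc fun _ a w b s _ hR hm hr =>
    ⟨s, 1, .skip s, le_rfl, .refl hm, rfl, H _ _ a w b hR hr⟩

/-! ### Constants, projections, pairs and arithmetic -/

@[fun_prop]
theorem PolyFun.id : PolyFun fun a : α => a :=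
  .of_skip (by rintro a w b ⟨rfl, rfl⟩; simp) (by rintro m w a v b ⟨rfl, rfl⟩ h; exact h)

@[fun_prop]
theorem PolyFun.val {P : α → Prop} : PolyFun fun a : {a // P a} => a.1 :=
  .of_skip (by rintro a w b ⟨rfl, rfl⟩; simp [size_subtype])
    (by rintro m w a v b ⟨rfl, rfl⟩ h; exact h)

theorem PolyFun.cons_pair : PolyFun fun p : α × List α => p.1 :: p.2 :=
  .of_skip (by rintro a w b ⟨rfl, rfl⟩; simp [size_pair, size_cons])
    (by rintro m w a v b ⟨rfl, rfl⟩ h; exact h)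

theorem PolyReads.uncons :
    PolyReads fun (l : List α) w (p : α × List α) => w = [] ∧ l = p.1 :: p.2 :=
  .of_skip (by rintro a w b ⟨rfl, rfl⟩; simp [size_pair, size_cons])
    (by rintro m w a v b ⟨rfl, rfl⟩ h; exact h)

@[fun_prop]
theorem PolyFun.const_nat (n : ℕ) : PolyFun fun _ : α => n := by
  refine .of_register (fun d => .assign (.cell (2 * d)) (.const n)) 1 ?_ ?_
  · rintro a w b ⟨rfl, rfl⟩; simp [size_nat]
  · rintro d a w b s hd ⟨rfl, rfl⟩ hm hr
    exact ⟨_, 1, .assign _ _ _, le_rfl, .store hm hd le_rfl, rfl, store_cell_same _ _ _⟩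

@[fun_prop]
theorem PolyFun.const_unit : PolyFun fun _ : α => () :=
  .of_skip (by rintro a w b ⟨rfl, rfl⟩; simp [size_unit]) (fun _ _ _ _ _ _ _ => trivial)

@[fun_prop]
theorem PolyFun.const_bool (n : Bool) : PolyFun fun _ : α => n := by
  refine .of_register (fun d => .assign (.cell (2 * d)) (.const n.toNat)) 1 ?_ ?_
  · rintro a w b ⟨rfl, rfl⟩; simp [size_bool]
  · rintro d a w b s hd ⟨rfl, rfl⟩ hm hr
    exact ⟨_, 1, .assign _ _ _, le_rfl, .store hm hd le_rfl, rfl, store_cell_same _ _ _⟩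

@[fun_prop]
theorem PolyFun.const_nil : PolyFun fun _ : α => ([] : List β) := by
  refine .of_register (fun d => .assign (.cell (2 * d)) (.const 0)) 1 ?_ ?_
  · rintro a w b ⟨rfl, rfl⟩; simp [size_nil]
  · rintro d a w b s hd ⟨rfl, rfl⟩ hm hr
    exact ⟨_, 1, .assign _ _ _, le_rfl, .store hm hd le_rfl, rfl, store_cell_same _ _ _⟩

theorem PolyFun.prod_fst : PolyFun fun p : α × β => p.1 := by
  refine .of_register (fun d => .assign (.cell (2 * d)) (.indirect (2 * d))) 1 ?_ ?_
  · rintro a w b ⟨rfl, rfl⟩; simp only [size_pair, true_and]; omega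
  · rintro d a w b s hd ⟨rfl, rfl⟩ hm ⟨hb, h1, h2⟩
    refine ⟨_, 1, .assign _ _ _, le_rfl, .store hm hd le_rfl, rfl, ?_⟩
    rw [store_cell_same]
    exact mono (Frame.store (d := d) hm hd le_rfl).heap h1

theorem PolyFun.prod_snd : PolyFun fun p : α × β => p.2 := by
  refine .of_register (fun d => .seq (.add (.cell (2 * d)) (.cell (2 * d)) (.const 2))
    (.assign (.cell (2 * d)) (.indirect (2 * d)))) 2 ?_ ?_
  · rintro a w b ⟨rfl, rfl⟩; simp only [size_pair, true_and]; omega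
  · rintro d a w b s hd ⟨rfl, rfl⟩ hm ⟨hb, h1, h2⟩
    have f1 : Frame d s (s.store (.cell (2 * d)) (s.mem (2 * d) + 2)) := .store hm hd le_rfl
    refine ⟨_, _, .seq (.add _ _ _ _) (.assign _ _ _), le_rfl,
      f1.trans (.store f1.odd hd le_rfl) le_rfl, rfl, ?_⟩
    rw [store_cell_same]
    have : (s.store (.cell (2 * d)) (s.mem (2 * d) + 2)).mem (s.mem (2 * d) + 2) =
      s.mem (s.mem (2 * d) + 2) := store_cell_ne _ _ (by have := hb.1; omega)
    simp only [State.val, store_cell_same, this]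
    exact mono (f1.trans (.store f1.odd hd le_rfl) le_rfl).heap h2

@[fun_prop]
theorem PolyFun.fst {f : α → β × γ} (hf : PolyFun f) : PolyFun fun a => (f a).1 :=
  PolyFun.prod_fst.comp hf

@[fun_prop]
theorem PolyFun.snd {f : α → β × γ} (hf : PolyFun f) : PolyFun fun a => (f a).2 :=
  PolyFun.prod_snd.comp hf

theorem exec_save {d : ℕ} {s : State} {e : ℕ} {a : α} (hm : s.mem 0 % 2 = 1)
    (he : 1 ≤ e) (hde : d ≤ e) (i : ℕ) (ha : rep s.mem (s.mem (2 * i)) a) :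
    ∃ s', Exec (.assign (.cell (2 * e)) (.cell (2 * i))) s s' 1 ∧ Frame d s s' ∧
      s'.input = s.input ∧ rep s'.mem (s'.mem (2 * e)) a := by
  refine ⟨_, .assign _ _ _, .store hm he hde, rfl, ?_⟩
  rw [store_cell_same]
  exact mono (Frame.store hm he hde).heap ha

/-- The heap pointer is odd, so the two cells of the new block are not registers, and they lie above
all old data. Nothing represented before is destroyed. -/
theorem exec_alloc {d : ℕ} {s : State} {a : α} {b : β} (hd : 1 ≤ d) (hm : s.mem 0 % 2 = 1)
    (ha : rep s.mem (s.mem (2 * (d + 1))) a) (hb : rep s.mem (s.mem (2 * (d + 2))) b) :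
    ∃ s', Exec (.seq (.assign (.indirect 0) (.cell (2 * (d + 1))))
      (.seq (.assign (.cell (2 * d)) (.cell 0))
      (.seq (.add (.cell 0) (.cell 0) (.const 2))
      (.seq (.assign (.indirect 0) (.cell (2 * (d + 2))))
        (.add (.cell 0) (.cell 0) (.const 2)))))) s s' 5 ∧ Frame d s s' ∧
      s'.input = s.input ∧ rep s'.mem (s'.mem (2 * d)) (a, b) := by
  have h0 : s.mem 0 ≠ 0 := by omega
  have h1 : s.mem 0 ≠ 2 * d := by omega
  have h2 : s.mem 0 ≠ 2 * (d + 2) := by omega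
  have h5 : s.mem 0 + 2 ≠ 2 * d := by omega
  have h6 : (0 : ℕ) ≠ 2 * d := by omega
  have h8 : 2 * (d + 2) ≠ 2 * d := by omega
  have h9 : 2 * (d + 2) ≠ 0 := by omega
  have h10 : 2 * d ≠ 0 := by omega
  obtain ⟨m', hm'⟩ : ∃ m', m' = Function.update (Function.update (Function.update (Function.update
    (Function.update s.mem (s.mem 0) (s.mem (2 * (d + 1)))) (2 * d) (s.mem 0)) 0 (s.mem 0 + 2))
      (s.mem 0 + 2) (s.mem (2 * (d + 2)))) 0 (s.mem 0 + 2 + 2) := ⟨_, rfl⟩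
  have key : Frame d s ⟨m', s.input, s.output⟩ := by
    refine ⟨rfl, ?_, ⟨?_, fun i hi hl => ?_⟩, fun e he hl => ?_⟩
    · simp [hm']; omega
    · simp [hm']; omega
    · simp only [hm']
      repeat rw [Function.update_of_ne (by omega)]
    · simp only [hm']
      repeat rw [Function.update_of_ne (by omega)]
  have x : Exec (.seq (.assign (.indirect 0) (.cell (2 * (d + 1))))
      (.seq (.assign (.cell (2 * d)) (.cell 0))
      (.seq (.add (.cell 0) (.cell 0) (.const 2))
      (.seq (.assign (.indirect 0) (.cell (2 * (d + 2))))
        (.add (.cell 0) (.cell 0) (.const 2)))))) s ⟨m', s.input, s.output⟩ 5 := by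
    convert Exec.seq (.assign _ _ _) (.seq (.assign _ _ _) (.seq (.add _ _ _ _)
      (.seq (.assign _ _ _) (.add _ _ _ _)))) using 1
    simp [State.val, State.store, State.address, hm', h0.symm, h2.symm, h6, h8, h9]
  refine ⟨_, x, key, rfl, ?_⟩
  have : rep m' (m' (2 * d)) (a, b) := by
    have k1 : m' (2 * d) = s.mem 0 := by
      simp only [hm']
      rw [Function.update_of_ne h10, Function.update_of_ne h5.symm, Function.update_of_ne h10,
        Function.update_self]
    have k2 : m' (s.mem 0) = s.mem (2 * (d + 1)) := by
      simp only [hm']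
      rw [Function.update_of_ne h0, Function.update_of_ne (by omega), Function.update_of_ne h0,
        Function.update_of_ne h1, Function.update_self]
    have k3 : m' (s.mem 0 + 2) = s.mem (2 * (d + 2)) := by
      simp only [hm']
      rw [Function.update_of_ne (by omega), Function.update_self]
    rw [k1]
    refine ⟨⟨hm, ?_⟩, ?_, ?_⟩
    · simp [hm']
    · rw [k2]; exact mono key.heap ha
    · rw [k3]; exact mono key.heap hb
  exact this

/-- The first program works from register `d + 1` on and spares the argument in register `d`; the
second works from `d + 2` on and also spares the first result. The constant 7 counts two copies and
the five instructions of the allocation. -/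
theorem PolyReads.pair {R : α → List ℕ → β → Prop} {R' : α → List ℕ → γ → Prop}
    (h : PolyReads R) (h' : PolyReads R') :
    PolyReads fun a w (c : β × γ) => ∃ u v, w = u ++ v ∧ R a u c.1 ∧ R' a v c.2 := by
  obtain ⟨p, q, H⟩ := h
  obtain ⟨p', q', H'⟩ := h'
  refine ⟨fun d => .seq (.assign (.cell (2 * (d + 1))) (.cell (2 * d))) (.seq (p (d + 1))
    (.seq (.assign (.cell (2 * (d + 2))) (.cell (2 * d))) (.seq (p' (d + 2))
      (.seq (.assign (.indirect 0) (.cell (2 * (d + 1))))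
      (.seq (.assign (.cell (2 * d)) (.cell 0))
      (.seq (.add (.cell 0) (.cell 0) (.const 2))
      (.seq (.assign (.indirect 0) (.cell (2 * (d + 2))))
        (.add (.cell 0) (.cell 0) (.const 2))))))))), q + q' + 7, ?_⟩
  · rintro d a w ⟨b, c⟩ hd ⟨u, v, rfl, hu, hv⟩
    obtain ⟨hs, H⟩ := H (d + 1) a u b (by omega) hu
    obtain ⟨hs', H'⟩ := H' (d + 2) a v c (by omega) hv
    have e1 := eval_mono q (show size a + u.length ≤ size a + (u ++ v).length by simp)
    have e2 := eval_mono q' (show size a + v.length ≤ size a + (u ++ v).length by simp)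
    have e7 : Polynomial.eval (size a + (u ++ v).length) (7 : Polynomial ℕ) = 7 := by simp
    simp only [Polynomial.eval_add, e7]
    refine ⟨by simp only [size_pair]; omega, fun s rest hi hm hr => ?_⟩
    obtain ⟨s1, x1, f1, i1, r1⟩ := exec_save (d := d) hm (e := d + 1) (by omega) (by omega) d hr
    obtain ⟨s2, t2, x2, l2, f2, i2, r2⟩ :=
      H s1 (v ++ rest) (by rw [i1, hi]; simp) f1.odd r1
    have hr2 : rep s2.mem (s2.mem (2 * d)) a := by
      rw [f2.regs d hd (by omega)]
      have : s1.mem (2 * d) = s.mem (2 * d) := by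
        cases x1
        exact store_cell_ne _ _ (by omega)
      rw [this]
      exact Rep.mono (f1.heap.trans f2.heap) hr
    obtain ⟨s3, x3, f3, i3, r3⟩ :=
      exec_save (d := d + 2) f2.odd (e := d + 2) (by omega) (by omega) d hr2
    obtain ⟨s4, t4, x4, l4, f4, i4, r4⟩ := H' s3 rest (by rw [i3, i2]) f3.odd r3
    obtain ⟨s5, x5, f5, i5, r5⟩ := exec_alloc (d := d) (a := b) (b := c) hd f4.odd (by
      rw [f4.regs (d + 1) (by omega) (by omega), f3.regs (d + 1) (by omega) (by omega)]
      exact Rep.mono (f3.heap.trans f4.heap) r2) r4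
    refine ⟨s5, _, .seq x1 (.seq x2 (.seq x3 (.seq x4 x5))), by omega, ?_, by rw [i5, i4], r5⟩
    exact (((f1.trans f2 (by omega)).trans f3 (by omega)).trans f4 (by omega)).trans f5 le_rfl

@[fun_prop]
theorem PolyFun.pair {f : α → β} {g : α → γ} (hf : PolyFun f) (hg : PolyFun g) :
    PolyFun fun a => (f a, g a) := by
  refine (PolyReads.pair hf hg).mono ?_
  rintro a w _ ⟨rfl, rfl⟩
  exact ⟨[], [], rfl, ⟨rfl, rfl⟩, rfl, rfl⟩

@[fun_prop]
theorem PolyFun.cons {f : α → β} {g : α → List β} (hf : PolyFun f) (hg : PolyFun g) :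
    PolyFun fun a => f a :: g a :=
  PolyFun.cons_pair.comp (hf.pair hg)

theorem PolyReads.readNat : PolyReads fun (_ : α) w (n : ℕ) => w = [n] := by
  refine ⟨fun d => .read (.cell (2 * d)), 1, ?_⟩
  rintro d a w b hd rfl
  refine ⟨by simp [size_nat], fun s rest hi hm hr => ?_⟩
  refine ⟨_, _, .read _ _, by simp, ?_, by simp [hi], ?_⟩
  · have := Frame.store (v := s.input.headD 0) hm hd le_rfl
    exact ⟨this.1, this.2, this.3, this.4⟩
  · simp only [store_cell_same]
    simp [rep, hi]

/-- Operations on the entries of a pair of numbers. -/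
theorem PolyFun.of_pair_op {f : ℕ × ℕ → β} (c : ℕ) (p : ℕ → Program)
    (hs : ∀ a, size (f a) ≤ c)
    (H : ∀ d (s : State) (x y : ℕ), 1 ≤ d → s.mem 0 % 2 = 1 → s.mem (s.mem (2 * d)) = x →
      s.mem (s.mem (2 * (d + 1))) = y →
      ∃ v t, Exec (p d) s (s.store (.cell (2 * d)) v) t ∧ t ≤ c ∧
        rep (s.store (.cell (2 * d)) v).mem v (f (x, y))) : PolyFun f := by
  -- Registers `d` and `d + 1` now hold the addresses of the two entries, so indirect operands give
  -- the entries themselves.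
  refine .of_register (fun d => .seq (.add (.cell (2 * (d + 1))) (.cell (2 * d)) (.const 2))
    (p d)) (c + 1) ?_ ?_
  · rintro a w b ⟨rfl, rfl⟩
    exact ⟨rfl, by have := hs a; omega⟩
  · rintro d a w b s hd ⟨rfl, rfl⟩ hm ⟨hb, h1, h2⟩
    have f1 : Frame d s (s.store (.cell (2 * (d + 1))) (s.mem (2 * d) + 2)) :=
      .store hm (by omega) (by omega)
    have h1' : s.mem (s.mem (2 * d)) = a.1 := h1
    have h2' : s.mem (s.mem (2 * d) + 2) = a.2 := h2
    have hb1 := hb.1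
    obtain ⟨v, t, x, ht, hv⟩ := H d _ a.1 a.2 hd f1.odd
      (by rw [store_cell_ne _ _ (show 2 * d ≠ _ by omega), store_cell_ne _ _ (by omega), h1'])
      (by rw [store_cell_same, store_cell_ne _ _ (by omega), h2'])
    refine ⟨_, 1 + t, .seq (.add _ _ _ _) x, by omega,
      f1.trans (.store f1.odd hd le_rfl) le_rfl, rfl, ?_⟩
    rw [store_cell_same]
    exact hv

theorem PolyFun.prod_add : PolyFun fun p : ℕ × ℕ => p.1 + p.2 := by
  refine .of_pair_op 1 (fun d => .add (.cell (2 * d)) (.indirect (2 * d)) (.indirect (2 * (d + 1))))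
    (by simp [size_nat]) ?_
  rintro d s x y hd hm rfl rfl
  exact ⟨_, 1, .add _ _ _ _, le_rfl, rfl⟩

theorem PolyFun.prod_sub : PolyFun fun p : ℕ × ℕ => p.1 - p.2 := by
  refine .of_pair_op 1 (fun d => .sub (.cell (2 * d)) (.indirect (2 * d)) (.indirect (2 * (d + 1))))
    (by simp [size_nat]) ?_
  rintro d s x y hd hm rfl rfl
  exact ⟨_, 1, .sub _ _ _ _, le_rfl, rfl⟩

theorem PolyFun.prod_beq : PolyFun fun p : ℕ × ℕ => p.1 == p.2 := by
  refine .of_pair_op 2 (fun d => .ite (.eq (.indirect (2 * d)) (.indirect (2 * (d + 1))))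
    (.assign (.cell (2 * d)) (.const 1)) (.assign (.cell (2 * d)) (.const 0)))
    (by simp [size_bool]) ?_
  rintro d s x y hd hm rfl rfl
  by_cases h : s.mem (s.mem (2 * d)) = s.mem (s.mem (2 * (d + 1)))
  · exact ⟨_, 2, .iteTrue h (.assign _ _ _), le_rfl, by simp [h, rep, State.val]⟩
  · refine ⟨_, 2, .iteFalse h (.assign _ _ _), le_rfl, ?_⟩
    simp [rep, State.val, beq_eq_false_iff_ne.2 h]

@[fun_prop]
theorem PolyFun.add {f g : α → ℕ} (hf : PolyFun f) (hg : PolyFun g) :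
    PolyFun fun a => f a + g a := PolyFun.prod_add.comp (hf.pair hg)

@[fun_prop]
theorem PolyFun.sub {f g : α → ℕ} (hf : PolyFun f) (hg : PolyFun g) :
    PolyFun fun a => f a - g a := PolyFun.prod_sub.comp (hf.pair hg)

@[fun_prop]
theorem PolyFun.beq {f g : α → ℕ} (hf : PolyFun f) (hg : PolyFun g) :
    PolyFun fun a => f a == g a := PolyFun.prod_beq.comp (hf.pair hg)

theorem PolyFun.isEmpty : PolyFun fun l : List α => l.isEmpty := by
  refine .of_register (fun d => .ite (.eq (.cell (2 * d)) (.const 0))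
    (.assign (.cell (2 * d)) (.const 1)) (.assign (.cell (2 * d)) (.const 0))) 2 ?_ ?_
  · rintro a w b ⟨rfl, rfl⟩
    simp [size_bool]
  · rintro d a w b s hd ⟨rfl, rfl⟩ hm hr
    cases a with
    | nil =>
      have hr' : s.mem (2 * d) = 0 := hr
      exact ⟨_, _, .iteTrue hr' (.assign _ _ _), le_rfl, .store hm hd le_rfl, rfl,
        store_cell_same _ _ _⟩
    | cons x l =>
      have hr' : ¬ s.mem (2 * d) = 0 := by have := hr.1.1; omega
      exact ⟨_, _, .iteFalse hr' (.assign _ _ _), le_rfl, .store hm hd le_rfl, rfl,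
        store_cell_same _ _ _⟩

/-! ### Conditionals and loops -/

/-- Running a function on a copy of register `d`. -/
theorem exec_test {c : α → β} {p : ℕ → Program} {q : Polynomial ℕ}
    (H : ∀ d a w b, 1 ≤ d → (w = [] ∧ b = c a) →
      size b ≤ q.eval (size a + w.length) ∧
      ∀ (s : State) (rest : List ℕ), s.input = w ++ rest → s.mem 0 % 2 = 1 →
        rep s.mem (s.mem (2 * d)) a →
        ∃ s' t, Exec (p d) s s' t ∧ t ≤ q.eval (size a + w.length) ∧ Frame d s s' ∧
          s'.input = rest ∧ rep s'.mem (s'.mem (2 * d)) b)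
    {d : ℕ} {s : State} {a : α} (hd : 1 ≤ d) (hm : s.mem 0 % 2 = 1)
    (ha : rep s.mem (s.mem (2 * d)) a) :
    ∃ s' t, Exec (.seq (.assign (.cell (2 * (d + 1))) (.cell (2 * d))) (p (d + 1))) s s' t ∧
      t ≤ q.eval (size a) + 1 ∧ Frame (d + 1) s s' ∧ s'.input = s.input ∧
      rep s'.mem (s'.mem (2 * d)) a ∧ rep s'.mem (s'.mem (2 * (d + 1))) (c a) := by
  obtain ⟨s1, x1, f1, i1, r1⟩ :=
    exec_save (d := d + 1) hm (e := d + 1) (by omega) le_rfl d ha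
  obtain ⟨-, H⟩ := H (d + 1) a [] (c a) (by omega) ⟨rfl, rfl⟩
  obtain ⟨s2, t2, x2, l2, f2, i2, r2⟩ := H s1 s.input (by simpa using i1) f1.odd r1
  refine ⟨s2, _, .seq x1 x2, by simp at l2; omega, f1.trans f2 le_rfl, i2, ?_, r2⟩
  rw [f2.regs d hd (by omega), f1.regs d hd (by omega)]
  exact mono (f1.heap.trans f2.heap) ha

theorem PolyReads.cond {c : α → Bool} {R R' : α → List ℕ → β → Prop} (hc : PolyFun c)
    (h : PolyReads R) (h' : PolyReads R') :
    PolyReads fun a w b => if c a then R a w b else R' a w b := by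
  obtain ⟨pc, qc, Hc⟩ := hc
  obtain ⟨p, q, H⟩ := h
  obtain ⟨p', q', H'⟩ := h'
  refine ⟨fun d => .seq (.seq (.assign (.cell (2 * (d + 1))) (.cell (2 * d))) (pc (d + 1)))
    (.ite (.lt (.const 0) (.cell (2 * (d + 1)))) (p d) (p' d)), qc + q + q' + 2, ?_⟩
  rintro d a w b hd hR
  have e1 := eval_mono qc (show size a ≤ size a + w.length by simp)
  have e2 : Polynomial.eval (size a + w.length) (2 : Polynomial ℕ) = 2 := by simp
  simp only [Polynomial.eval_add, e2]
  cases hca : c a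
  · simp only [hca, Bool.false_eq_true, if_false] at hR
    obtain ⟨hs, H⟩ := H' d a w b hd hR
    refine ⟨by omega, fun s rest hi hm hr => ?_⟩
    obtain ⟨s1, t1, x1, l1, f1, i1, r1, r1'⟩ := exec_test Hc hd hm hr
    obtain ⟨s2, t2, x2, l2, f2, i2, r2⟩ := H s1 rest (by rw [i1, hi]) f1.odd r1
    have : ¬ s1.holds (.lt (.const 0) (.cell (2 * (d + 1)))) := by
      have : s1.mem (2 * (d + 1)) = (c a).toNat := r1'
      simp [State.holds, State.val, this, hca]
    exact ⟨s2, _, .seq x1 (.iteFalse this x2), by omega,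
      (f1.weaken (by omega)).trans f2 le_rfl, i2, r2⟩
  · simp only [hca, if_true] at hR
    obtain ⟨hs, H⟩ := H d a w b hd hR
    refine ⟨by omega, fun s rest hi hm hr => ?_⟩
    obtain ⟨s1, t1, x1, l1, f1, i1, r1, r1'⟩ := exec_test Hc hd hm hr
    obtain ⟨s2, t2, x2, l2, f2, i2, r2⟩ := H s1 rest (by rw [i1, hi]) f1.odd r1
    have : s1.holds (.lt (.const 0) (.cell (2 * (d + 1)))) := by
      have : s1.mem (2 * (d + 1)) = (c a).toNat := r1'
      simp [State.holds, State.val, this, hca]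
    exact ⟨s2, _, .seq x1 (.iteTrue this x2), by omega,
      (f1.weaken (by omega)).trans f2 le_rfl, i2, r2⟩

@[fun_prop]
theorem PolyFun.cond {c : α → Bool} {f g : α → β} (hc : PolyFun c)
    (hf : PolyFun f) (hg : PolyFun g) : PolyFun fun a => bif c a then f a else g a := by
  refine (PolyReads.cond hc hf hg).mono ?_
  rintro a w _ ⟨rfl, rfl⟩
  cases h : c a <;> simp [h]

/-- Runs of a loop with `n` iterations on states of size at most `M`. -/
inductive LoopRun (test : σ → Bool) (R : σ → List ℕ → σ → Prop) (M : ℕ) :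
    ℕ → σ → List ℕ → σ → Prop
  | done {a : σ} : size a ≤ M → test a = false → LoopRun test R M 0 a [] a
  | step {n : ℕ} {a a' b : σ} {u v : List ℕ} : size a ≤ M → test a = true → R a u a' →
      LoopRun test R M n a' v b → LoopRun test R M (n + 1) a (u ++ v) b

theorem LoopRun.size_le {test : σ → Bool} {R : σ → List ℕ → σ → Prop} {M n : ℕ} {a b : σ}
    {w : List ℕ} (h : LoopRun test R M n a w b) : size b ≤ M := by
  induction h with
  | done h _ => exact h
  | step _ _ _ _ ih => exact ih

/-- One polynomial has to bound both the number of iterations and the sizes of all states. Bounding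
the iterations alone is not enough, since a polynomial time body may double the state each time. -/
theorem PolyReads.loop {test : σ → Bool} {R S : σ → List ℕ → σ → Prop} (ht : PolyFun test)
    (h : PolyReads R) (q : Polynomial ℕ)
    (hS : ∀ a w b, S a w b → ∃ n ≤ q.eval (size a + w.length),
      LoopRun test R (q.eval (size a + w.length)) n a w b) : PolyReads S := by
  obtain ⟨pt, qt, Ht⟩ := ht
  obtain ⟨p, r, H⟩ := h
  let ptest : ℕ → Program := fun d =>
    .seq (.assign (.cell (2 * (d + 1))) (.cell (2 * d))) (pt (d + 1))
  let lp : ℕ → Program := fun d =>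
    .loop (.lt (.const 0) (.cell (2 * (d + 1)))) ((p d).seq (ptest d))
  -- Invariant: register `d` holds the state and register `d + 1` the value of the test on it; `W`
  -- bounds the length of the input still to be read.
  have key : ∀ (W d M n : ℕ) (a : σ) (w : List ℕ) (b : σ), 1 ≤ d → LoopRun test R M n a w b →
      w.length ≤ W → ∀ (s : State) (rest : List ℕ), s.input = w ++ rest → s.mem 0 % 2 = 1 →
      rep s.mem (s.mem (2 * d)) a → s.mem (2 * (d + 1)) = (test a).toNat →
      ∃ s' t, Exec (lp d) s s' t ∧ t ≤ n * (r.eval (M + W) + qt.eval M + 2) + 1 ∧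
        Frame d s s' ∧ s'.input = rest ∧ rep s'.mem (s'.mem (2 * d)) b := by
    intro W d M n a w b hd hrun
    induction hrun with
    | done hM hta =>
      intro _ s rest hi hm hr hv
      exact ⟨s, 1, .loopFalse (by simp [State.holds, State.val, hv, hta]), by simp, .refl hm,
        hi, hr⟩
    | @step n a a' b u v hM hta hR hrun ih =>
      intro hW s rest hi hm hr hv
      simp only [List.length_append] at hW
      obtain ⟨-, H⟩ := H d a u a' hd hR
      obtain ⟨s1, t1, x1, l1, f1, i1, r1⟩ := H s (v ++ rest) (by simpa using hi) hm hr
      obtain ⟨s2, t2, x2, l2, f2, i2, r2, r2'⟩ := exec_test Ht hd f1.odd r1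
      obtain ⟨s3, t3, x3, l3, f3, i3, r3⟩ :=
        ih (by omega) s2 rest (by rw [i2, i1]) f2.odd r2 r2'
      have e1 := eval_mono r (show size a + u.length ≤ M + W by omega)
      have e2 := eval_mono qt (show size a' ≤ M by cases hrun <;> assumption)
      refine ⟨s3, _, .loopTrue (by simp [State.holds, State.val, hv, hta]) (.seq x1 x2) x3, ?_,
        (f1.trans (f2.weaken (by omega)) le_rfl).trans f3 le_rfl, i3, r3⟩
      rw [Nat.add_mul]
      omega
  refine ⟨fun d => (ptest d).seq (lp d),
    qt + q * (r.comp (q + .X) + qt.comp q + 2) + 2 + q, fun d a w b hd hab => ?_⟩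
  obtain ⟨n, hn, hrun⟩ := hS a w b hab
  have e2 : Polynomial.eval (size a + w.length) (2 : Polynomial ℕ) = 2 := by simp
  simp only [Polynomial.eval_add, Polynomial.eval_mul, Polynomial.eval_comp, Polynomial.eval_X, e2]
  set M := q.eval (size a + w.length)
  refine ⟨hrun.size_le.trans (by omega), fun s rest hi hm hr => ?_⟩
  obtain ⟨s1, t1, x1, l1, f1, i1, r1, r1'⟩ := exec_test Ht hd hm hr
  obtain ⟨s2, t2, x2, l2, f2, i2, r2⟩ :=
    key w.length d M n a w b hd hrun le_rfl s1 rest (by rw [i1, hi]) f1.odd r1 r1'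
  refine ⟨s2, _, .seq x1 x2, ?_, (f1.weaken (by omega)).trans f2 le_rfl, i2, r2⟩
  have e1 := eval_mono qt (show size a ≤ size a + w.length by simp)
  have e3 := eval_mono r (show M + w.length ≤ M + (size a + w.length) by omega)
  have e4 : n * (r.eval (M + w.length) + qt.eval M + 2) ≤
      M * (r.eval (M + (size a + w.length)) + qt.eval M + 2) := by gcongr
  omega

end

/-! ### Writing the result to the output tape -/

theorem exec_writeList (l : List ℕ) : ∀ (s : State), repList s.mem (s.mem 2) l →
    ∃ s', Exec (.loop (.lt (.const 0) (.cell 2)) (.seq (.write (.indirect 2))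
      (.seq (.add (.cell 2) (.cell 2) (.const 2)) (.assign (.cell 2) (.indirect 2))))) s s'
      (4 * l.length + 1) ∧ s'.output = s.output ++ l := by
  induction l with
  | nil =>
    intro s hs
    have : s.mem 2 = 0 := hs
    exact ⟨s, .loopFalse (by simp [State.holds, State.val, this]), by simp⟩
  | cons a l ih =>
    rintro s ⟨hb, h1, h2⟩
    obtain rfl : s.mem (s.mem 2) = a := h1
    have hb1 := hb.1
    have k : (s.store (.cell 2) (s.mem 2 + 2)).mem (s.mem 2 + 2) = s.mem (s.mem 2 + 2) :=
      store_cell_ne _ _ (by omega)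
    obtain ⟨s', x, hs'⟩ := ih
      ({ s with output := s.output ++ [s.mem (s.mem 2)] }.store (.cell 2) (s.mem 2 + 2) |>.store (.cell 2)
        (s.mem (s.mem 2 + 2))) (by
        rw [store_cell_same]
        refine repList_mono ?_ h2
        exact (HeapLE.update (d := 1) le_rfl).trans (HeapLE.update (d := 1) le_rfl))
    refine ⟨s', ?_, by rw [hs']; simp [State.store]⟩
    have := Exec.loopTrue (b := .lt (.const 0) (.cell 2)) (s := s)
      (by simp only [State.holds, State.val]; omega)
      (.seq (.write s (.indirect 2)) (.seq (.add _ (.cell 2) (.cell 2) (.const 2))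
        (.assign _ (.cell 2) (.indirect 2)))) (s'' := s')
      (t' := 4 * l.length + 1) (by
        convert x using 2
        · rfl
        · exact k)
    convert this using 1
    simp
    omega

/-- Setting cell 0 to 1 makes the heap pointer odd. Writing costs four units per entry and the list
is no longer than its size, whence the factor 5 = 1 + 4; the shift `.X + 1` accounts for the size of
`()`. -/
theorem PolyReads.polyTime {R : Unit → List ℕ → List ℕ → Prop} (h : PolyReads R) {α : Type}
    {isInput isOutput : α → List ℕ → Prop}
    (H : ∀ x w, isInput x w → ∃ v, R () w v ∧ isOutput x v) : PolyTime isInput isOutput := by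
  obtain ⟨p, q, hp⟩ := h
  refine ⟨.seq (.assign (.cell 0) (.const 1)) (.seq (p 1) (.loop (.lt (.const 0) (.cell 2))
    (.seq (.write (.indirect 2)) (.seq (.add (.cell 2) (.cell 2) (.const 2))
    (.assign (.cell 2) (.indirect 2)))))), 5 * q.comp (.X + 1) + 2, fun x w hw => ?_⟩
  obtain ⟨v, hv, hx⟩ := H x w hw
  obtain ⟨hs, hp⟩ := hp 1 () w v le_rfl hv
  obtain ⟨s1, t1, x1, l1, f1, i1, r1⟩ := hp ⟨Function.update (fun _ => 0) 0 1, w, []⟩ []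
    (by simp) (by simp) trivial
  obtain ⟨s2, x2, o2⟩ := exec_writeList v s1 r1
  refine ⟨v, _, ⟨s2, .seq (.assign _ _ _) (.seq x1 x2), by rw [o2, f1.output]; simp⟩, ?_, hx⟩
  have hl : v.length ≤ size v := by
    rw [size_list]
    simp only [size_nat, List.map_const', List.sum_replicate]
    simp
    omega
  simp only [size_unit, add_comm 1] at hs l1
  simp only [Polynomial.eval_add, Polynomial.eval_mul, Polynomial.eval_comp, Polynomial.eval_X,
    Polynomial.eval_one, Polynomial.eval_ofNat]
  omega

end JoinQuery.RAM

namespace JoinQuery.RAM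

open JoinQuery.RAM.Rep

section

variable {α β γ δ : Type} [Rep α] [Rep β] [Rep γ] [Rep δ]

theorem size_le_of_mem {l : List α} {a : α} (h : a ∈ l) : size a + 2 ≤ size l := by
  have := List.single_le_sum (l := l.map fun a => size a + 1) (by simp) (size a + 1)
    (List.mem_map_of_mem h)
  rw [size_list]
  omega

theorem length_lt_size (l : List α) : l.length < size l := by
  induction l with
  | nil => simp [size_nil]
  | cons a l ih => rw [size_cons, List.length_cons]; omega

theorem size_le_of_forall_le {l : List α} {M : ℕ} (h : ∀ a ∈ l, size a ≤ M) :
    size l ≤ l.length * (M + 1) + 1 := by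
  induction l with
  | nil => simp [size_nil]
  | cons a l ih =>
    have h1 := h a (by simp)
    have h2 := ih fun b hb => h b (by simp [hb])
    rw [size_cons, List.length_cons, Nat.add_mul]
    omega

theorem size_sublist {l l' : List α} (h : l.Sublist l') : size l ≤ size l' := by
  induction h with
  | slnil => exact le_rfl
  | cons a h ih => rw [size_cons]; omega
  | cons_cons a h ih => rw [size_cons, size_cons]; omega

@[fun_prop]
theorem PolyFun.not {c : α → Bool} (hc : PolyFun c) : PolyFun fun a => !(c a) :=
  (hc.cond (.const_bool false) (.const_bool true)).of_eq fun a => by cases c a <;> rfl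

@[fun_prop]
theorem PolyFun.or {c d : α → Bool} (hc : PolyFun c) (hd : PolyFun d) :
    PolyFun fun a => c a || d a :=
  (hc.cond (.const_bool true) hd).of_eq fun a => by cases c a <;> rfl

@[fun_prop]
theorem PolyFun.and {c d : α → Bool} (hc : PolyFun c) (hd : PolyFun d) :
    PolyFun fun a => c a && d a :=
  (hc.cond hd (.const_bool false)).of_eq fun a => by cases c a <;> rfl

theorem PolyFun.exists_size_le {f : α → β} (h : PolyFun f) :
    ∃ q : Polynomial ℕ, ∀ a, size (f a) ≤ q.eval (size a) := by
  obtain ⟨p, q, H⟩ := h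
  exact ⟨q, fun a => by simpa using (H 1 a [] (f a) le_rfl ⟨rfl, rfl⟩).1⟩

/-! ### Folds -/

/-- A fold over a list whose step reads from the input, with intermediate results of size at
most `M`. -/
inductive FoldRun (R : γ × β × α → List ℕ → β → Prop) (g : γ) (M : ℕ) :
    List α → β → List ℕ → β → Prop
  | nil {b : β} : size b ≤ M → FoldRun R g M [] b [] b
  | cons {x : α} {l : List α} {b b' b'' : β} {u v : List ℕ} : size b ≤ M → R (g, b, x) u b' →
      FoldRun R g M l b' v b'' → FoldRun R g M (x :: l) b (u ++ v) b''

theorem PolyReads.fold {R : γ × β × α → List ℕ → β → Prop}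
    {S : γ × List α × β → List ℕ → β → Prop} (h : PolyReads R) (q : Polynomial ℕ)
    (hS : ∀ g l b w b', S (g, l, b) w b' →
      FoldRun R g (q.eval (size (g, l, b) + w.length)) l b w b') : PolyReads S := by
  let body : γ × List α × β → List ℕ → γ × List α × β → Prop := fun a w a' =>
    ∃ x, a.2.1 = x :: a'.2.1 ∧ a'.1 = a.1 ∧ R (a.1, a.2.2, x) w a'.2.2
  have hbody : PolyReads body := by
    have h1 : PolyReads fun (a : γ × List α × β) w (p : (γ × β) × α × List α) =>
        w = [] ∧ p.1 = (a.1, a.2.2) ∧ a.2.1 = p.2.1 :: p.2.2 := by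
      refine (PolyReads.pair (show PolyFun fun a : γ × List α × β => (a.1, a.2.2) by fun_prop)
        (PolyReads.uncons.comp_fun (show PolyFun fun a : γ × List α × β => a.2.1 by
          fun_prop))).mono ?_
      rintro a w p ⟨rfl, h1, h2⟩
      exact ⟨[], [], rfl, ⟨rfl, h1⟩, rfl, h2⟩
    refine (h1.comp (PolyReads.pair (show PolyFun fun p : (γ × β) × α × List α => p.1.1 by
      fun_prop) (PolyReads.pair (show PolyFun fun p : (γ × β) × α × List α => p.2.2 by fun_prop)
      (h.comp_fun (show PolyFun fun p : (γ × β) × α × List α => (p.1.1, p.1.2, p.2.1) by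
        fun_prop))))).mono ?_
    rintro ⟨g, l, b⟩ w ⟨g', l', b'⟩ ⟨x, h1, h2, h3⟩
    exact ⟨[], w, ((g, b), x, l'), rfl, ⟨rfl, rfl, h1⟩, [], w, rfl, ⟨rfl, h2⟩, [], w, rfl,
      ⟨rfl, rfl⟩, h3⟩
  have htest : PolyFun fun a : γ × List α × β => !a.2.1.isEmpty :=
    (PolyFun.isEmpty.comp (by fun_prop)).not
  have key : ∀ (g : γ) (M N : ℕ) (l : List α) (b : β) (w : List ℕ) (b' : β),
      FoldRun R g M l b w b' → size g + size l + M + 2 ≤ N →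
      LoopRun (fun a : γ × List α × β => !a.2.1.isEmpty) body N l.length (g, l, b) w
        (g, [], b') := by
    intro g M N l b w b' hr
    induction hr with
    | nil hb => exact fun hN => .done (by simp only [size_pair]; omega) rfl
    | cons hb hR hr ih =>
      intro hN
      have := hN
      rw [size_cons] at this
      exact .step (a' := (_, _, _)) (by simp only [size_pair]; omega) rfl ⟨_, rfl, rfl, hR⟩
        (ih (by omega))
  have hloop : PolyReads fun (a : γ × List α × β) w (a' : γ × List α × β) =>
      S a w a'.2.2 ∧ a' = (a.1, [], a'.2.2) := by
    refine PolyReads.loop htest hbody (q + .X + 2) ?_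
    rintro ⟨g, l, b⟩ w ⟨g', l', b'⟩ ⟨hr, h⟩
    obtain ⟨rfl, rfl⟩ : g' = g ∧ l' = [] := by simpa using h
    simp only [Polynomial.eval_add, Polynomial.eval_X, Polynomial.eval_ofNat]
    refine ⟨l.length, ?_, key _ _ _ _ _ _ _ (hS _ _ _ _ _ hr) ?_⟩
    · have := length_lt_size l
      simp only [size_pair]
      omega
    · generalize q.eval _ = x
      simp only [size_pair]
      omega
  refine (PolyFun.comp_reads (show PolyFun fun a : γ × List α × β => a.2.2 by fun_prop)
    hloop).mono ?_
  rintro ⟨g, l, b⟩ w b' hr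
  exact ⟨(g, [], b'), ⟨hr, rfl⟩, rfl⟩

theorem foldRun_foldl {α γ : Type} {f : γ → β → α → β} {g : γ} {M : ℕ} (l : List α) (b : β)
    (h : ∀ l', l' <+: l → size (l'.foldl (f g) b) ≤ M) :
    FoldRun (fun a w b' => w = [] ∧ b' = f a.1 a.2.1 a.2.2) g M l b [] (l.foldl (f g) b) := by
  induction l generalizing b with
  | nil => exact .nil (h [] (List.prefix_refl _))
  | cons x l ih =>
    exact .cons (u := []) (h [] List.nil_prefix) ⟨rfl, rfl⟩
      (ih _ fun l' hl' => h (x :: l') (by simpa using hl'))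

/-- Only the values of the fold on prefixes of the list need a size bound; the number of rounds is
bounded by the size of the list. The evaluation of plans obtains this bound from a fractional edge
cover. -/
theorem PolyFun.foldl {f : γ → β → α → β} {l : γ → List α} {i : γ → β} (q : Polynomial ℕ)
    (hf : PolyFun fun p : γ × β × α => f p.1 p.2.1 p.2.2) (hl : PolyFun l) (hi : PolyFun i)
    (hq : ∀ g l', l' <+: l g → size (l'.foldl (f g) (i g)) ≤ q.eval (size g)) :
    PolyFun fun g => (l g).foldl (f g) (i g) := by
  have : PolyReads fun (a : γ × List α × β) w b => w = [] ∧ a.2.1 = l a.1 ∧ a.2.2 = i a.1 ∧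
      b = (l a.1).foldl (f a.1) (i a.1) := by
    refine PolyReads.fold hf q ?_
    rintro g l' b w b' ⟨h1, h2, h3, h4⟩
    dsimp only at h2 h3 h4
    subst h1 h2 h3 h4
    exact foldRun_foldl _ _ fun l' hl' => (hq g l' hl').trans
      (eval_mono q (by simp only [size_pair]; omega))
  refine (this.comp_fun (PolyFun.id.pair (hl.pair hi))).mono ?_
  rintro g w b ⟨rfl, rfl⟩
  exact ⟨rfl, rfl, rfl, rfl⟩

theorem size_foldl_le {α : Type} {f : β → α → β} {B : ℕ} {l : List α} (b : β)
    (h : ∀ b, ∀ x ∈ l, size (f b x) ≤ size b + B) :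
    size (l.foldl f b) ≤ size b + l.length * B := by
  induction l generalizing b with
  | nil => simp
  | cons x l ih =>
    have h1 := h b x (by simp)
    have h2 := ih (f b x) fun b y hy => h b y (by simp [hy])
    rw [List.foldl_cons, List.length_cons, Nat.add_mul]
    omega

/-- Folds where every step increases the size by a bounded amount. -/
theorem PolyFun.foldl_of_growth {f : γ → β → α → β} {l : γ → List α} {i : γ → β}
    (hf : PolyFun fun p : γ × β × α => f p.1 p.2.1 p.2.2) (hl : PolyFun l) (hi : PolyFun i)
    (q : Polynomial ℕ) (hq : ∀ g b x, size (f g b x) ≤ size b + q.eval (size (g, x))) :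
    PolyFun fun g => (l g).foldl (f g) (i g) := by
  obtain ⟨ql, hql⟩ := hl.exists_size_le
  obtain ⟨qi, hqi⟩ := hi.exists_size_le
  refine PolyFun.foldl (qi + ql * q.comp (.X + ql + 1)) hf hl hi fun g l' hl' => ?_
  simp only [Polynomial.eval_add, Polynomial.eval_mul, Polynomial.eval_comp, Polynomial.eval_X,
    Polynomial.eval_one]
  refine (size_foldl_le (B := q.eval (size g + ql.eval (size g) + 1)) _ ?_).trans ?_
  · intro b x hx
    refine (hq g b x).trans ?_
    gcongr
    have := size_le_of_mem (hl'.subset hx)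
    have := hql g
    exact eval_mono q (by simp only [size_pair]; omega)
  · have h1 := (size_sublist hl'.sublist).trans (hql g)
    have h2 := (length_lt_size l').le.trans h1
    gcongr
    exact hqi g

theorem foldl_flip_cons {α : Type} (l acc : List α) :
    l.foldl (fun acc x => x :: acc) acc = l.reverse ++ acc := by
  induction l generalizing acc <;> simp [*]

-- Pushing elements onto an accumulator reverses their order, so `append`, `map` and `filter` below
-- are combined with a reversal.
@[fun_prop]
theorem PolyFun.reverseAux {f g : γ → List α} (hf : PolyFun f) (hg : PolyFun g) :
    PolyFun fun a => (f a).reverse ++ g a := by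
  refine (PolyFun.foldl_of_growth (f := fun (_ : γ) acc x => x :: acc) (by fun_prop) hf hg
    .X fun g b x => ?_).of_eq fun a => (foldl_flip_cons _ _).symm
  simp only [size_cons, size_pair, Polynomial.eval_X]
  omega

@[fun_prop]
theorem PolyFun.reverse {f : γ → List α} (hf : PolyFun f) : PolyFun fun a => (f a).reverse :=
  (hf.reverseAux (.const_nil)).of_eq fun a => by simp

@[fun_prop]
theorem PolyFun.append {f g : γ → List α} (hf : PolyFun f) (hg : PolyFun g) :
    PolyFun fun a => f a ++ g a :=
  (hf.reverse.reverseAux hg).of_eq fun a => by simp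

@[fun_prop]
theorem PolyFun.length {f : γ → List α} (hf : PolyFun f) : PolyFun fun a => (f a).length := by
  refine (PolyFun.foldl_of_growth (f := fun (_ : γ) (n : ℕ) (_ : α) => n + 1) (i := fun _ => 0)
    (by fun_prop) hf (by fun_prop) 0 fun g b x => ?_).of_eq fun a => ?_
  · simp [size_nat]
  · generalize f a = l
    have : ∀ n, l.foldl (fun n _ => n + 1) n = n + l.length := by
      induction l with
      | nil => simp
      | cons a l ih => intro n; rw [List.foldl_cons, ih, List.length_cons]; omega
    simp [this]

@[fun_prop]
theorem PolyFun.map {f : γ → α → β} {l : γ → List α}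
    (hf : PolyFun fun p : γ × α => f p.1 p.2) (hl : PolyFun l) :
    PolyFun fun g => (l g).map (f g) := by
  obtain ⟨q, hq⟩ := hf.exists_size_le
  refine (PolyFun.foldl_of_growth (f := fun g acc x => f g x :: acc) (i := fun _ => [])
    (((hf.comp (g := fun p : γ × List β × α => (p.1, p.2.2)) (by fun_prop))).cons (by fun_prop))
    hl (by fun_prop) (q + 1) fun g b x => ?_).reverse.of_eq fun a => ?_
  · have : size (f g x) ≤ _ := hq (g, x)
    simp only [size_cons, Polynomial.eval_add, Polynomial.eval_one]
    omega
  · rw [← List.foldl_map (f := f a) (g := fun acc x => x :: acc), foldl_flip_cons]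
    simp

@[fun_prop]
theorem PolyFun.filter {f : γ → α → Bool} {l : γ → List α}
    (hf : PolyFun fun p : γ × α => f p.1 p.2) (hl : PolyFun l) :
    PolyFun fun g => (l g).filter (f g) := by
  refine (PolyFun.foldl_of_growth (f := fun g acc x => bif f g x then x :: acc else acc)
    (i := fun _ => [])
    ((hf.comp (g := fun p : γ × List α × α => (p.1, p.2.2)) (by fun_prop)).cond (by fun_prop)
      (by fun_prop)) hl (by fun_prop) (.X + 1) fun g b x => ?_).reverse.of_eq fun a => ?_
  · cases f g x <;> simp [size_cons, size_pair]
    omega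
  · generalize l a = l
    suffices h : ∀ acc, l.foldl (fun acc x => bif f a x then x :: acc else acc) acc =
        (l.filter (f a)).reverse ++ acc by simp [h]
    induction l with
    | nil => simp
    | cons x l ih => intro acc; cases h : f a x <;> simp [ih, h]

@[fun_prop]
theorem PolyFun.any {f : γ → α → Bool} {l : γ → List α}
    (hf : PolyFun fun p : γ × α => f p.1 p.2) (hl : PolyFun l) :
    PolyFun fun g => (l g).any (f g) := by
  refine (PolyFun.foldl_of_growth (f := fun g b x => b || f g x) (i := fun _ => false)
    (PolyFun.or (by fun_prop) (hf.comp (g := fun p : γ × Bool × α => (p.1, p.2.2))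
      (by fun_prop))) hl (by fun_prop) 0 fun g b x => ?_).of_eq fun a => ?_
  · simp [size_bool]
  · generalize l a = l
    suffices h : ∀ b, l.foldl (fun b x => b || f a x) b = (b || l.any (f a)) by simp [h]
    induction l with
    | nil => simp
    | cons x l ih => intro b; simp [ih, Bool.or_assoc]

@[fun_prop]
theorem PolyFun.all {f : γ → α → Bool} {l : γ → List α}
    (hf : PolyFun fun p : γ × α => f p.1 p.2) (hl : PolyFun l) :
    PolyFun fun g => (l g).all (f g) :=
  (PolyFun.any (f := fun g x => !f g x) hf.not hl).not.of_eq fun a => by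
    simp [List.all_eq_not_any_not]

@[fun_prop]
theorem PolyFun.flatMap {f : γ → α → List β} {l : γ → List α}
    (hf : PolyFun fun p : γ × α => f p.1 p.2) (hl : PolyFun l) :
    PolyFun fun g => (l g).flatMap (f g) := by
  obtain ⟨q, hq⟩ := hf.exists_size_le
  refine (PolyFun.foldl_of_growth (f := fun g acc x => acc ++ f g x) (i := fun _ => [])
    (PolyFun.append (by fun_prop) ((hf.comp (g := fun p : γ × List β × α => (p.1, p.2.2))
      (by fun_prop)))) hl (by fun_prop) q fun g b x => ?_).of_eq fun a => ?_
  · have : size (f g x) ≤ _ := hq (g, x)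
    have := size_append b (f g x)
    omega
  · generalize l a = l
    suffices h : ∀ acc, l.foldl (fun acc x => acc ++ f a x) acc = acc ++ l.flatMap (f a) by
      simp [h]
    induction l with
    | nil => simp
    | cons x l ih => intro b; simp [ih]

@[fun_prop]
theorem PolyFun.contains {f : γ → List ℕ} {g : γ → ℕ} (hf : PolyFun f) (hg : PolyFun g) :
    PolyFun fun a => (f a).contains (g a) :=
  (PolyFun.any (f := fun a x => g a == x) ((hg.comp .prod_fst).beq .prod_snd) hf).of_eq fun a => by
    rw [List.contains_eq_any_beq]

theorem PolyFun.getLastD {f : γ → List α} {i : γ → α} (hf : PolyFun f) (hi : PolyFun i) :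
    PolyFun fun a => (f a).getLastD (i a) :=
  (PolyFun.foldl_of_growth (f := fun _ _ x => x) (by fun_prop) hf hi .X fun g b x => by
    simp only [size_pair, Polynomial.eval_X]; omega).of_eq fun a => by
    generalize f a = l
    generalize i a = b
    induction l generalizing b with
    | nil => rfl
    | cons x l ih => rw [List.getLastD_cons, ih, List.foldl_cons]

/-! ### Reading a given number of items -/

/-- The announced number of items is a single number of size 1 and could be arbitrarily large; it
must be bounded by the length of what is read. The slack of 1 admits a table without columns, whose
only possible row takes up no input. -/
theorem PolyReads.readMany {R : γ → List ℕ → β → Prop} (h : PolyReads R) :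
    PolyReads fun (a : γ × ℕ) w (l : List β) => a.2 ≤ w.length + 1 ∧ l.length = a.2 ∧
      ∃ ws : List (List ℕ), List.Forall₂ (R a.1) ws l ∧ w = ws.flatten := by
  let body : γ × ℕ × List β → List ℕ → γ × ℕ × List β → Prop := fun a w a' =>
    a'.1 = a.1 ∧ a'.2.1 = a.2.1 - 1 ∧ ∃ b, R a.1 w b ∧ a'.2.2 = b :: a.2.2
  have hbody : PolyReads body := by
    have h1 := PolyReads.pair (show PolyFun fun a : γ × ℕ × List β => a by fun_prop)
      (h.comp_fun (show PolyFun fun a : γ × ℕ × List β => a.1 by fun_prop))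
    refine (PolyFun.comp_reads (show PolyFun fun p : (γ × ℕ × List β) × β =>
      (p.1.1, p.1.2.1 - 1, p.2 :: p.1.2.2) by fun_prop) h1).mono ?_
    rintro ⟨g, n, l⟩ w ⟨g', n', l'⟩ ⟨h1, h2, b, h3, h4⟩
    refine ⟨((g, n, l), b), ⟨[], w, rfl, ⟨rfl, rfl⟩, h3⟩, ?_⟩
    simp_all
  have htest : PolyFun fun a : γ × ℕ × List β => !(a.2.1 == 0) := by fun_prop
  obtain ⟨pr, q, hq⟩ := id h
  have key : ∀ (g : γ) (B N : ℕ) (ws : List (List ℕ)) (l acc : List β),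
      List.Forall₂ (R g) ws l → (∀ b ∈ l, size b ≤ B) →
      size g + size acc + l.length * (B + 1) + 3 ≤ N →
      LoopRun (fun a : γ × ℕ × List β => !(a.2.1 == 0)) body N l.length (g, l.length, acc)
        ws.flatten (g, 0, l.reverse ++ acc) := by
    intro g B N ws l acc hl
    induction hl generalizing acc with
    | nil =>
      intro _ hN
      exact .done (by simp only [size_pair, size_nat]; omega) rfl
    | @cons u b ws l hR hl ih =>
      intro hB hN
      have hb := hB b (by simp)
      rw [List.length_cons, Nat.add_mul] at hN
      refine .step (a' := (g, l.length, b :: acc)) (by simp only [size_pair, size_nat]; omega)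
        (by simp) ⟨rfl, by simp, b, hR, rfl⟩ ?_
      rw [List.reverse_cons, List.append_assoc, List.singleton_append]
      exact ih (b :: acc) (fun b hb => hB b (by simp [hb])) (by rw [size_cons]; omega)
  have hloop : PolyReads fun (a : γ × ℕ × List β) w (a' : γ × ℕ × List β) =>
      a.2.2 = [] ∧ a'.1 = a.1 ∧ a'.2.1 = 0 ∧ a.2.1 ≤ w.length + 1 ∧ a'.2.2.length = a.2.1 ∧
      ∃ ws : List (List ℕ), List.Forall₂ (R a.1) ws a'.2.2.reverse ∧ w = ws.flatten := by
    refine PolyReads.loop htest hbody ((.X + 1) * (q + 1) + .X + 4) ?_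
    rintro ⟨g, n, l⟩ w ⟨g', n', l'⟩ ⟨h1, h2, h3, h4, h5, ws, h6, rfl⟩
    dsimp only at h1 h2 h3 h4 h5 h6 ⊢
    subst h1 h2 h3
    simp only [Polynomial.eval_add, Polynomial.eval_mul, Polynomial.eval_X, Polynomial.eval_one,
      Polynomial.eval_ofNat]
    set W := ws.flatten.length
    set X := size (g', n, ([] : List β)) + W with hX
    simp only [size_pair, size_nat, size_nil] at hX
    have hn : n ≤ X + 1 := by omega
    refine ⟨n, by nlinarith [Nat.zero_le (q.eval X)], ?_⟩
    have hB : ∀ b ∈ l'.reverse, size b ≤ q.eval X := by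
      intro b hb
      obtain ⟨i, hi, rfl⟩ := List.mem_iff_getElem.1 hb
      have hi' : i < ws.length := by rw [h6.length_eq]; exact hi
      have hR := (List.forall₂_iff_get.1 h6).2 i hi' hi
      -- The size bound does not depend on the register, so any admissible one can be inserted.
      refine (hq 1 g' _ _ le_rfl hR).1.trans (eval_mono q ?_)
      have : ws[i].length ≤ W := by
        simp only [W, List.length_flatten]
        exact List.single_le_sum (by simp) _ (List.mem_map_of_mem (List.getElem_mem hi'))
      simp only [List.get_eq_getElem]
      omega
    have := key g' (q.eval X) ((X + 1) * (q.eval X + 1) + X + 4) ws l'.reverse [] h6 hB (by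
      rw [List.length_reverse, h5, size_nil]
      have := Nat.mul_le_mul_right (q.eval X + 1) hn
      omega)
    rw [List.length_reverse, h5] at this
    simpa using this
  refine (PolyFun.comp_reads (show PolyFun fun a : γ × ℕ × List β => a.2.2.reverse by fun_prop)
    (hloop.comp_fun (show PolyFun fun a : γ × ℕ => (a.1, a.2, ([] : List β)) by fun_prop))).mono ?_
  rintro ⟨g, n⟩ w l ⟨h1, h2, ws, h3, h4⟩
  exact ⟨(g, 0, l.reverse), ⟨rfl, rfl, rfl, h1, by simpa using h2, ws, by simpa using h3, h4⟩,
    by simp⟩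

end

end JoinQuery.RAM

namespace JoinQuery

open JoinQuery.RAM

/-! ### Tables as lists -/

/-- A row of a table: a list of pairs of an attribute and a value. -/
abbrev Row : Type := List (ℕ × ℕ)

/-- A table: the attributes of its columns and its rows. -/
abbrev Table : Type := List ℕ × List Row

/-- The last matching pair wins and the default is 0. Neither choice matters for attributes that
occur in a row whose pairs come from one function (`Row.val_eq`). -/
def Row.val (r : Row) (a : ℕ) : ℕ := r.foldl (fun v p => bif p.1 == a then p.2 else v) 0

def Row.agree (C : List ℕ) (r r' : Row) : Bool := C.all fun a => r.val a == r'.val a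

def distinctRows (C : List ℕ) (rows : List Row) : List Row :=
  rows.foldl (fun acc r => bif acc.any fun r' => Row.agree C r r' then acc else r :: acc) []

/-- Different rows may have the same projection, so duplicates must be removed; a join creates none.
-/
def Table.proj (B : List ℕ) (T : Table) : Table :=
  (T.1.filter fun a => B.contains a, distinctRows (T.1.filter fun a => B.contains a)
    (T.2.map fun r => (T.1.filter fun a => B.contains a).map fun a => (a, r.val a)))

def Row.merge (C A : List ℕ) (r r' : Row) : Row :=
  C.map fun a => (a, bif A.contains a then r.val a else r'.val a)

def Table.join (S T : Table) : Table :=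
  (S.1 ++ T.1.filter fun a => !S.1.contains a,
    S.2.flatMap fun r => (T.2.filter fun r' =>
      Row.agree (S.1.filter fun a => T.1.contains a) r r').map fun r' =>
        Row.merge (S.1 ++ T.1.filter fun a => !S.1.contains a) S.1 r r')

/-- The table as a sequence of numbers. -/
def Table.code (T : Table) : List ℕ :=
  T.1.length :: T.1 ++ T.2.length :: T.2.flatMap fun r => T.1.map fun a => r.val a

/-- Starting from the list `B`, the attributes in `L` are added one after the other; at every stage
the current list is paired with all elements of `ts`. -/
def steps {τ : Type} (ts : List τ) : List ℕ → List ℕ → List (List ℕ × τ)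
  | B, [] => ts.map fun x => (B, x)
  | B, a :: L => ts.map (fun x => (B, x)) ++ steps ts (bif B.contains a then B else a :: B) L

section

open JoinQuery.RAM.Rep

variable {γ α τ : Type} [Rep γ] [Rep α] [Rep τ]

@[fun_prop]
theorem polyFun_val {r : γ → Row} {a : γ → ℕ} (hr : PolyFun r) (ha : PolyFun a) :
    PolyFun fun g => (r g).val (a g) :=
  PolyFun.foldl_of_growth (f := fun g v (p : ℕ × ℕ) => bif p.1 == a g then p.2 else v)
    (i := fun _ => 0) (by fun_prop) hr (by fun_prop) 0 fun g b x => by simp [size_nat]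

@[fun_prop]
theorem polyFun_agree {C : γ → List ℕ} {r r' : γ → Row} (hC : PolyFun C) (hr : PolyFun r)
    (hr' : PolyFun r') : PolyFun fun g => Row.agree (C g) (r g) (r' g) := by
  unfold Row.agree
  fun_prop

@[fun_prop]
theorem polyFun_distinctRows {C : γ → List ℕ} {l : γ → List Row} (hC : PolyFun C)
    (hl : PolyFun l) : PolyFun fun g => distinctRows (C g) (l g) := by
  refine PolyFun.foldl_of_growth (f := fun g acc r => bif acc.any fun r' => Row.agree (C g) r r'
    then acc else r :: acc) (i := fun _ => []) (by fun_prop) hl (by fun_prop) (.X + 1)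
    fun g b x => ?_
  cases b.any fun r' => Row.agree (C g) x r' <;> simp [size_cons, size_pair]
  omega

@[fun_prop]
theorem polyFun_proj {B : γ → List ℕ} {T : γ → Table} (hB : PolyFun B) (hT : PolyFun T) :
    PolyFun fun g => Table.proj (B g) (T g) := by
  unfold Table.proj
  fun_prop

@[fun_prop]
theorem polyFun_merge {C A : γ → List ℕ} {r r' : γ → Row} (hC : PolyFun C) (hA : PolyFun A)
    (hr : PolyFun r) (hr' : PolyFun r') : PolyFun fun g => Row.merge (C g) (A g) (r g) (r' g) := by
  unfold Row.merge
  fun_prop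

@[fun_prop]
theorem polyFun_join {S T : γ → Table} (hS : PolyFun S) (hT : PolyFun T) :
    PolyFun fun g => Table.join (S g) (T g) := by
  unfold Table.join
  fun_prop

@[fun_prop]
theorem polyFun_code {T : γ → Table} (hT : PolyFun T) : PolyFun fun g => (T g).code := by
  unfold Table.code
  fun_prop

/-- Turns the recursion, which passes its list `B` downwards, into a left fold on pairs of the
current list and the output, so that it can be programmed. -/
theorem foldl_steps {τ : Type} (ts : List τ) (L B : List ℕ) (out : List (List ℕ × τ)) :
    (L.foldl (fun (acc : List ℕ × List (List ℕ × τ)) a =>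
      (bif acc.1.contains a then acc.1 else a :: acc.1,
        acc.2 ++ ts.map fun x => (bif acc.1.contains a then acc.1 else a :: acc.1, x)))
      (B, out ++ ts.map fun x => (B, x))).2 = out ++ steps ts B L := by
  induction L generalizing B out with
  | nil => simp [steps]
  | cons a L ih => rw [List.foldl_cons, steps, ← List.append_assoc, ← ih]

/-- Each attribute enlarges the current list by at most 2 and the output by one block of size at
most `M`. As the growth depends on the current list, `PolyFun.foldl_of_growth` does not apply. -/
theorem size_foldl_steps_le (ts : List τ) {N M : ℕ}
    (hM : ∀ B : List ℕ, size B ≤ N → size (ts.map fun x => (B, x)) ≤ M) (L B : List ℕ)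
    (out : List (List ℕ × τ)) (hN : size B + 2 * L.length ≤ N) :
    size (L.foldl (fun (acc : List ℕ × List (List ℕ × τ)) a =>
      (bif acc.1.contains a then acc.1 else a :: acc.1,
        acc.2 ++ ts.map fun x => (bif acc.1.contains a then acc.1 else a :: acc.1, x)))
      (B, out)) ≤ N + size out + L.length * M + 1 := by
  induction L generalizing B out with
  | nil =>
    simp only [List.length_nil] at hN
    simp only [List.foldl_nil, size_pair, List.length_nil]
    omega
  | cons a L ih =>
    simp only [List.length_cons] at hN
    have hB : size (bif B.contains a then B else a :: B) ≤ size B + 2 := by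
      cases B.contains a <;> simp [size_cons, size_nat]
      omega
    have h1 := hM (bif B.contains a then B else a :: B) (by omega)
    have h2 := size_append out (ts.map fun x => (bif B.contains a then B else a :: B, x))
    refine (ih _ _ (by dsimp only; omega)).trans ?_
    dsimp only
    rw [List.length_cons, Nat.add_mul]
    omega

@[fun_prop]
theorem polyFun_steps {ts : γ → List τ} {L : γ → List ℕ} (ht : PolyFun ts) (hL : PolyFun L) :
    PolyFun fun g => steps (ts g) [] (L g) := by
  have hmap : PolyFun fun p : List ℕ × List τ => p.2.map fun x => (p.1, x) := by fun_prop
  obtain ⟨q, hq⟩ := hmap.exists_size_le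
  obtain ⟨qt, hqt⟩ := ht.exists_size_le
  obtain ⟨qL, hqL⟩ := hL.exists_size_le
  have hfold : PolyFun fun g => (L g).foldl (fun (acc : List ℕ × List (List ℕ × τ)) a =>
      (bif acc.1.contains a then acc.1 else a :: acc.1,
        acc.2 ++ (ts g).map fun x => (bif acc.1.contains a then acc.1 else a :: acc.1, x)))
      ([], (ts g).map fun x => ([], x)) := by
    refine PolyFun.foldl (f := fun g (acc : List ℕ × List (List ℕ × τ)) a =>
      (bif acc.1.contains a then acc.1 else a :: acc.1,
        acc.2 ++ (ts g).map fun x => (bif acc.1.contains a then acc.1 else a :: acc.1, x)))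
      ((1 + 2 * qL) + q.comp (2 + 2 * qL + qt) + qL * q.comp (2 + 2 * qL + qt) + 1)
      (by fun_prop) hL (by fun_prop) fun g l' hl' => ?_
    have h1 := hqt g
    have h3 := (size_sublist hl'.sublist).trans (hqL g)
    have h4 := (length_lt_size l').le.trans h3
    simp only [Polynomial.eval_add, Polynomial.eval_mul, Polynomial.eval_comp, Polynomial.eval_one,
      Polynomial.eval_ofNat]
    set a := qL.eval (size g)
    set b := qt.eval (size g)
    have hM : ∀ B : List ℕ, size B ≤ 1 + 2 * a →
        size ((ts g).map fun x => (B, x)) ≤ q.eval (2 + 2 * a + b) := fun B hB =>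
      (hq (B, ts g)).trans (eval_mono q (by simp only [size_pair]; omega))
    refine (size_foldl_steps_le (ts g) hM l' [] _ (by rw [size_nil]; omega)).trans ?_
    have h5 := hM [] (by rw [size_nil]; omega)
    gcongr
  refine hfold.snd.of_eq fun g => ?_
  have := foldl_steps (ts g) (L g) [] []
  rw [List.nil_append] at this
  rw [this, List.nil_append]

/-! ### Reading queries and tables -/

theorem forall₂_singleton (l : List ℕ) :
    List.Forall₂ (fun (w : List ℕ) (n : ℕ) => w = [n]) (l.map fun n => [n]) l := by
  induction l <;> simp [*]

theorem flatten_map_singleton (l : List ℕ) : (l.map fun n => [n]).flatten = l := by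
  induction l <;> simp [*]

theorem PolyReads.readList : PolyReads fun (_ : α) w (l : List ℕ) => w = l.length :: l := by
  refine (PolyReads.comp (PolyReads.pair (PolyFun.const_unit (α := α)) PolyReads.readNat)
    (PolyReads.readMany PolyReads.readNat)).mono ?_
  rintro a w l rfl
  exact ⟨[l.length], l, ((), l.length), rfl, ⟨[], _, rfl, ⟨rfl, rfl⟩, rfl⟩, by simp, rfl,
    l.map fun n => [n], forall₂_singleton l, (flatten_map_singleton l).symm⟩

theorem PolyReads.readRow : PolyReads fun (C : List ℕ) w (r : Row) =>
    w.length = C.length ∧ r = (C.zip w).reverse := by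
  have hstep : PolyReads fun (a : Unit × Row × ℕ) w (r : Row) =>
      ∃ x, w = [x] ∧ r = (a.2.2, x) :: a.2.1 := by
    refine (PolyFun.comp_reads (show PolyFun fun p : (Unit × Row × ℕ) × ℕ =>
      (p.1.2.2, p.2) :: p.1.2.1 by fun_prop) (PolyReads.pair PolyFun.id PolyReads.readNat)).mono ?_
    rintro a w r ⟨x, rfl, rfl⟩
    exact ⟨(a, x), ⟨[], [x], rfl, ⟨rfl, rfl⟩, rfl⟩, rfl⟩
  have hfold : PolyReads fun (a : Unit × List ℕ × Row) w (r : Row) =>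
      w.length = a.2.1.length ∧ r = (a.2.1.zip w).reverse ++ a.2.2 := by
    -- Each column adds a pair of numbers, of size 3, and one cons.
    refine PolyReads.fold hstep (4 * .X) ?_
    rintro g C b w b' ⟨hl, rfl⟩
    have key : ∀ (C w : List ℕ) (b : Row) (M : ℕ), w.length = C.length →
        size b + 4 * C.length ≤ M → FoldRun (fun (a : Unit × Row × ℕ) w (r : Row) =>
          ∃ x, w = [x] ∧ r = (a.2.2, x) :: a.2.1) g M C b w ((C.zip w).reverse ++ b) := by
      intro C
      induction C with
      | nil =>
        intro w b M hl hM
        obtain rfl := List.length_eq_zero_iff.1 hl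
        exact .nil (by simpa using hM)
      | cons c C ih =>
        intro w b M hl hM
        obtain ⟨x, w, rfl⟩ := List.exists_cons_of_length_eq_add_one hl
        rw [List.length_cons] at hM
        have := ih w ((c, x) :: b) M (by simpa using hl)
          (by simp only [size_cons, size_pair, size_nat]; omega)
        simpa using FoldRun.cons (u := [x]) (b := b) (by omega) ⟨x, rfl, rfl⟩ this
    refine key C w b _ hl ?_
    simp only [Polynomial.eval_mul, Polynomial.eval_X, Polynomial.eval_ofNat, size_pair]
    have := length_lt_size C
    omega
  refine (hfold.comp_fun (show PolyFun fun C : List ℕ => ((), C, ([] : Row)) by fun_prop)).mono ?_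
  rintro C w r ⟨h1, h2⟩
  exact ⟨h1, by simpa using h2⟩

/-- The sequence `w` lists the table `T`. -/
def Table.Listing (w : List ℕ) (T : Table) : Prop :=
  ∃ rows : List (List ℕ), (∀ r ∈ rows, r.length = T.1.length) ∧
    rows.length ≤ rows.flatten.length + 1 ∧ w = T.1.length :: T.1 ++ rows.length :: rows.flatten ∧
    T.2 = rows.map fun r => (T.1.zip r).reverse

theorem PolyReads.readTable : PolyReads fun (_ : α) w (T : Table) => T.Listing w := by
  have h1 := PolyReads.pair (PolyFun.id (α := List ℕ))
    (PolyReads.comp (PolyReads.pair PolyFun.id PolyReads.readNat)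
      (PolyReads.readMany PolyReads.readRow))
  refine (PolyReads.comp (PolyReads.readList (α := α)) h1).mono ?_
  rintro _ w ⟨C, R⟩ ⟨rows, hlen, hle, rfl, hR⟩
  dsimp only at *
  subst hR
  refine ⟨C.length :: C, rows.length :: rows.flatten, C, by simp, rfl, [], _, rfl, ⟨rfl, rfl⟩,
    [rows.length], rows.flatten, (C, rows.length), rfl, ⟨[], _, rfl, ⟨rfl, rfl⟩, rfl⟩, hle,
    by simp, rows, ?_, rfl⟩
  rw [List.forall₂_map_right_iff, List.forall₂_same]
  exact fun r hr => ⟨hlen r hr, rfl⟩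

/-- The relation names of a query with their sorted lists of attributes. -/
def Query.data (Q : Query) : List (ℕ × List ℕ) :=
  Q.rels.map fun R => (R.name, R.attrs.sort (· ≤ ·))

theorem PolyReads.readQuery : PolyReads fun (_ : α) w (q : List (ℕ × List ℕ)) =>
    ∃ Q : Query, w = Q.code ∧ q = Q.data := by
  have hrel : PolyReads fun (_ : Unit) w (p : ℕ × List ℕ) => w = p.1 :: p.2.length :: p.2 := by
    refine (PolyReads.pair PolyReads.readNat PolyReads.readList).mono ?_
    rintro a w p rfl
    exact ⟨[p.1], _, rfl, rfl, rfl⟩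
  refine (PolyReads.comp (PolyReads.pair (PolyFun.const_unit (α := α)) PolyReads.readNat)
    (PolyReads.readMany hrel)).mono ?_
  rintro a w q ⟨Q, rfl, rfl⟩
  refine ⟨[Q.rels.length], Q.rels.flatMap RelName.code, ((), Q.rels.length), rfl,
    ⟨[], _, rfl, ⟨rfl, rfl⟩, rfl⟩, ?_, by simp [Query.data], Q.rels.map RelName.code, ?_, by
      rw [List.flatMap]⟩
  · generalize Q.rels = l
    induction l with
    | nil => simp
    | cons R l ih =>
      have : 1 ≤ R.code.length := by simp [RelName.code]
      simp only [List.length_cons, List.flatMap_cons, List.length_append] at *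
      omega
  · rw [Query.data, List.forall₂_map_left_iff, List.forall₂_map_right_iff, List.forall₂_same]
    intro R _
    simp [RelName.code]

/-- The sequence `w` lists the query data and the tables in `p`. -/
def InputListing (w : List ℕ) (p : List (ℕ × List ℕ) × List Table) : Prop :=
  ∃ Q : Query, p.1 = Q.data ∧ ∃ vs : List (List ℕ), List.Forall₂ Table.Listing vs p.2 ∧
    p.2.length = Q.rels.length ∧ w = Q.code ++ vs.flatten

theorem PolyReads.readInput : PolyReads fun (_ : Unit) w p => InputListing w p := by
  refine (PolyReads.comp (PolyReads.readQuery (α := Unit)) (PolyReads.pair (PolyFun.id)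
    ((PolyReads.readMany (PolyReads.readTable (α := Unit))).comp_fun
      (show PolyFun fun q : List (ℕ × List ℕ) => ((), q.length) by fun_prop)))).mono ?_
  rintro a w ⟨q, ts⟩ ⟨Q, hq, vs, h1, h2, rfl⟩
  dsimp only at hq h1 h2
  subst hq
  refine ⟨Q.code, vs.flatten, Q.data, rfl, ⟨Q, rfl, rfl⟩, [], _, rfl, ⟨rfl, rfl⟩, ?_,
    by simpa [Query.data] using h2, vs, h1, rfl⟩
  have : Q.data.length = ts.length := by simp [Query.data, h2]
  dsimp only
  rw [this, ← h1.length_eq]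
  have hne : ∀ v ∈ vs, 1 ≤ v.length := by
    intro v hv
    obtain ⟨i, hi, rfl⟩ := List.mem_iff_getElem.1 hv
    obtain ⟨_, _, _, h, _⟩ := (List.forall₂_iff_get.1 h1).2 i hi (by rw [← h1.length_eq]; exact hi)
    simp only [List.get_eq_getElem] at h
    simp [h]
  clear h1
  induction vs with
  | nil => simp
  | cons v vs ih =>
    have := hne v (by simp)
    have := ih fun u hu => hne u (by simp [hu])
    simp only [List.length_cons, List.flatten_cons, List.length_append]
    omega

end

end JoinQuery

namespace JoinQuery

open JoinQuery.RAM

/-! ### Tables representing relations -/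

/-- The `A`-tuple given by a row. -/
def Row.toTup (A : Finset ℕ) (r : Row) : Tup A := fun a => r.val a.1

theorem Row.val_eq {r : Row} {g : ℕ → ℕ} (h : ∀ p ∈ r, p.2 = g p.1) {a : ℕ}
    (ha : ∃ p ∈ r, p.1 = a) : r.val a = g a := by
  -- Strengthened for the induction: either the accumulator is already correct or a match is still
  -- to come.
  suffices H : ∀ v, (v = g a ∨ ∃ p ∈ r, p.1 = a) →
      r.foldl (fun v p => bif p.1 == a then p.2 else v) v = g a from H 0 (Or.inr ha)
  clear ha
  induction r with
  | nil => simp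
  | cons p r ih =>
    intro v hv
    have hp := h p (by simp)
    refine ih (fun q hq => h q (by simp [hq])) _ ?_
    by_cases e : p.1 = a
    · simp [e, hp]
    · have e' : (p.1 == a) = false := by simpa using e
      simp only [List.exists_mem_cons_iff, e, false_or] at hv
      simpa only [e', cond_false] using hv

theorem Row.val_map {C : List ℕ} {g : ℕ → ℕ} {a : ℕ} (ha : a ∈ C) :
    Row.val (C.map fun a => (a, g a)) a = g a :=
  Row.val_eq (by simp) ⟨(a, g a), by simpa using ha, rfl⟩

theorem Row.agree_iff {C : List ℕ} {r r' : Row} :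
    Row.agree C r r' = true ↔ ∀ a ∈ C, r.val a = r'.val a := by
  simp [Row.agree]

theorem Row.toTup_eq_iff {C : List ℕ} {A : Finset ℕ} (h : C.toFinset = A) {r r' : Row} :
    r.toTup A = r'.toTup A ↔ Row.agree C r r' = true := by
  subst h
  simp [Row.agree_iff, funext_iff, Row.toTup]

theorem distinctRows_spec {C : List ℕ} {A : Finset ℕ} (h : C.toFinset = A) (rows : List Row) :
    ((distinctRows C rows).map (Row.toTup A)).Nodup ∧ distinctRows C rows ⊆ rows ∧
      ∀ t, t ∈ (distinctRows C rows).map (Row.toTup A) ↔ t ∈ rows.map (Row.toTup A) := by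
  suffices H : ∀ rows acc : List Row, (acc.map (Row.toTup A)).Nodup →
      ((rows.foldl (fun acc r => bif acc.any fun r' => Row.agree C r r' then acc else r :: acc)
        acc).map (Row.toTup A)).Nodup ∧
      (rows.foldl (fun acc r => bif acc.any fun r' => Row.agree C r r' then acc else r :: acc)
        acc) ⊆ rows ++ acc ∧
      ∀ t, t ∈ (rows.foldl (fun acc r => bif acc.any fun r' => Row.agree C r r' then acc
        else r :: acc) acc).map (Row.toTup A) ↔ t ∈ (rows ++ acc).map (Row.toTup A) by
    have := H rows [] (by simp)
    rwa [List.append_nil] at this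
  intro rows
  induction rows with
  | nil => intro acc hacc; simp [hacc]
  | cons r rows ih =>
    intro acc hacc
    have hany : (acc.any fun r' => Row.agree C r r') = true ↔
        r.toTup A ∈ acc.map (Row.toTup A) := by
      simp only [List.any_eq_true, List.mem_map]
      exact exists_congr fun r' => and_congr_right fun _ => by
        rw [← Row.toTup_eq_iff h, eq_comm]
    rw [List.foldl_cons]
    cases hc : acc.any fun r' => Row.agree C r r'
    · have hr : r.toTup A ∉ acc.map (Row.toTup A) := by rw [← hany, hc]; simp
      obtain ⟨h1, h2, h3⟩ := ih (r :: acc) (by rw [List.map_cons, List.nodup_cons]; exact ⟨hr, hacc⟩)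
      refine ⟨h1, fun x hx => ?_, fun t => (h3 t).trans ?_⟩
      · have := h2 hx
        simp only [List.mem_append, List.mem_cons] at this ⊢
        tauto
      · simp only [List.map_append, List.map_cons, List.mem_append, List.mem_cons]
        tauto
    · have hr := hany.1 hc
      obtain ⟨h1, h2, h3⟩ := ih acc hacc
      refine ⟨h1, fun x hx => ?_, fun t => (h3 t).trans ?_⟩
      · have := h2 hx
        simp only [List.mem_append, List.cons_append, List.mem_cons] at this ⊢
        tauto
      · simp only [List.map_append, List.map_cons, List.mem_append, List.cons_append,
          List.mem_cons]
        constructor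
        · tauto
        · rintro (rfl | h | h)
          · exact Or.inr hr
          · exact Or.inl h
          · exact Or.inr h

/-- The table `T` represents the `A`-relation `S`. -/
structure Table.Represents {A : Finset ℕ} (T : Table) (S : Set (Tup A)) : Prop where
  nodup_cols : T.1.Nodup
  cols : T.1.toFinset = A
  width : ∀ r ∈ T.2, r.length = T.1.length
  nodup_rows : (T.2.map (Row.toTup A)).Nodup
  mem_rows : ∀ t, t ∈ T.2.map (Row.toTup A) ↔ t ∈ S

theorem Table.Represents.mem_cols {A : Finset ℕ} {T : Table} {S : Set (Tup A)}
    (h : T.Represents S) {a : ℕ} : a ∈ T.1 ↔ a ∈ A := by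
  rw [← h.cols, List.mem_toFinset]

theorem Table.Represents.length_cols {A : Finset ℕ} {T : Table} {S : Set (Tup A)}
    (h : T.Represents S) : T.1.length = A.card := by
  rw [← h.cols, List.toFinset_card_of_nodup h.nodup_cols]

theorem Table.Represents.length_rows {A : Finset ℕ} {T : Table} {S : Set (Tup A)}
    (h : T.Represents S) : T.2.length = S.ncard := by
  classical
  have : S = ((T.2.map (Row.toTup A)).toFinset : Set (Tup A)) := by
    ext t
    simp only [List.coe_toFinset, Set.mem_ofPred_eq]
    exact (h.mem_rows t).symm
  rw [this, Set.ncard_coe_finset, List.toFinset_card_of_nodup h.nodup_rows, List.length_map]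

theorem Table.Represents.isTable {A : Finset ℕ} {T : Table} {S : Set (Tup A)}
    (h : T.Represents S) : IsTable S T.code := by
  refine ⟨T.1, T.2.map (Row.toTup A), h.nodup_cols, h.cols, h.nodup_rows, h.mem_rows, ?_⟩
  rw [Table.code, List.length_map, List.flatMap_map]
  congr 3
  funext r
  refine List.map_congr_left fun a ha => ?_
  rw [Tup.entry, dif_pos (h.mem_cols.1 ha), Row.toTup]

theorem Table.Represents.size_le {A : Finset ℕ} {T : Table} {S : Set (Tup A)}
    (h : T.Represents S) :
    Rep.size T ≤ 2 * A.card + S.ncard * (4 * A.card + 2) + 3 := by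
  have h1 : Rep.size T.1 ≤ T.1.length * (1 + 1) + 1 :=
    size_le_of_forall_le fun a _ => (size_nat a).le
  have h2 : Rep.size T.2 ≤ T.2.length * (4 * A.card + 2) + 1 := by
    refine size_le_of_forall_le (M := 4 * A.card + 1) fun r hr => ?_
    have : Rep.size r ≤ r.length * (3 + 1) + 1 :=
      size_le_of_forall_le fun p _ => by simp [size_pair, size_nat]
    rw [h.width r hr, h.length_cols] at this
    omega
  rw [h.length_cols] at h1
  rw [h.length_rows] at h2
  rw [size_pair]
  omega

theorem Table.Represents.proj {A : Finset ℕ} {T : Table} {S : Set (Tup A)}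
    (h : T.Represents S) (B : List ℕ) : (T.proj B).Represents
      {t : Tup (B.toFinset ∩ A) | ∃ s ∈ S, t = s.proj Finset.inter_subset_right} := by
  have hC : (T.1.filter fun a => B.contains a).toFinset = B.toFinset ∩ A := by
    ext a
    simp [h.mem_cols, and_comm]
  obtain ⟨h1, h2, h3⟩ := distinctRows_spec hC
    (T.2.map fun r => (T.1.filter fun a => B.contains a).map fun a => (a, r.val a))
  refine ⟨h.nodup_cols.filter _, hC, fun r hr => ?_, h1, fun t => (h3 t).trans ?_⟩
  · obtain ⟨r', -, rfl⟩ := List.mem_map.1 (h2 hr)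
    simp [Table.proj]
  · have key : ∀ r : Row, Row.toTup (B.toFinset ∩ A)
        ((T.1.filter fun a => B.contains a).map fun a => (a, r.val a)) =
        (r.toTup A).proj Finset.inter_subset_right := by
      intro r
      funext a
      have : a.1 ∈ T.1.filter fun a => B.contains a := by
        rw [← List.mem_toFinset, hC]; exact a.2
      exact Row.val_map this
    simp only [List.mem_map, Set.mem_ofPred_eq, ← h.mem_rows]
    constructor
    · rintro ⟨_, ⟨r, hr, rfl⟩, rfl⟩
      exact ⟨_, ⟨r, hr, rfl⟩, key r⟩
    · rintro ⟨_, ⟨r, hr, rfl⟩, rfl⟩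
      exact ⟨_, ⟨r, hr, rfl⟩, key r⟩

theorem Table.Represents.join {A A' : Finset ℕ} {T T' : Table} {S : Set (Tup A)}
    {S' : Set (Tup A')} (h : T.Represents S) (h' : T'.Represents S') :
    (T.join T').Represents {t : Tup (A ∪ A') |
      t.proj Finset.subset_union_left ∈ S ∧ t.proj Finset.subset_union_right ∈ S'} := by
  have hC : ∀ a, a ∈ (T.1 ++ T'.1.filter fun a => !T.1.contains a) ↔ a ∈ A ∪ A' := by
    intro a
    simp only [List.mem_append, List.mem_filter, h.mem_cols, h'.mem_cols, Finset.mem_union,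
      Bool.not_eq_true', List.contains_eq_mem, decide_eq_false_iff_not]
    tauto
  have hI : ∀ a, a ∈ (T.1.filter fun a => T'.1.contains a) ↔ a ∈ A ∧ a ∈ A' := by
    simp [h.mem_cols, h'.mem_cols]
  have kl : ∀ r r' : Row, (Row.toTup (A ∪ A') (Row.merge
      (T.1 ++ T'.1.filter fun a => !T.1.contains a) T.1 r r')).proj
        Finset.subset_union_left = r.toTup A := by
    intro r r'
    funext a
    refine (Row.val_map ((hC _).2 (Finset.subset_union_left a.2))).trans ?_
    have : T.1.contains a.1 = true := by simpa using h.mem_cols.2 a.2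
    simp only [this, cond_true, Row.toTup]
  have kr : ∀ r r' : Row, Row.agree (T.1.filter fun a => T'.1.contains a) r r' = true →
      (Row.toTup (A ∪ A') (Row.merge
      (T.1 ++ T'.1.filter fun a => !T.1.contains a) T.1 r r')).proj
        Finset.subset_union_right = r'.toTup A' := by
    intro r r' hrr
    funext a
    refine (Row.val_map ((hC _).2 (Finset.subset_union_right a.2))).trans ?_
    cases hc : T.1.contains a.1
    · rfl
    · simp only [cond_true, Row.toTup]
      exact Row.agree_iff.1 hrr _ ((hI _).2 ⟨h.mem_cols.1 (by simpa using hc), a.2⟩)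
  have inj : ∀ {t t' : Tup (A ∪ A')},
      t.proj (Finset.subset_union_left : A ⊆ A ∪ A') = t'.proj Finset.subset_union_left →
      t.proj (Finset.subset_union_right : A' ⊆ A ∪ A') = t'.proj Finset.subset_union_right →
      t = t' := by
    intro t t' e e'
    funext ⟨a, ha⟩
    rcases Finset.mem_union.1 ha with ha' | ha'
    · exact congrFun e ⟨a, ha'⟩
    · exact congrFun e' ⟨a, ha'⟩
  refine ⟨?_, ?_, ?_, ?_, ?_⟩
  · refine List.Nodup.append h.nodup_cols (h'.nodup_cols.filter _) fun a ha ha' => ?_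
    simp [ha] at ha'
  · ext a
    rw [List.mem_toFinset]
    exact hC a
  · intro r hr
    simp only [Table.join, List.mem_flatMap, List.mem_map] at hr
    obtain ⟨_, _, _, _, rfl⟩ := hr
    simp [Row.merge, Table.join]
  -- A joined row determines its two restrictions, and the pairs of restrictions are distinct
  -- because the rows of each factor are.
  · have hpairs : (T.2.flatMap fun r => (T'.2.filter fun r' =>
        Row.agree (T.1.filter fun a => T'.1.contains a) r r').map fun r' =>
          (r.toTup A, r'.toTup A')).Nodup := by
      refine List.nodup_flatMap.2 ⟨fun r _ => ?_, ?_⟩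
      · have := (h'.nodup_rows.sublist ((List.filter_sublist (p := fun r' =>
          Row.agree (T.1.filter fun a => T'.1.contains a) r r') (l := T'.2)).map _)).map
          (f := fun t => (r.toTup A, t)) (fun _ _ e => (Prod.ext_iff.1 e).2)
        rwa [List.map_map] at this
      · refine (List.pairwise_map.1 h.nodup_rows).imp fun {r s} hrs => ?_
        intro p hp hp'
        obtain ⟨_, _, rfl⟩ := List.mem_map.1 hp
        obtain ⟨_, _, e⟩ := List.mem_map.1 hp'
        exact hrs (Prod.ext_iff.1 e).1.symm
    refine List.Nodup.of_map (fun t : Tup (A ∪ A') =>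
      (t.proj (Finset.subset_union_left : A ⊆ A ∪ A'),
        t.proj (Finset.subset_union_right : A' ⊆ A ∪ A'))) ?_
    convert hpairs using 1
    simp only [Table.join, List.map_flatMap, List.map_map]
    congr 1
    funext r
    refine List.map_congr_left fun r' hr' => ?_
    simp only [Function.comp, kl, kr r r' (List.mem_filter.1 hr').2]
  · intro t
    simp only [Table.join, List.mem_map, List.mem_flatMap, Set.mem_ofPred_eq, ← h.mem_rows,
      ← h'.mem_rows]
    constructor
    · rintro ⟨_, ⟨r, hr, r', hr', rfl⟩, rfl⟩
      obtain ⟨hr1, hr2⟩ := List.mem_filter.1 hr'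
      exact ⟨⟨r, hr, (kl r r').symm⟩, r', hr1, (kr r r' hr2).symm⟩
    · rintro ⟨⟨r, hr, e⟩, r', hr', e'⟩
      have hag : Row.agree (T.1.filter fun a => T'.1.contains a) r r' = true := by
        refine Row.agree_iff.2 fun a ha => ?_
        obtain ⟨h1, h2⟩ := (hI a).1 ha
        exact (congrFun e ⟨a, h1⟩).trans (congrFun e' ⟨a, h2⟩).symm
      exact ⟨_, ⟨r, hr, r', List.mem_filter.2 ⟨hr', hag⟩, rfl⟩,
        inj ((kl r r').trans e) ((kr r r' hag).trans e')⟩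

theorem IsTable.exists_represents {A : Finset ℕ} {S : Set (Tup A)} {w : List ℕ}
    (h : IsTable S w) : ∃ T : Table, T.Listing w ∧ T.Represents S := by
  obtain ⟨C, rows, hC, rfl, hrows, hmem, rfl⟩ := h
  let row : Tup C.toFinset → Row := fun t => (C.zip (C.map t.entry)).reverse
  have hrow : ∀ t, (row t).toTup C.toFinset = t := by
    intro t
    funext ⟨a, ha⟩
    have hz : C.zip (C.map t.entry) = C.map fun a => (a, t.entry a) := by
      have := List.zip_map' (f := fun a : ℕ => a) (g := t.entry) (l := C)
      rwa [List.map_id'] at this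
    have : (row t).val a = t.entry a := by
      simp only [row, hz]
      exact Row.val_eq (by simp) ⟨(a, t.entry a), by simpa using ha, rfl⟩
    exact this.trans (dif_pos ha)
  refine ⟨(C, rows.map row), ⟨rows.map fun t => C.map t.entry, by simp, ?_, ?_, ?_⟩, hC, rfl, ?_,
    ?_, ?_⟩
  · cases C with
    | nil =>
      -- Over the empty set of attributes there is only one tuple.
      have : rows.length ≤ 1 := by
        rcases rows with _ | ⟨t, _ | ⟨t', rows⟩⟩
        · exact Nat.zero_le _
        · exact le_rfl
        · have : t = t' := funext fun a => by simpa using a.2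
          exact absurd (this ▸ List.mem_cons_self) (List.nodup_cons.1 hrows).1
      rw [List.length_map]
      omega
    | cons c C =>
      simp only [List.length_map, List.length_flatten, List.map_map]
      have : ∀ rows : List (Tup (c :: C).toFinset), rows.length ≤
          (rows.map (List.length ∘ fun t => (c :: C).map t.entry)).sum + 1 := by
        intro rows
        induction rows with
        | nil => simp
        | cons t rows ih => simp at ih ⊢; omega
      exact this rows
  · simp [List.flatMap]
  · simp [row]
  · simp [row]
  · simp only [List.map_map]
    rwa [show Row.toTup C.toFinset ∘ row = id from funext hrow, List.map_id]
  · intro t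
    simp only [List.map_map]
    rw [show Row.toTup C.toFinset ∘ row = id from funext hrow, List.map_id, hmem]

end JoinQuery

namespace JoinQuery

/-! ### The size bound for joins -/

/-- A form of Hölder's inequality for exponents of total weight at least 1. After division by the
sums `S i` all ratios are at most 1; the weighted inequality of arithmetic and geometric means,
summed over `v`, then bounds the normalised left side by 1. -/
theorem sum_prod_rpow_le {V ι : Type*} (s : Finset V) (I : Finset ι) {x : ι → ℝ}
    (hx : ∀ i, 0 ≤ x i) (hI : 1 ≤ ∑ i ∈ I, x i) {c : V → ι → ℝ} (hc : ∀ v i, 0 ≤ c v i) :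
    ∑ v ∈ s, ∏ i ∈ I, c v i ^ x i ≤ ∏ i ∈ I, (∑ v ∈ s, c v i) ^ x i := by
  set S : ι → ℝ := fun i => ∑ v ∈ s, c v i with hS
  have hS0 : ∀ i, 0 ≤ S i := fun i => Finset.sum_nonneg fun v _ => hc v i
  have hle : ∀ v ∈ s, ∀ i, c v i ≤ S i := fun v hv i =>
    Finset.single_le_sum (f := fun v => c v i) (fun v _ => hc v i) hv
  set t := ∑ i ∈ I, x i with ht
  have ht0 : 0 < t := by linarith
  have hd : ∀ v ∈ s, ∏ i ∈ I, (c v i / S i) ^ x i ≤ ∑ i ∈ I, x i / t * (c v i / S i) := by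
    intro v hv
    have h0 : ∀ i, 0 ≤ c v i / S i := fun i => div_nonneg (hc v i) (hS0 i)
    refine le_trans (Finset.prod_le_prod (fun i _ => Real.rpow_nonneg (h0 i) _) fun i _ => ?_)
      (Real.geom_mean_le_arith_mean_weighted I (fun i => x i / t) _
        (fun i _ => div_nonneg (hx i) ht0.le) ?_ fun i _ => h0 i)
    -- The base is at most 1 and `t` is at least 1, so lowering the exponent from `x i` to `x i / t`
    -- can only increase the power.
    · exact Real.rpow_le_rpow_of_exponent_ge' (h0 i) (div_le_one_of_le₀ (hle v hv i) (hS0 i))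
        (div_nonneg (hx i) ht0.le) (div_le_self (hx i) hI)
    · rw [← Finset.sum_div, div_self ht0.ne']
  have hsplit : ∀ v ∈ s, ∏ i ∈ I, c v i ^ x i =
      (∏ i ∈ I, S i ^ x i) * ∏ i ∈ I, (c v i / S i) ^ x i := by
    intro v hv
    rw [← Finset.prod_mul_distrib]
    refine Finset.prod_congr rfl fun i _ => ?_
    rw [← Real.mul_rpow (hS0 i) (div_nonneg (hc v i) (hS0 i))]
    rcases eq_or_ne (S i) 0 with h | h
    -- With the convention 0 / 0 = 0 the normalisation is harmless when the sum vanishes.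
    · have : c v i = 0 := le_antisymm (h ▸ hle v hv i) (hc v i)
      simp [h, this]
    · rw [mul_div_cancel₀ _ h]
  rw [Finset.sum_congr rfl hsplit, ← Finset.mul_sum]
  refine mul_le_of_le_one_right (Finset.prod_nonneg fun i _ => Real.rpow_nonneg (hS0 i) _) ?_
  calc ∑ v ∈ s, ∏ i ∈ I, (c v i / S i) ^ x i
      ≤ ∑ v ∈ s, ∑ i ∈ I, x i / t * (c v i / S i) := Finset.sum_le_sum hd
    _ = ∑ i ∈ I, x i / t * (S i / S i) := by
      rw [Finset.sum_comm]
      refine Finset.sum_congr rfl fun i _ => ?_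
      rw [← Finset.mul_sum, ← Finset.sum_div]
    _ ≤ ∑ i ∈ I, x i / t := Finset.sum_le_sum fun i _ =>
      mul_le_of_le_one_right (div_nonneg (hx i) ht0.le) (div_self_le_one _)
    _ = 1 := by rw [← Finset.sum_div, div_self ht0.ne']

/-- If the functions in `Y` are determined by their values on `B`, and their restrictions to
`A i ∩ B` are restrictions of functions in `X i`, then every fractional cover `x` of `B` by the
sets `A i` gives a bound for the size of `Y`. -/
theorem card_le_prod_rpow {ι : Type*} [Fintype ι] {x : ι → ℝ} (hx : ∀ i, 0 ≤ x i)
    (A : ι → Finset ℕ) (B : Finset ℕ) (hc : ∀ a ∈ B, 1 ≤ ∑ i with a ∈ A i, x i)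
    (Y : Finset (ℕ → ℕ)) (X : ι → Finset (ℕ → ℕ))
    (inj : ∀ f ∈ Y, ∀ g ∈ Y, (∀ a ∈ B, f a = g a) → f = g)
    (h : ∀ f ∈ Y, ∀ i, ∃ g ∈ X i, ∀ a ∈ B, a ∈ A i → f a = g a) :
    (Y.card : ℝ) ≤ ∏ i, ((X i).card : ℝ) ^ x i := by
  classical
  induction B using Finset.induction_on generalizing Y X with
  | empty =>
    rcases Y.eq_empty_or_nonempty with rfl | ⟨f, hf⟩
    · simpa using Finset.prod_nonneg fun i _ => Real.rpow_nonneg (Nat.cast_nonneg _) _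
    -- Nothing distinguishes elements of `Y` any more; if there is one, all `X i` are nonempty and
    -- every factor is at least 1.
    · have h1 : Y.card ≤ 1 := Finset.card_le_one.2 fun f hf g hg => inj f hf g hg (by simp)
      refine le_trans (by exact_mod_cast h1) (Finset.prod_induction _ (1 ≤ ·)
        (fun _ _ => one_le_mul_of_one_le_of_one_le) le_rfl fun i _ => ?_)
      obtain ⟨g, hg, -⟩ := h f hf i
      exact Real.one_le_rpow (by exact_mod_cast Finset.card_pos.2 ⟨g, hg⟩) (hx i)
  | insert a B ha ih =>
    -- Fixing the value at `a` shrinks only the sets with `a ∈ A i`. These exponents have sum at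
    -- least 1, so the slices can be recombined by `sum_prod_rpow_le`.
    let X' : ℕ → ι → Finset (ℕ → ℕ) := fun v i =>
      if a ∈ A i then (X i).filter fun g => g a = v else X i
    have hY : ∀ v, ((Y.filter fun f => f a = v).card : ℝ) ≤ ∏ i, ((X' v i).card : ℝ) ^ x i := by
      intro v
      refine ih (fun b hb => hc b (Finset.mem_insert_of_mem hb)) _ _ ?_ ?_
      · intro f hf g hg hfg
        rw [Finset.mem_filter] at hf hg
        refine inj f hf.1 g hg.1 fun b hb => ?_
        rcases Finset.mem_insert.1 hb with rfl | hb
        · rw [hf.2, hg.2]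
        · exact hfg b hb
      · intro f hf i
        rw [Finset.mem_filter] at hf
        obtain ⟨g, hg, hfg⟩ := h f hf.1 i
        refine ⟨g, ?_, fun b hb hb' => hfg b (Finset.mem_insert_of_mem hb) hb'⟩
        simp only [X']
        split_ifs with hai
        · exact Finset.mem_filter.2 ⟨hg, by rw [← hfg a (Finset.mem_insert_self _ _) hai, hf.2]⟩
        · exact hg
    have hsplit : ∀ v, ∏ i, ((X' v i).card : ℝ) ^ x i =
        (∏ i with a ∈ A i, (((X i).filter fun g => g a = v).card : ℝ) ^ x i) *
          ∏ i with a ∉ A i, ((X i).card : ℝ) ^ x i := by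
      intro v
      rw [← Finset.prod_filter_mul_prod_filter_not Finset.univ (fun i => a ∈ A i)]
      congr 1 <;> refine Finset.prod_congr rfl fun i hi => ?_
      · simp only [X', if_pos (Finset.mem_filter.1 hi).2]
      · simp only [X', if_neg (Finset.mem_filter.1 hi).2]
    calc (Y.card : ℝ) = ∑ v ∈ Y.image fun f => f a, ((Y.filter fun f => f a = v).card : ℝ) := by
          exact_mod_cast Finset.card_eq_sum_card_image (fun f : ℕ → ℕ => f a) Y
      _ ≤ ∑ v ∈ Y.image fun f => f a, ∏ i, ((X' v i).card : ℝ) ^ x i :=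
          Finset.sum_le_sum fun v _ => hY v
      _ = (∑ v ∈ Y.image fun f => f a, ∏ i with a ∈ A i,
            (((X i).filter fun g => g a = v).card : ℝ) ^ x i) *
          ∏ i with a ∉ A i, ((X i).card : ℝ) ^ x i := by
          rw [Finset.sum_congr rfl fun v _ => hsplit v, ← Finset.sum_mul]
      _ ≤ (∏ i with a ∈ A i, ((X i).card : ℝ) ^ x i) *
          ∏ i with a ∉ A i, ((X i).card : ℝ) ^ x i := by
          refine mul_le_mul_of_nonneg_right ?_
            (Finset.prod_nonneg fun i _ => Real.rpow_nonneg (Nat.cast_nonneg _) _)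
          refine (sum_prod_rpow_le _ _ hx (hc a (Finset.mem_insert_self _ _))
            fun v i => Nat.cast_nonneg _).trans ?_
          refine Finset.prod_le_prod (fun i _ => Real.rpow_nonneg
            (Finset.sum_nonneg fun v _ => Nat.cast_nonneg _) _) fun i _ => ?_
          refine Real.rpow_le_rpow (Finset.sum_nonneg fun v _ => Nat.cast_nonneg _) ?_ (hx i)
          have := Finset.card_biUnion (s := Y.image fun f => f a)
            (t := fun v => (X i).filter fun g => g a = v) (by
              intro v _ w _ hvw
              exact Finset.disjoint_filter.2 fun g _ e e' => hvw (e.symm.trans e'))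
          rw [← Nat.cast_sum, ← this]
          exact_mod_cast Finset.card_le_card (Finset.biUnion_subset.2 fun v _ =>
            Finset.filter_subset _ _)
      _ = ∏ i, ((X i).card : ℝ) ^ x i := Finset.prod_filter_mul_prod_filter_not _ _ _

end JoinQuery

namespace JoinQuery

open JoinQuery.RAM

/-! ### The sequence of steps -/

theorem mem_bif_cons {B : List ℕ} {a b : ℕ} :
    b ∈ (bif B.contains a then B else a :: B) ↔ b = a ∨ b ∈ B := by
  cases h : B.contains a
  · simp
  · have : a ∈ B := by simpa using h
    simp only [cond_true]
    constructor
    · exact Or.inr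
    · rintro (rfl | h) <;> assumption

section

variable {τ υ : Type}

theorem steps_map (f : τ → υ) (ts : List τ) (B L : List ℕ) :
    steps (ts.map f) B L = (steps ts B L).map (Prod.map id f) := by
  induction L generalizing B <;> simp [steps, *]

theorem forall₂_steps {r : τ → υ → Prop} {ts : List τ} {us : List υ} (h : List.Forall₂ r ts us)
    (B L : List ℕ) : List.Forall₂ (fun p q => p.1 = q.1 ∧ r p.2 q.2) (steps ts B L)
      (steps us B L) := by
  have hm : ∀ B : List ℕ, List.Forall₂ (fun (p : List ℕ × τ) (q : List ℕ × υ) =>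
      p.1 = q.1 ∧ r p.2 q.2) (ts.map fun x => (B, x)) (us.map fun x => (B, x)) := by
    intro B
    rw [List.forall₂_map_left_iff, List.forall₂_map_right_iff]
    exact h.imp fun _ _ h => ⟨rfl, h⟩
  induction L generalizing B with
  | nil => exact hm B
  | cons a L ih => exact List.rel_append (hm B) (ih _)

theorem of_mem_steps {ts : List τ} {B L : List ℕ} {p : List ℕ × τ} (h : p ∈ steps ts B L) :
    B ⊆ p.1 ∧ p.1 ⊆ B ++ L ∧ p.2 ∈ ts ∧ (B.Nodup → p.1.Nodup) := by
  induction L generalizing B with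
  | nil =>
    obtain ⟨x, hx, rfl⟩ := List.mem_map.1 h
    simp [hx]
  | cons a L ih =>
    rcases List.mem_append.1 h with h | h
    · obtain ⟨x, hx, rfl⟩ := List.mem_map.1 h
      simp [hx]
    · obtain ⟨h1, h2, h3, h4⟩ := ih h
      refine ⟨fun b hb => h1 (mem_bif_cons.2 (Or.inr hb)), fun b hb => ?_, h3, fun hB => h4 ?_⟩
      · have := h2 hb
        rw [List.mem_append, mem_bif_cons] at this
        simp only [List.mem_append, List.mem_cons]
        tauto
      · cases hc : B.contains a
        · simp only [cond_false, List.nodup_cons]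
          exact ⟨by simpa using hc, hB⟩
        · exact hB

/-- The last round uses a list containing all attributes; there the projections are the full
relations, which makes the plan exact. -/
theorem exists_mem_steps {ts : List τ} (B L : List ℕ) {x : τ} (hx : x ∈ ts) :
    ∃ B', (B', x) ∈ steps ts B L ∧ B ⊆ B' ∧ L ⊆ B' := by
  induction L generalizing B with
  | nil => exact ⟨B, List.mem_map.2 ⟨x, hx, rfl⟩, by simp, by simp⟩
  | cons a L ih =>
    obtain ⟨B', h1, h2, h3⟩ := ih (bif B.contains a then B else a :: B)
    refine ⟨B', List.mem_append_right _ h1, fun b hb => h2 (mem_bif_cons.2 (Or.inr hb)), ?_⟩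
    rintro b (_ | ⟨_, hb⟩)
    · exact h2 (mem_bif_cons.2 (Or.inl rfl))
    · exact h3 hb

/-- In an initial segment of the sequence of steps, only one attribute is not yet completely
processed. -/
theorem prefix_steps {ts : List τ} (hts : ts ≠ []) {B L : List ℕ} {l : List (List ℕ × τ)}
    (h : l <+: steps ts B L) : (∀ p ∈ l, p.1 = B) ∨
      ∃ B' a, (∀ x ∈ ts, (B', x) ∈ l) ∧ ∀ p ∈ l, ∀ b ∈ p.1, b = a ∨ b ∈ B' := by
  induction L generalizing B l with
  | nil =>
    left
    intro p hp
    obtain ⟨x, hx, rfl⟩ := List.mem_map.1 (h.subset hp)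
    rfl
  | cons a L ih =>
    have hmap : ∀ p ∈ ts.map fun x => (B, x), p.1 = B := by simp +contextual
    rcases List.prefix_or_prefix_of_prefix h (List.prefix_append _ _) with h' | ⟨l', rfl⟩
    · exact Or.inl fun p hp => hmap p (h'.subset hp)
    · right
      have h' := (List.prefix_append_right_inj _).1 h
      rcases ih h' with h | ⟨B', a', h1, h2⟩
      · refine ⟨B, a, fun x hx => List.mem_append_left _ (List.mem_map.2 ⟨x, hx, rfl⟩), ?_⟩
        intro p hp b hb
        rcases List.mem_append.1 hp with hp | hp
        · exact Or.inr (hmap p hp ▸ hb)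
        · rw [h p hp, mem_bif_cons] at hb
          exact hb
      · refine ⟨B', a', fun x hx => List.mem_append_right _ (h1 x hx), fun p hp b hb => ?_⟩
        rcases List.mem_append.1 hp with hp | hp
        -- Some pair with first entry `B'` occurs in the later rounds, and lists only grow, so `B'`
        -- contains the earlier list.
        · obtain ⟨x, hx⟩ := List.exists_mem_of_ne_nil _ hts
          rw [hmap p hp] at hb
          exact Or.inr ((of_mem_steps (h'.subset (h1 x hx))).1 (mem_bif_cons.2 (Or.inr hb)))
        · exact h2 p hp b hb

end

/-! ### The plan -/

/-- The restriction of a function to `A`. -/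
def Tup.of (A : Finset ℕ) (f : ℕ → ℕ) : Tup A := fun a => f a.1

theorem Tup.of_entry {A : Finset ℕ} (t : Tup A) : Tup.of A t.entry = t := by
  funext a
  simp [Tup.of, Tup.entry]

/-- Testing membership on restrictions of total functions avoids casts between tuples over sets of
attributes that are only provably equal. -/
theorem sigma_tup_eq {A A' : Finset ℕ} {S : Set (Tup A)} {S' : Set (Tup A')} (h : A = A')
    (h' : ∀ f, Tup.of A f ∈ S ↔ Tup.of A' f ∈ S') :
    (⟨A, S⟩ : Σ A : Finset ℕ, Set (Tup A)) = ⟨A', S'⟩ := by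
  subst h
  congr 1
  ext t
  rw [← Tup.of_entry t, h']

section

variable {σ : Finset RelName}

theorem Plan.of_mem_eval_proj_rel {D : Instance σ} {B : Finset ℕ} {R : σ} {f : ℕ → ℕ} :
    Tup.of _ f ∈ (Plan.proj B (.rel R)).eval D ↔
      ∃ g, Tup.of R.1.attrs g ∈ D R ∧ ∀ a ∈ B, a ∈ R.1.attrs → f a = g a := by
  constructor
  · rintro ⟨s, hs, e⟩
    refine ⟨Tup.entry (A := R.1.attrs) s, ?_, fun a ha ha' => ?_⟩
    · exact (congrArg (· ∈ D R) (Tup.of_entry (A := R.1.attrs) s)).mpr hs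
    · have h : Tup.entry (A := R.1.attrs) s a = s ⟨a, ha'⟩ := dif_pos ha'
      exact (congrFun e ⟨a, Finset.mem_inter.2 ⟨ha, ha'⟩⟩).trans h.symm
  · rintro ⟨g, hg, h⟩
    refine ⟨Tup.of _ g, hg, funext fun a => ?_⟩
    exact h a (Finset.mem_inter.1 a.2).1 (Finset.mem_inter.1 a.2).2

/-- One step of the plan. -/
def Plan.step (φ : Plan σ) (p : List ℕ × σ) : Plan σ :=
  .join φ (.proj p.1.toFinset (.rel p.2))

theorem Plan.mem_attrs_foldl (φ : Plan σ) (l : List (List ℕ × σ)) {a : ℕ} :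
    a ∈ (l.foldl Plan.step φ).attrs ↔
      a ∈ φ.attrs ∨ ∃ p ∈ l, a ∈ p.1 ∧ a ∈ p.2.1.attrs := by
  induction l generalizing φ with
  | nil => simp
  | cons p l ih =>
    rw [List.foldl_cons, ih]
    simp [Plan.step, Plan.attrs, or_assoc]

theorem Plan.of_mem_eval_foldl (D : Instance σ) (φ : Plan σ) (l : List (List ℕ × σ))
    {f : ℕ → ℕ} : Tup.of _ f ∈ (l.foldl Plan.step φ).eval D ↔ Tup.of _ f ∈ φ.eval D ∧
      ∀ p ∈ l, ∃ g, Tup.of p.2.1.attrs g ∈ D p.2 ∧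
        ∀ a ∈ p.1, a ∈ p.2.1.attrs → f a = g a := by
  induction l generalizing φ with
  | nil => exact ⟨fun h => ⟨h, by simp⟩, fun h => h.1⟩
  | cons p l ih =>
    rw [List.foldl_cons, ih, List.forall_mem_cons, ← and_assoc]
    refine and_congr_left fun _ => ?_
    have : Tup.of _ f ∈ (φ.step p).eval D ↔
      Tup.of _ f ∈ φ.eval D ∧ Tup.of _ f ∈ (Plan.proj p.1.toFinset (.rel p.2)).eval D := Iff.rfl
    rw [this, Plan.of_mem_eval_proj_rel]
    simp

theorem Plan.isCode_foldl {φ : Plan σ} {u : List ℕ} (hu : φ.IsCode u) (l : List (List ℕ × σ))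
    (hl : ∀ p ∈ l, p.1.Nodup) : (l.foldl Plan.step φ).IsCode
      (u ++ l.flatMap fun p => 0 :: p.2.1.code ++ 2 :: p.1.length :: p.1 ++ [1]) := by
  induction l generalizing φ u with
  | nil => simpa using hu
  | cons p l ih =>
    have := ih (φ := φ.step p) (.join hu (.proj (.rel p.2) (hl p (by simp)) rfl))
      fun q hq => hl q (by simp [hq])
    simpa using this

end

/-- The relation names of a query as elements of its schema. -/
def Query.names (Q : Query) : List Q.schema :=
  Q.rels.attach.map fun R => ⟨R.1, List.mem_toFinset.2 R.2⟩

theorem Query.map_names (Q : Query) : Q.names.map (fun R => R.1) = Q.rels := by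
  simp [Query.names]

theorem Query.mem_names (Q : Query) (R : Q.schema) : R ∈ Q.names := by
  have : R.1 ∈ Q.names.map (fun R => R.1) := by
    rw [Q.map_names]; exact List.mem_toFinset.1 R.2
  obtain ⟨S, hS, e⟩ := List.mem_map.1 this
  rwa [← Subtype.ext e]

theorem Query.names_ne_nil (Q : Query) : Q.names ≠ [] := fun h => Q.rels_ne_nil (by
  rw [← Q.map_names, h, List.map_nil])

/-- The attributes of all atoms of a query, with repetitions. -/
def Query.attrList (Q : Query) : List ℕ := Q.rels.flatMap fun R => R.attrs.sort (· ≤ ·)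

theorem Query.mem_attrs {Q : Query} {a : ℕ} : a ∈ Q.attrs ↔ ∃ R : Q.schema, a ∈ R.1.attrs := by
  simp [Query.attrs]

theorem Query.mem_attrList {Q : Query} {a : ℕ} : a ∈ Q.attrList ↔ a ∈ Q.attrs := by
  simp [Query.attrList, Query.attrs, Query.schema]

/-- The initial subplan. -/
def Query.basePlan (Q : Query) : Plan Q.schema :=
  .proj ([] : List ℕ).toFinset (.rel (Q.names.getLast Q.names_ne_nil))

theorem Query.attrs_basePlan (Q : Query) : Q.basePlan.attrs = ∅ := by
  simp [Query.basePlan, Plan.attrs]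

/-- A plan that treats the attributes of the query one after the other. -/
def Query.plan (Q : Query) : Plan Q.schema :=
  (steps Q.names [] Q.attrList).foldl Plan.step Q.basePlan

theorem Query.isPlanFor_plan (Q : Query) : Q.plan.IsPlanFor Q := by
  intro D
  refine sigma_tup_eq ?_ fun f => ?_
  · ext a
    rw [Query.plan, Plan.mem_attrs_foldl, Q.attrs_basePlan]
    constructor
    · rintro (h | ⟨p, hp, h1, h2⟩)
      · simp at h
      · exact Query.mem_attrs.2 ⟨p.2, h2⟩
    · intro ha
      obtain ⟨R, hR⟩ := Query.mem_attrs.1 ha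
      obtain ⟨B, h1, -, h2⟩ := exists_mem_steps [] Q.attrList (Q.mem_names R)
      exact Or.inr ⟨_, h1, h2 (Query.mem_attrList.2 ha), hR⟩
  · have hans : Tup.of Q.attrs f ∈ Q.answer D ↔ ∀ R : Q.schema, Tup.of R.1.attrs f ∈ D R :=
      Iff.rfl
    rw [Query.plan, Plan.of_mem_eval_foldl, hans]
    constructor
    · rintro ⟨-, h⟩ R
      obtain ⟨B, h1, -, h2⟩ := exists_mem_steps [] Q.attrList (Q.mem_names R)
      obtain ⟨g, hg, hfg⟩ := h _ h1
      have : Tup.of R.1.attrs f = Tup.of R.1.attrs g := funext fun a =>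
        hfg a.1 (h2 (Query.mem_attrList.2 (Query.mem_attrs.2 ⟨R, a.2⟩))) a.2
      rwa [this]
    · intro h
      refine ⟨?_, fun p _ => ⟨f, h p.2, fun _ _ _ => rfl⟩⟩
      -- The initial subplan has no attributes and merely tests that one relation is nonempty, which
      -- any answer tuple witnesses.
      exact Plan.of_mem_eval_proj_rel.2 ⟨f, h _, fun _ _ _ => rfl⟩

theorem Query.isCode_plan (Q : Query) : Q.plan.IsCode
    (0 :: (Q.names.getLast Q.names_ne_nil).1.code ++ [2, 0] ++
      (steps Q.names [] Q.attrList).flatMap fun p =>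
        0 :: p.2.1.code ++ 2 :: p.1.length :: p.1 ++ [1]) := by
  refine Plan.isCode_foldl ?_ _ fun p hp => (of_mem_steps hp).2.2.2 List.nodup_nil
  exact .proj (l := []) (.rel _) List.nodup_nil rfl

/-! ### Sizes of intermediate results -/

theorem Query.ncard_eval_prefix_le {Q : Query} {D : Instance Q.schema} {N k : ℕ} (hN : 1 ≤ N)
    (hD : ∀ R, (D R).card ≤ N) {x : Q.schema → ℝ} (hx : Q.IsFractionalEdgeCover x)
    (hk : ∑ R, x R ≤ k) {l : List (List ℕ × Q.schema)} (hl : l <+: steps Q.names [] Q.attrList)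
    (hfin : ((l.foldl Plan.step Q.basePlan).eval D).Finite) :
    ((l.foldl Plan.step Q.basePlan).eval D).ncard ≤ N ^ (k + 1) := by
  set φ := l.foldl Plan.step Q.basePlan with hφ
  let ent : ∀ {A : Finset ℕ}, Tup A ↪ (ℕ → ℕ) := fun {A} =>
    ⟨Tup.entry, Function.LeftInverse.injective Tup.of_entry⟩
  have hatt : ∀ {a}, a ∈ φ.attrs ↔ ∃ p ∈ l, a ∈ p.1 ∧ a ∈ p.2.1.attrs := by
    intro a
    rw [hφ, Plan.mem_attrs_foldl, Q.attrs_basePlan]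
    simp
  have hev : ∀ {t}, t ∈ φ.eval D → ∀ p ∈ l, ∃ s ∈ D p.2,
      ∀ a ∈ p.1, a ∈ p.2.1.attrs → t.entry a = s.entry a := by
    intro t ht p hp
    rw [← Tup.of_entry t] at ht
    obtain ⟨g, hg, h⟩ := ((Plan.of_mem_eval_foldl D _ l).1 ht).2 p hp
    refine ⟨_, hg, fun a ha ha' => (h a ha ha').trans ?_⟩
    rw [Tup.entry, dif_pos ha', Tup.of]
  have hN1 : (1 : ℝ) ≤ N := by exact_mod_cast hN
  rw [Set.ncard_eq_toFinset_card _ hfin]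
  rcases prefix_steps Q.names_ne_nil hl with h | ⟨B, a, h1, h2⟩
  -- Only the empty list of attributes has been used so far, so the result has no columns and at
  -- most one row.
  · refine (Finset.card_le_one.2 fun s _ t _ => funext fun b => ?_).trans (Nat.one_le_pow _ _ hN)
    obtain ⟨p, hp, hb, -⟩ := hatt.1 b.2
    rw [h p hp] at hb
    simp at hb
  -- All values in the column `a`, if present, come from one relation `R₀`: one whose projection has
  -- introduced `a`.
  · obtain ⟨R₀, hR₀⟩ : ∃ R : Q.schema, ∀ t ∈ φ.eval D, ∃ s ∈ D R,
        a ∈ φ.attrs → t.entry a = s.entry a := by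
      by_cases ha : a ∈ φ.attrs
      · obtain ⟨p, hp, hb, hb'⟩ := hatt.1 ha
        refine ⟨p.2, fun t ht => ?_⟩
        obtain ⟨s, hs, h⟩ := hev ht p hp
        exact ⟨s, hs, fun _ => h a hb hb'⟩
      · refine ⟨Q.names.getLast Q.names_ne_nil, fun t ht => ?_⟩
        obtain ⟨s, hs, -⟩ := hev ht _ (h1 _ (Q.mem_names _))
        exact ⟨s, hs, fun h => absurd h ha⟩
    -- The index `none` stands for the additional edge {a} of weight 1, filled by `R₀`; the other
    -- edges lose `a`. Outside `a` all relations have been joined on `B`, as the product bound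
    -- requires.
    have key := card_le_prod_rpow (ι := Option Q.schema) (x := fun o => o.elim 1 x)
      (by rintro (_ | R); exacts [zero_le_one, hx.1 R])
      (fun o => o.elim {a} fun R => R.1.attrs.erase a) φ.attrs ?_
      (hfin.toFinset.map ent) (fun o => o.elim ((D R₀).map ent) fun R => (D R).map ent) ?_ ?_
    · rw [Fintype.prod_option] at key
      simp only [Option.elim_none, Option.elim_some, Finset.card_map, Real.rpow_one] at key
      have : ∏ R, ((D R).card : ℝ) ^ x R ≤ (N : ℝ) ^ k := by
        calc ∏ R, ((D R).card : ℝ) ^ x R ≤ ∏ R, (N : ℝ) ^ x R :=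
              Finset.prod_le_prod (fun R _ => Real.rpow_nonneg (Nat.cast_nonneg _) _) fun R _ =>
                Real.rpow_le_rpow (Nat.cast_nonneg _) (by exact_mod_cast hD R) (hx.1 R)
          _ = (N : ℝ) ^ ∑ R, x R := (Real.rpow_sum_of_pos (by linarith) _ _).symm
          _ ≤ (N : ℝ) ^ (k : ℝ) := Real.rpow_le_rpow_of_exponent_le hN1 hk
          _ = (N : ℝ) ^ k := Real.rpow_natCast _ _
      have h3 : (hfin.toFinset.card : ℝ) ≤ N * (N : ℝ) ^ k := key.trans (mul_le_mul
        (by exact_mod_cast hD R₀) this (Finset.prod_nonneg fun R _ =>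
          Real.rpow_nonneg (Nat.cast_nonneg _) _) (Nat.cast_nonneg _))
      rw [pow_succ']
      exact_mod_cast h3
    · intro b hb
      by_cases hba : b = a
      · subst hba
        refine (le_of_eq ?_).trans (Finset.single_le_sum (f := fun o : Option Q.schema =>
          o.elim (1 : ℝ) x) ?_ (Finset.mem_filter.2 ⟨Finset.mem_univ none, ?_⟩))
        · rfl
        · rintro (_ | R) _
          exacts [zero_le_one, hx.1 R]
        · simp
      · rw [Finset.sum_filter, Fintype.sum_option, ← Finset.sum_filter]
        obtain ⟨p, -, -, hp⟩ := hatt.1 hb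
        simpa [hba] using hx.2 b (Query.mem_attrs.2 ⟨p.2, hp⟩)
    · simp only [Finset.mem_map, Set.Finite.mem_toFinset]
      rintro _ ⟨s, -, rfl⟩ _ ⟨t, -, rfl⟩ h
      refine congrArg _ (funext fun b => ?_)
      have := h b.1 b.2
      rwa [show ent s b.1 = s b from congrFun (Tup.of_entry s) b,
        show ent t b.1 = t b from congrFun (Tup.of_entry t) b] at this
    · simp only [Finset.mem_map, Set.Finite.mem_toFinset]
      rintro _ ⟨t, ht, rfl⟩ (_ | R)
      · obtain ⟨s, hs, h⟩ := hR₀ t ht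
        refine ⟨ent s, Finset.mem_map_of_mem _ hs, fun b hb hb' => ?_⟩
        obtain rfl : b = a := by simpa using hb'
        exact h hb
      · obtain ⟨s, hs, h⟩ := hev ht _ (h1 R (Q.mem_names R))
        refine ⟨ent s, Finset.mem_map_of_mem _ hs, fun b hb hb' => ?_⟩
        obtain ⟨hb1, hb2⟩ := Finset.mem_erase.1 hb'
        obtain ⟨p, hp, hb3, -⟩ := hatt.1 hb
        exact h b ((h2 p hp b hb3).resolve_left hb1) hb2

end JoinQuery

namespace JoinQuery

open JoinQuery.RAM

/-! ### Duality and lower bounds -/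

/-- Covers of nearly minimal cost suffice, so attainment of the infimum plays no role. -/
theorem Query.exists_cover_lt {Q : Query} {c : ℝ} (h : Q.fractionalEdgeCoverNumber < c) :
    ∃ x, Q.IsFractionalEdgeCover x ∧ ∑ R, x R < c := by
  obtain ⟨_, ⟨x, hx, rfl⟩, hlt⟩ := exists_lt_of_csInf_lt
    (s := {c | ∃ x : Q.schema → ℝ, Q.IsFractionalEdgeCover x ∧ c = ∑ R, x R})
    ⟨_, fun _ => 1, ⟨fun _ => zero_le_one, fun a ha => by
      obtain ⟨R, hR⟩ := Query.mem_attrs.1 ha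
      exact Finset.single_le_sum (f := fun _ : Q.schema => (1 : ℝ)) (fun _ _ => zero_le_one)
        (Finset.mem_filter.2 ⟨Finset.mem_univ R, hR⟩)⟩, rfl⟩ h
  exact ⟨x, hx, hlt⟩

theorem Query.fractionalEdgeCoverNumber_le {Q : Query} {x : Q.schema → ℝ}
    (hx : Q.IsFractionalEdgeCover x) : Q.fractionalEdgeCoverNumber ≤ ∑ R, x R := by
  refine csInf_le ⟨0, ?_⟩ ⟨x, hx, rfl⟩
  rintro _ ⟨y, hy, rfl⟩
  exact Finset.sum_nonneg fun R _ => hy.1 R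

/-- Weak linear programming duality in the direction that needs separation of convex sets. -/
theorem Query.exists_independent {Q : Query} {k : ℝ} (hk : 0 < k)
    (h : k < Q.fractionalEdgeCoverNumber) : ∃ z : ℕ → ℝ, (∀ a, 0 ≤ z a) ∧
      (∀ R ∈ Q.schema, ∑ a ∈ R.attrs, z a ≤ 1) ∧ k < ∑ a ∈ Q.attrs, z a := by
  classical
  let T : (Q.schema → ℝ) →ₗ[ℝ] (Q.attrs → ℝ) := LinearMap.pi fun a =>
    ∑ R with a.1 ∈ R.1.attrs, LinearMap.proj R
  have hT : ∀ x a, T x a = ∑ R with a.1 ∈ R.1.attrs, x R := by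
    intro x a
    simp [T]
  -- The upper bound on the coordinates follows from the other conditions; it makes compactness
  -- evident.
  let Δ : Set (Q.schema → ℝ) := Set.Icc 0 (fun _ => k) ∩ {x | ∑ R, x R ≤ k}
  have hΔ : IsCompact Δ := isCompact_Icc.inter_right
    (isClosed_le (by fun_prop) continuous_const)
  have hΔc : Convex ℝ Δ := (convex_Icc _ _).inter
    ((convex_halfSpace_le (f := fun x : Q.schema → ℝ => ∑ R, x R)
      (IsLinearMap.mk (by simp [Finset.sum_add_distrib]) (by simp [Finset.mul_sum])) k))
  -- A common point would come from a fractional edge cover of cost at most `k`.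
  have hdisj : Disjoint (T '' Δ) (Set.Ici 1) := by
    rw [Set.disjoint_left]
    rintro _ ⟨x, hx, rfl⟩ h1
    refine absurd (Query.fractionalEdgeCoverNumber_le (x := x) ⟨hx.1.1, fun a ha => ?_⟩)
      (not_le.2 (lt_of_le_of_lt hx.2 h))
    have := h1 ⟨a, ha⟩
    rwa [hT] at this
  obtain ⟨f, u, v, hu, huv, hv⟩ := geometric_hahn_banach_compact_closed (hΔc.linear_image T)
    (hΔ.image (LinearMap.continuous_of_finiteDimensional T)) (convex_Ici 1) isClosed_Ici hdisj
  let y : Q.attrs → ℝ := fun a => f (Pi.single a 1)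
  have hf : ∀ w, f w = ∑ a, w a * y a := by
    intro w
    conv_lhs => rw [← Finset.univ_sum_single w, map_sum]
    refine Finset.sum_congr rfl fun a _ => ?_
    rw [← smul_eq_mul, ← map_smul, ← Pi.single_smul', smul_eq_mul, mul_one]
  have h1 : v < f 1 := hv 1 (Set.mem_Ici.2 le_rfl)
  have hy : ∀ a, 0 ≤ y a := by
    intro a
    by_contra hneg
    rw [not_le] at hneg
    -- If `y a` were negative, moving this far in direction `a` stays in the orthant but brings `f`
    -- down to exactly `v`.
    have hs : 0 ≤ (v - f 1) / y a := div_nonneg_of_nonpos (by linarith) hneg.le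
    have := hv (1 + ((v - f 1) / y a) • Pi.single a 1) (Set.mem_Ici.2 (le_add_of_nonneg_right
      (smul_nonneg hs (Pi.single_nonneg.2 zero_le_one))))
    rw [map_add, map_smul, smul_eq_mul] at this
    change v < f 1 + (v - f 1) / y a * y a at this
    rw [div_mul_cancel₀ _ hneg.ne] at this
    linarith
  have hu0 : 0 < u := by
    have := hu (T 0) ⟨0, ⟨⟨le_rfl, fun _ => hk.le⟩, by simpa using hk.le⟩, rfl⟩
    simpa using this
  have hR : ∀ R : Q.schema, k * ∑ a with a.1 ∈ R.1.attrs, y a < u := by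
    intro R
    -- Testing the vertices of the simplex gives the constraint for each single relation.
    have := hu (T (Pi.single R k)) ⟨_, ⟨⟨Pi.single_nonneg.2 hk.le, fun S => ?_⟩, ?_⟩, rfl⟩
    · rw [hf] at this
      convert this using 1
      rw [Finset.mul_sum, Finset.sum_filter]
      refine Finset.sum_congr rfl fun a _ => ?_
      rw [hT, Finset.sum_pi_single']
      simp
    · rcases eq_or_ne S R with rfl | hne
      · simp
      · simp [hne, hk.le]
    · simp
  -- Scaling by `k / u` brings the weight of every relation below 1, while the total weight is `k *
  -- f 1 / u`, which exceeds `k` because `u < v < f 1`.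
  refine ⟨fun a => if ha : a ∈ Q.attrs then k / u * y ⟨a, ha⟩ else 0, fun a => ?_, fun R hRQ => ?_,
    ?_⟩
  · dsimp only
    split_ifs
    · exact mul_nonneg (div_nonneg hk.le hu0.le) (hy _)
    · exact le_rfl
  · have e : ∑ a ∈ R.attrs, (if ha : a ∈ Q.attrs then k / u * y ⟨a, ha⟩ else 0) =
        k / u * ∑ a with a.1 ∈ R.attrs, y a := by
      rw [Finset.mul_sum]
      symm
      refine Finset.sum_bij (fun a _ => a.1) (fun a ha => (Finset.mem_filter.1 ha).2)
        (fun a _ b _ e => Subtype.ext e) (fun a ha => ?_) fun a _ => ?_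
      · have := Q.attrs_subset hRQ ha
        exact ⟨⟨a, this⟩, by simpa using ha, rfl⟩
      · rw [dif_pos a.2]
    rw [e, div_mul_eq_mul_div, div_le_one hu0]
    exact (hR ⟨R, hRQ⟩).le
  · have e : ∑ a ∈ Q.attrs, (if ha : a ∈ Q.attrs then k / u * y ⟨a, ha⟩ else 0) =
        k / u * f 1 := by
      rw [hf, Finset.mul_sum, ← Finset.sum_coe_sort Q.attrs]
      refine Finset.sum_congr rfl fun a _ => ?_
      rw [dif_pos a.2]
      simp
    rw [e, div_mul_eq_mul_div, lt_div_iff₀ hu0]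
    exact mul_lt_mul_of_pos_left (huv.trans h1) hk

/-- Answers of polynomial size, with a factor depending on the query, bound the fractional edge
cover number. -/
theorem Query.fractionalEdgeCoverNumber_le_of_encard_le {Q : Query} {K k : ℕ}
    (h : ∀ D : Instance Q.schema,
      (Q.answer D).encard ≤ ((K * (D.size + 1) ^ k : ℕ) : ℕ∞)) :
    Q.fractionalEdgeCoverNumber ≤ k + 1 := by
  by_contra hlt
  obtain ⟨z, hz, hzR, hzQ⟩ := Query.exists_independent (by positivity) (not_le.1 hlt)
  let M : ℕ := ∑ R : Q.schema, 2 ^ R.1.attrs.card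
  -- One more than the factor left after cancelling `N ^ k` in the final comparison.
  let N : ℕ := K * (M + 1) ^ k + 1
  have hN : (1 : ℝ) ≤ N := by exact_mod_cast Nat.le_add_left 1 _
  let n : ℕ → ℕ := fun a => ⌈(N : ℝ) ^ z a⌉₊
  let D : Instance Q.schema := fun R => Fintype.piFinset fun a => Finset.range (n a.1)
  have hcard : ∀ A : Finset ℕ, (Fintype.piFinset fun a : A => Finset.range (n a.1)).card =
      ∏ a ∈ A, n a := by
    intro A
    rw [Fintype.card_piFinset, ← Finset.prod_coe_sort A]
    simp
  have hpow : ∀ A : Finset ℕ, ∏ a ∈ A, (N : ℝ) ^ z a = (N : ℝ) ^ ∑ a ∈ A, z a := fun A =>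
    (Real.rpow_sum_of_pos (by linarith) _ _).symm
  have hDR : ∀ R : Q.schema, (D R).card ≤ 2 ^ R.1.attrs.card * N := by
    intro R
    have : ((∏ a ∈ R.1.attrs, n a : ℕ) : ℝ) ≤ 2 ^ R.1.attrs.card * N := by
      calc ((∏ a ∈ R.1.attrs, n a : ℕ) : ℝ) = ∏ a ∈ R.1.attrs, (n a : ℝ) := by push_cast; rfl
        _ ≤ ∏ a ∈ R.1.attrs, (2 * (N : ℝ) ^ z a) := by
          refine Finset.prod_le_prod (fun _ _ => Nat.cast_nonneg _) fun a _ => ?_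
          -- Rounding up therefore costs at most a factor 2 per attribute, which `M` collects.
          have h1 : 1 ≤ (N : ℝ) ^ z a := Real.one_le_rpow hN (hz a)
          have := Nat.ceil_lt_add_one (zero_le_one.trans h1)
          simp only [n]
          linarith
        _ = 2 ^ R.1.attrs.card * (N : ℝ) ^ ∑ a ∈ R.1.attrs, z a := by
          rw [Finset.prod_mul_distrib, Finset.prod_const, hpow]
        _ ≤ 2 ^ R.1.attrs.card * N := by
          gcongr
          exact (Real.rpow_le_rpow_of_exponent_le hN (hzR _ R.2)).trans (Real.rpow_one _).le
    rw [show (D R).card = _ from hcard _]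
    exact_mod_cast this
  have hsize : D.size ≤ M * N := by
    rw [Instance.size, Finset.sum_mul]
    exact Finset.sum_le_sum fun R _ => hDR R
  have hans : ((∏ a ∈ Q.attrs, n a : ℕ) : ℕ∞) ≤ (Q.answer D).encard := by
    rw [← hcard, ← Set.encard_coe_eq_coe_finsetCard]
    refine Set.encard_le_encard fun t ht R => ?_
    rw [Finset.mem_coe, Fintype.mem_piFinset] at ht
    exact Fintype.mem_piFinset.2 fun a => ht ⟨a.1, _⟩
  have h1 : ∏ a ∈ Q.attrs, n a ≤ K * (D.size + 1) ^ k := by exact_mod_cast hans.trans (h D)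
  have h2 : N ^ (k + 1) ≤ ∏ a ∈ Q.attrs, n a := by
    have : (N : ℝ) ^ (k + 1) ≤ ∏ a ∈ Q.attrs, (n a : ℝ) := by
      calc (N : ℝ) ^ (k + 1) = (N : ℝ) ^ ((k : ℝ) + 1) := by
            rw [← Real.rpow_natCast]; push_cast; rfl
        _ ≤ (N : ℝ) ^ ∑ a ∈ Q.attrs, z a := Real.rpow_le_rpow_of_exponent_le hN hzQ.le
        _ = ∏ a ∈ Q.attrs, (N : ℝ) ^ z a := (hpow _).symm
        _ ≤ ∏ a ∈ Q.attrs, (n a : ℝ) := Finset.prod_le_prod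
            (fun _ _ => Real.rpow_nonneg (Nat.cast_nonneg _) _) fun a _ => Nat.le_ceil _
    exact_mod_cast this
  have h3 : K * (D.size + 1) ^ k ≤ K * (M + 1) ^ k * N ^ k := by
    rw [mul_assoc, ← mul_pow]
    gcongr
    have : 1 ≤ N := by exact_mod_cast hN
    nlinarith
  have h4 : N * N ^ k ≤ K * (M + 1) ^ k * N ^ k := by
    rw [← pow_succ']
    exact h2.trans (h1.trans h3)
  have := Nat.le_of_mul_le_mul_right h4 (pow_pos (Nat.succ_pos _) _)
  omega

/-! ### Lengths of inputs and outputs -/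

theorem RAM.Exec.length_output_le {p : Program} {s s' : State} {t : ℕ} (h : Exec p s s' t) :
    s'.output.length ≤ s.output.length + t := by
  induction h with
  | write => simp
  | seq _ _ ih ih' => omega
  | iteTrue _ _ ih => omega
  | iteFalse _ _ ih => omega
  | loopTrue _ _ _ ih ih' => omega
  | _ => simp [State.store]

theorem encard_le_length {A : Finset ℕ} {S : Set (Tup A)} {w : List ℕ} (h : IsTable S w) :
    S.encard ≤ w.length := by
  classical
  obtain ⟨T, ⟨rows, -, hle, rfl, hT⟩, hS⟩ := h.exists_represents
  have hfin : S = ((T.2.map (Row.toTup A)).toFinset : Set (Tup A)) := by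
    ext t
    rw [← hS.mem_rows]
    simp
  have : S.Finite := hfin ▸ Finset.finite_toSet _
  rw [← this.cast_ncard_eq, ← hS.length_rows, hT]
  simp only [List.length_map, List.length_append, List.length_cons]
  exact_mod_cast (by omega)

theorem exists_isTable {A : Finset ℕ} (S : Finset (Tup A)) :
    ∃ w, IsTable (S : Set (Tup A)) w ∧ w.length = 2 + A.card + S.card * A.card := by
  refine ⟨_, ⟨A.sort (· ≤ ·), S.toList, Finset.sort_nodup _ _, Finset.sort_toFinset _ _,
    S.nodup_toList, by simp, rfl⟩, ?_⟩
  simp [List.length_flatMap]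
  omega

/-- The factor `K` may depend on the query, because the lower bound on answers detects only the
exponent. -/
theorem exists_isInputCode (Q : Query) : ∃ K : ℕ, ∀ D : Instance Q.schema,
    ∃ w, IsInputCode Q D w ∧ w.length ≤ K * (D.size + 1) := by
  refine ⟨Q.code.length + Q.names.length * (2 + 2 * Q.attrs.card), fun D => ?_⟩
  choose tab h1 h2 using fun R => exists_isTable (D R)
  refine ⟨Q.code ++ (Q.names.map tab).flatten, ⟨Q.names.map tab, ?_, rfl⟩, ?_⟩
  · refine (List.forall₂_map_right_iff).2 (List.forall₂_same.2 fun R _ => h1 R)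
  · rw [List.length_append, List.length_flatten, List.map_map]
    have hb : ∀ R ∈ Q.names, (List.length ∘ tab) R ≤
        (2 + 2 * Q.attrs.card) * (D.size + 1) := by
      intro R _
      rw [Function.comp, h2]
      have e1 : R.1.attrs.card ≤ Q.attrs.card := Finset.card_le_card (Q.attrs_subset R.2)
      have e2 : (D R).card ≤ D.size :=
        Finset.single_le_sum (f := fun R => (D R).card) (fun _ _ => Nat.zero_le _)
          (Finset.mem_univ R)
      have := Nat.mul_le_mul e2 e1
      nlinarith
    have := List.sum_le_card_nsmul (Q.names.map (List.length ∘ tab))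
      ((2 + 2 * Q.attrs.card) * (D.size + 1)) (by
        intro x hx
        obtain ⟨R, hR, rfl⟩ := List.mem_map.1 hx
        exact hb R hR)
    rw [List.length_map, smul_eq_mul, ← mul_assoc] at this
    rw [Nat.add_mul]
    have h3 : Q.code.length ≤ Q.code.length * (D.size + 1) :=
      Nat.le_mul_of_pos_right _ (Nat.succ_pos _)
    omega

theorem eval_le_pow (q : Polynomial ℕ) (n : ℕ) :
    q.eval n ≤ q.eval 1 * (n + 1) ^ q.natDegree := by
  simp only [Polynomial.eval_eq_sum_range, one_pow, mul_one, Finset.sum_mul]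
  refine Finset.sum_le_sum fun i hi => Nat.mul_le_mul_left _ ?_
  exact (Nat.pow_le_pow_left (Nat.le_succ n) i).trans
    (Nat.pow_le_pow_right (Nat.succ_pos n) (Nat.lt_succ_iff.1 (Finset.mem_range.1 hi)))

/-- If some output of polynomial length is at least as long as the answer has tuples, then the
fractional edge cover number is bounded. -/
theorem bounded_of_polyTime {𝒬 : Set Query}
    {isOutput : (Σ Q : 𝒬, Instance Q.1.schema) → List ℕ → Prop}
    (h : RAM.PolyTime (α := Σ Q : 𝒬, Instance Q.1.schema)
      (fun x w => IsInputCode x.1.1 x.2 w) isOutput)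
    (hout : ∀ x v, isOutput x v → (x.1.1.answer x.2).encard ≤ v.length) :
    BoundedFractionalEdgeCoverNumber 𝒬 := by
  obtain ⟨p, q, H⟩ := h
  -- The degree of the running time is common to the whole class; only the constant factor varies
  -- with the query.
  refine ⟨(q.natDegree : ℕ) + 1, fun Q hQ => ?_⟩
  obtain ⟨K, hK⟩ := exists_isInputCode Q
  refine Query.fractionalEdgeCoverNumber_le_of_encard_le (K := q.eval 1 * (K + 1) ^ q.natDegree)
    fun D => ?_
  obtain ⟨w, hw, hlen⟩ := hK D
  obtain ⟨v, t, ⟨s, hs, rfl⟩, ht, hv⟩ := H ⟨⟨Q, hQ⟩, D⟩ w hw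
  refine (hout _ _ hv).trans ?_
  have h1 := hs.length_output_le
  have h2 := eval_le_pow q w.length
  have h3 : (w.length + 1) ^ q.natDegree ≤ ((K + 1) * (D.size + 1)) ^ q.natDegree :=
    Nat.pow_le_pow_left (by rw [Nat.add_mul]; omega) _
  have h4 := Nat.mul_le_mul_left (q.eval 1) h3
  rw [mul_pow, ← mul_assoc] at h4
  simp only [List.length_nil] at h1
  exact_mod_cast (by omega)

theorem Plan.IsEvaluation.exists_isTable {σ : Finset RelName} {D : Instance σ} {φ : Plan σ}
    {w : List ℕ} (h : φ.IsEvaluation D w) : ∃ u v, w = u ++ v ∧ IsTable (φ.eval D) v := by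
  cases h with
  | rel h => exact ⟨[], _, rfl, h⟩
  | join _ _ h => exact ⟨_, _, rfl, h⟩
  | proj _ h => exact ⟨_, _, rfl, h⟩

theorem Plan.IsPlanFor.encard_eq {Q : Query} {φ : Plan Q.schema} (h : φ.IsPlanFor Q)
    (D : Instance Q.schema) : (φ.eval D).encard = (Q.answer D).encard :=
  congrArg (fun s : Σ A : Finset ℕ, Set (Tup A) => s.2.encard) (h D)

/-! ### Each of the properties 1, 2 and 3 bounds the cover number -/

theorem HasPolySizeAnswers.bounded {𝒬 : Set Query} (h : HasPolySizeAnswers 𝒬) :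
    BoundedFractionalEdgeCoverNumber 𝒬 := by
  obtain ⟨c, -, hc⟩ := h
  refine ⟨c + 1, fun Q hQ => Query.fractionalEdgeCoverNumber_le_of_encard_le (K := 1) fun D =>
    (hc Q hQ D).trans ?_⟩
  rw [one_mul]
  exact_mod_cast Nat.pow_le_pow_left (Nat.le_succ _) c

theorem PolyTimeEvaluable.bounded {𝒬 : Set Query} (h : PolyTimeEvaluable 𝒬) :
    BoundedFractionalEdgeCoverNumber 𝒬 :=
  bounded_of_polyTime h fun _ _ hv => encard_le_length hv

theorem PolyTimeEvaluableByPlan.bounded {𝒬 : Set Query} (h : PolyTimeEvaluableByPlan 𝒬) :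
    BoundedFractionalEdgeCoverNumber 𝒬 := by
  obtain ⟨Φ, hΦ, -, h⟩ := h
  refine bounded_of_polyTime h fun x v hv => ?_
  obtain ⟨u, v, rfl, htab⟩ := hv.exists_isTable
  rw [← (hΦ _ x.1.2).encard_eq]
  refine (encard_le_length htab).trans ?_
  simp

end JoinQuery

namespace JoinQuery

open JoinQuery.RAM JoinQuery.RAM.Rep

/-! ### Folds that produce output -/

theorem foldl_append_fst {α β δ : Type} (f : β → α → β) (h : β → α → List δ) (l : List α) (b : β)
    (o : List δ) :
    (l.foldl (fun acc x => (f acc.1 x, acc.2 ++ h acc.1 x)) (b, o)).1 = l.foldl f b := by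
  induction l generalizing b o with
  | nil => rfl
  | cons x l ih => exact ih _ _

theorem size_foldl_append_le {α β δ : Type} [Rep δ] {f : β → α → β} {h : β → α → List δ} {B : ℕ}
    (l : List α) (b : β) (o : List δ)
    (hB : ∀ l' x, (l' ++ [x]) <+: l → size (h (l'.foldl f b) x) ≤ B) :
    size (l.foldl (fun acc x => (f acc.1 x, acc.2 ++ h acc.1 x)) (b, o)).2 ≤
      size o + l.length * B := by
  induction l generalizing b o with
  | nil => simp
  | cons x l ih =>
    have h1 := hB [] x (by simp)
    have h2 := ih (f b x) (o ++ h b x) fun l' y hl' => hB (x :: l') y (by simpa using hl')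
    have h3 := size_append o (h b x)
    simp only [List.foldl_nil] at h1
    rw [List.foldl_cons, List.length_cons, Nat.add_mul]
    dsimp only
    omega

/-- The accumulated output never influences the state, and each chunk is polynomial in the state and
the list element. Hence a size bound for the states alone suffices. -/
theorem RAM.PolyFun.foldl_append {α β γ δ : Type} [Rep α] [Rep β] [Rep γ] [Rep δ] {f : β → α → β}
    {h : β → α → List δ} {l : γ → List α} {i : γ → β} {o : γ → List δ} (q : Polynomial ℕ)
    (hf : PolyFun fun p : β × α => f p.1 p.2) (hh : PolyFun fun p : β × α => h p.1 p.2)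
    (hl : PolyFun l) (hi : PolyFun i) (ho : PolyFun o)
    (hq : ∀ g l', l' <+: l g → size (l'.foldl f (i g)) ≤ q.eval (size g)) :
    PolyFun fun g => (l g).foldl (fun acc x => (f acc.1 x, acc.2 ++ h acc.1 x)) (i g, o g) := by
  obtain ⟨qh, hqh⟩ := hh.exists_size_le
  obtain ⟨ql, hql⟩ := hl.exists_size_le
  obtain ⟨qo, hqo⟩ := ho.exists_size_le
  refine PolyFun.foldl (f := fun _ (acc : β × List δ) x => (f acc.1 x, acc.2 ++ h acc.1 x))
    (q + (qo + ql * qh.comp (q + ql + 1)) + 1)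
    (.pair (hf.comp (g := fun p : γ × (β × List δ) × α => (p.2.1.1, p.2.2)) (by fun_prop))
      (.append (by fun_prop)
        (hh.comp (g := fun p : γ × (β × List δ) × α => (p.2.1.1, p.2.2)) (by fun_prop))))
    hl (hi.pair ho) fun g l' hl' => ?_
  simp only [Polynomial.eval_add, Polynomial.eval_mul, Polynomial.eval_comp, Polynomial.eval_one]
  rw [size_pair, foldl_append_fst]
  have h1 := hq g l' hl'
  have h2 := (size_sublist hl'.sublist).trans (hql g)
  have h3 := (length_lt_size l').le.trans h2
  have h4 := size_foldl_append_le (f := f) (h := h)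
    (B := qh.eval (q.eval (size g) + ql.eval (size g) + 1)) l' (i g) (o g) (by
      intro l'' x hx
      refine (hqh (_, x)).trans (eval_mono qh ?_)
      have h5 := hq g l'' ((List.prefix_append _ _).trans (hx.trans hl'))
      have h6 := size_le_of_mem ((hx.trans hl').subset (List.mem_append_right _
        (List.mem_singleton_self x)))
      have h7 := hql g
      rw [size_pair]
      dsimp only
      omega)
  have h5 := hqo g
  have h6 := Nat.mul_le_mul_right (qh.eval (q.eval (size g) + ql.eval (size g) + 1)) h3
  omega

/-! ### Evaluation of the plan on tables -/

def Table.step (J : Table) (p : List ℕ × Table) : Table := J.join (p.2.proj p.1)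

/-- The tables of the subplans added in one step. -/
def Table.stepCode (J : Table) (p : List ℕ × Table) : List ℕ :=
  (p.2.code ++ (p.2.proj p.1).code) ++ (J.step p).code

/-- The final table and the record of the evaluation of the plan. -/
def evalTables (L : List ℕ) (ts : List Table) : Table × List ℕ :=
  (steps ts [] L).foldl (fun acc p => (acc.1.step p, acc.2 ++ acc.1.stepCode p))
    ((ts.getLastD ([], [])).proj [],
      (ts.getLastD ([], [])).code ++ ((ts.getLastD ([], [])).proj []).code)

@[fun_prop]
theorem polyFun_getLastD {γ : Type} [Rep γ] {ts : γ → List Table} (h : PolyFun ts) :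
    PolyFun fun g => (ts g).getLastD ([], []) :=
  PolyFun.getLastD h (by fun_prop)

theorem getLastD_of_ne_nil {α : Type} {l : List α} (h : l ≠ []) (d : α) :
    l.getLastD d = l.getLast h := by
  rw [List.getLastD_eq_getLast?, List.getLast?_eq_some_getLast h, Option.getD_some]

theorem forall₂_getLast {α β : Type} {r : α → β → Prop} {l : List α} {l' : List β}
    (h : List.Forall₂ r l l') (hl : l ≠ []) (hl' : l' ≠ []) : r (l.getLast hl) (l'.getLast hl') := by
  have hlen := h.length_eq
  have hpos := List.length_pos_iff.2 hl
  have := (List.forall₂_iff_get.1 h).2 (l.length - 1) (by omega) (by omega)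
  simpa [List.getLast_eq_getElem, hlen] using this

/-- The tables `ts` represent the instance `D`. -/
def RepresentInstance {Q : Query} (D : Instance Q.schema) (ts : List Table) : Prop :=
  List.Forall₂ (fun R T => T.Represents {t | t ∈ D R}) Q.names ts

section

variable {Q : Query} {D : Instance Q.schema}

theorem represents_foldl {φ : Plan Q.schema} {T : Table} {o : List ℕ} (hT : T.Represents (φ.eval D))
    (ho : φ.IsEvaluation D o) {xs : List (List ℕ × Q.schema)} {ys : List (List ℕ × Table)}
    (h : List.Forall₂ (fun p q => p.1 = q.1 ∧ q.2.Represents {t | t ∈ D p.2}) xs ys) :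
    (ys.foldl Table.step T).Represents ((xs.foldl Plan.step φ).eval D) ∧
      (xs.foldl Plan.step φ).IsEvaluation D
        (ys.foldl (fun acc p => (acc.1.step p, acc.2 ++ acc.1.stepCode p)) (T, o)).2 := by
  induction h generalizing φ T o with
  | nil => exact ⟨hT, ho⟩
  | @cons p q xs ys hpq h ih =>
    obtain ⟨B, R⟩ := p
    obtain ⟨B', S⟩ := q
    obtain ⟨rfl, hS⟩ := hpq
    have hS' : S.Represents ((Plan.rel R).eval D) := hS
    have hP : (S.proj B).Represents ((Plan.proj B.toFinset (.rel R)).eval D) := hS'.proj B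
    have hJ : (T.step (B, S)).Represents ((φ.step (B, R)).eval D) := hT.join hP
    refine ih hJ ?_
    have := Plan.IsEvaluation.join ho (.proj (.rel hS'.isTable) hP.isTable) hJ.isTable
    rw [List.append_assoc] at this
    exact this

theorem represents_base {ts : List Table} (h : RepresentInstance D ts) :
    ((ts.getLastD ([], [])).proj []).Represents (Q.basePlan.eval D) ∧
      Q.basePlan.IsEvaluation D
        ((ts.getLastD ([], [])).code ++ ((ts.getLastD ([], [])).proj []).code) := by
  have hne : ts ≠ [] := by
    rintro rfl
    exact Q.names_ne_nil (List.forall₂_nil_right_iff.1 h)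
  have hlast : (ts.getLastD ([], [])).Represents
      ((Plan.rel (Q.names.getLast Q.names_ne_nil)).eval D) := by
    rw [getLastD_of_ne_nil hne]
    exact forall₂_getLast h _ _
  exact ⟨hlast.proj [], .proj (.rel hlast.isTable) (hlast.proj []).isTable⟩

theorem evalTables_spec {ts : List Table} (h : RepresentInstance D ts) :
    (evalTables Q.attrList ts).1.Represents (Q.plan.eval D) ∧
      Q.plan.IsEvaluation D (evalTables Q.attrList ts).2 := by
  obtain ⟨h1, h2⟩ := represents_base h
  have := represents_foldl h1 h2 (forall₂_steps h [] Q.attrList)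
  rw [evalTables, foldl_append_fst]
  exact this

theorem Plan.finite_eval {σ : Finset RelName} (D : Instance σ) (φ : Plan σ) :
    (φ.eval D).Finite := by
  induction φ with
  | rel R => exact (D R).finite_toSet
  | join φ ψ h h' =>
    refine Set.Finite.of_finite_image ((h.prod h').subset ?_)
      (f := fun t : Tup (φ.attrs ∪ ψ.attrs) => ((t.proj Finset.subset_union_left : Tup φ.attrs),
        (t.proj Finset.subset_union_right : Tup ψ.attrs))) ?_
    · rintro _ ⟨t, ht, rfl⟩
      exact ht
    · intro s _ t _ e
      obtain ⟨e1, e2⟩ := Prod.ext_iff.1 e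
      funext ⟨a, ha⟩
      rcases Finset.mem_union.1 ha with ha' | ha'
      · exact congrFun e1 ⟨a, ha'⟩
      · exact congrFun e2 ⟨a, ha'⟩
  | proj B φ h =>
    refine (h.image fun s => s.proj (Finset.inter_subset_right : B ∩ φ.attrs ⊆ _)).subset ?_
    rintro _ ⟨s, hs, rfl⟩
    exact ⟨s, hs, rfl⟩

theorem size_foldl_prefix_le {N k : ℕ} {x : Q.schema → ℝ} (hx : Q.IsFractionalEdgeCover x)
    (hk : ∑ R, x R ≤ k) {ts : List Table} (h : RepresentInstance D ts) (hN : 1 ≤ N)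
    (hts : ∀ T ∈ ts, size T ≤ N) (hL : Q.attrList.length ≤ N) {l : List (List ℕ × Table)}
    (hl : l <+: steps ts [] Q.attrList) :
    size (l.foldl Table.step ((ts.getLastD ([], [])).proj [])) ≤
      2 * N + N ^ (k + 1) * (4 * N + 2) + 3 := by
  obtain ⟨h1, h2⟩ := represents_base h
  -- A prefix of the steps on tables corresponds to the prefix of the same length of the steps of
  -- the plan, so the intermediate table represents the value of a subplan.
  have hpre : List.Forall₂ (fun p q => p.1 = q.1 ∧ q.2.Represents {t | t ∈ D p.2})
      ((steps Q.names [] Q.attrList).take l.length) l := by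
    have := List.forall₂_take l.length (forall₂_steps h [] Q.attrList)
    rwa [← List.prefix_iff_eq_take.1 hl] at this
  have hrep := (represents_foldl h1 h2 hpre).1
  have hcard : ∀ R, (D R).card ≤ N := by
    intro R
    obtain ⟨i, hi, rfl⟩ := List.mem_iff_getElem.1 (Q.mem_names R)
    have hi' : i < ts.length := by rw [← h.length_eq]; exact hi
    have hT := (List.forall₂_iff_get.1 h).2 i hi hi'
    simp only [List.get_eq_getElem] at hT
    have h3 := hT.length_rows
    have h4 : Set.ncard {t : Tup Q.names[i].1.attrs | t ∈ D Q.names[i]} = (D Q.names[i]).card := Set.ncard_coe_finset _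
    have h5 := length_lt_size ts[i].2
    have h6 := hts _ (List.getElem_mem hi')
    rw [size_pair] at h6
    omega
  have hncard := Query.ncard_eval_prefix_le hN hcard hx hk (List.take_prefix l.length _)
    (Plan.finite_eval D _)
  refine hrep.size_le.trans ?_
  set φ := ((steps Q.names [] Q.attrList).take l.length).foldl Plan.step Q.basePlan
  have hattrs : φ.attrs.card ≤ N := by
    refine le_trans ?_ hL
    refine le_trans (Finset.card_le_card fun a ha => ?_) (List.toFinset_card_le Q.attrList)
    rw [Plan.mem_attrs_foldl, Q.attrs_basePlan] at ha
    rcases ha with ha | ⟨p, -, -, hp⟩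
    · simp at ha
    · exact List.mem_toFinset.2 (Query.mem_attrList.2 (Query.mem_attrs.2 ⟨p.2, hp⟩))
  gcongr

end

/-! ### A bounded cover number implies properties 1, 2 and 3 -/

/-- The data of a query of a class and of an instance for it. -/
abbrev InputData (𝒬 : Set Query) : Type :=
  {p : List (ℕ × List ℕ) × List Table //
    ∃ Q ∈ 𝒬, p.1 = Q.data ∧ ∃ D : Instance Q.schema, RepresentInstance D p.2}

theorem Query.flatMap_data (Q : Query) : (Q.data.flatMap fun p => p.2) = Q.attrList := by
  simp [Query.data, Query.attrList, List.flatMap_map]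

/-- The exponent `k + 1` is the same for all queries of the class, so a single polynomial bounds all
intermediate tables, for inputs satisfying the promise. -/
theorem polyFun_evalTables {𝒬 : Set Query} (h : BoundedFractionalEdgeCoverNumber 𝒬) :
    PolyFun fun g : InputData 𝒬 => evalTables (g.1.1.flatMap fun p => p.2) g.1.2 := by
  obtain ⟨c, hc⟩ := h
  let k := ⌈c + 1⌉₊
  obtain ⟨qL, hqL⟩ := (show PolyFun fun g : InputData 𝒬 => g.1.1.flatMap fun p => p.2 by
    fun_prop).exists_size_le
  -- Its value bounds both the sizes of the given tables, hence their numbers of rows, and the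
  -- number of attribute occurrences.
  let qN : Polynomial ℕ := .X + qL
  refine PolyFun.foldl_append (f := Table.step) (h := Table.stepCode)
    (2 * qN + qN ^ (k + 1) * (4 * qN + 2) + 3) (by unfold Table.step; fun_prop)
    (by unfold Table.stepCode Table.step; fun_prop) (by fun_prop) (by fun_prop) (by fun_prop) ?_
  rintro ⟨⟨q, ts⟩, Q, hQ, hq, D, hD⟩ l hl
  dsimp only at hq hD hl ⊢
  subst hq
  rw [Q.flatMap_data] at hl
  obtain ⟨x, hx, hxc⟩ := Q.exists_cover_lt ((hc Q hQ).trans_lt (lt_add_one c))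
  simp only [Polynomial.eval_add, Polynomial.eval_mul, Polynomial.eval_pow,
    Polynomial.eval_ofNat]
  set g : InputData 𝒬 := ⟨(Q.data, ts), Q, hQ, rfl, D, hD⟩
  have hN : qN.eval (size g) = size g + qL.eval (size g) := by simp [qN]
  have hg : size g = size Q.data + size ts + 1 := rfl
  refine size_foldl_prefix_le hx (hxc.le.trans (Nat.le_ceil _)) hD (by omega) (fun T hT => ?_) ?_ hl
  · have := size_le_of_mem hT
    omega
  · have h1 : size (Q.data.flatMap fun p => p.2) ≤ qL.eval (size g) := hqL g
    rw [Q.flatMap_data] at h1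
    have := length_lt_size Q.attrList
    omega

theorem IsInputCode.exists_data {Q : Query} {D : Instance Q.schema} {w : List ℕ}
    (h : IsInputCode Q D w) : ∃ ts, InputListing w (Q.data, ts) ∧ RepresentInstance D ts := by
  obtain ⟨vs, hvs, rfl⟩ := h
  replace hvs : List.Forall₂ (fun R v => IsTable {t | t ∈ D R} v) Q.names vs := hvs
  have : ∃ ts, List.Forall₂ Table.Listing vs ts ∧ RepresentInstance D ts := by
    unfold RepresentInstance
    generalize Q.names = l at hvs
    induction hvs with
    | nil => exact ⟨[], .nil, .nil⟩
    | cons h _ ih =>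
      obtain ⟨ts, h1, h2⟩ := ih
      obtain ⟨T, h3, h4⟩ := h.exists_represents
      exact ⟨T :: ts, .cons h3 h1, .cons h4 h2⟩
  obtain ⟨ts, h1, h2⟩ := this
  refine ⟨ts, ⟨Q, rfl, vs, h1, ?_, rfl⟩, h2⟩
  dsimp only
  rw [← h1.length_eq, ← hvs.length_eq, ← Q.map_names, List.length_map]

theorem polyTime_of_evalTables {𝒬 : Set Query} (h : BoundedFractionalEdgeCoverNumber 𝒬)
    {f : Table × List ℕ → List ℕ} (hf : PolyFun f)
    {isOutput : (Σ Q : 𝒬, Instance Q.1.schema) → List ℕ → Prop}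
    (H : ∀ x T o, T.Represents ((x.1.1.plan).eval x.2) → x.1.1.plan.IsEvaluation x.2 o →
      isOutput x (f (T, o))) :
    RAM.PolyTime (α := Σ Q : 𝒬, Instance Q.1.schema)
      (fun x w => IsInputCode x.1.1 x.2 w) isOutput := by
  -- The reader for arbitrary inputs also serves for the subtype, whose elements have the same
  -- representation.
  have hread : PolyReads fun (_ : Unit) w (g : InputData 𝒬) => InputListing w g.1 := by
    obtain ⟨p, q, hp⟩ := PolyReads.readInput
    exact ⟨p, q, fun d a w b => hp d a w b.1⟩
  refine PolyReads.polyTime (PolyFun.comp_reads (hf.comp (polyFun_evalTables h)) hread) ?_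
  rintro ⟨⟨Q, hQ⟩, D⟩ w hw
  obtain ⟨ts, h1, h2⟩ := hw.exists_data
  refine ⟨_, ⟨⟨(Q.data, ts), Q, hQ, rfl, D, h2⟩, h1, rfl⟩, ?_⟩
  obtain ⟨h3, h4⟩ := evalTables_spec h2
  dsimp only
  rw [Q.flatMap_data]
  exact H _ _ _ h3 h4

theorem Plan.IsPlanFor.isTable {Q : Query} {φ : Plan Q.schema} (h : φ.IsPlanFor Q)
    {D : Instance Q.schema} {w : List ℕ} (hw : IsTable (φ.eval D) w) :
    IsTable (Q.answer D) w := by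
  have : ∀ s s' : Σ A : Finset ℕ, Set (Tup A), s = s' → IsTable s.2 w → IsTable s'.2 w := by
    rintro s _ rfl hs
    exact hs
  exact this _ _ (h D) hw

theorem BoundedFractionalEdgeCoverNumber.polyTimeEvaluable {𝒬 : Set Query}
    (h : BoundedFractionalEdgeCoverNumber 𝒬) : PolyTimeEvaluable 𝒬 :=
  polyTime_of_evalTables h (f := fun p => p.1.code) (by fun_prop) fun x _ _ hT _ =>
    (Query.isPlanFor_plan x.1.1).isTable hT.isTable

/-- The code of a query entry as a relation name. -/
def entryCode (p : ℕ × List ℕ) : List ℕ := p.1 :: p.2.length :: p.2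

def planCode (q : List (ℕ × List ℕ)) : List ℕ :=
  0 :: entryCode (q.getLastD (0, [])) ++ [2, 0] ++
    (steps q [] (q.flatMap fun p => p.2)).flatMap fun p =>
      0 :: entryCode p.2 ++ 2 :: p.1.length :: p.1 ++ [1]

theorem polyFun_planCode : PolyFun planCode := by
  have : PolyFun fun q : List (ℕ × List ℕ) => q.getLastD (0, []) :=
    PolyFun.getLastD (by fun_prop) (by fun_prop)
  unfold planCode entryCode
  fun_prop

theorem planCode_data (Q : Query) : planCode Q.data =
    0 :: (Q.names.getLast Q.names_ne_nil).1.code ++ [2, 0] ++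
      (steps Q.names [] Q.attrList).flatMap fun p =>
        0 :: p.2.1.code ++ 2 :: p.1.length :: p.1 ++ [1] := by
  have hdata : Q.data = Q.names.map fun R => (R.1.name, R.1.attrs.sort (· ≤ ·)) := by
    rw [Query.data, ← Q.map_names, List.map_map]
    rfl
  have hcode : ∀ R : RelName, entryCode (R.name, R.attrs.sort (· ≤ ·)) = R.code := by
    intro R
    simp [entryCode, RelName.code]
  rw [planCode, Q.flatMap_data, hdata, steps_map, List.flatMap_map,
    getLastD_of_ne_nil (fun h => Q.names_ne_nil (List.map_eq_nil_iff.1 h)), List.getLast_map]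
  simp only [Prod.map, hcode, id]

theorem BoundedFractionalEdgeCoverNumber.polyTimeEvaluableByPlan {𝒬 : Set Query}
    (h : BoundedFractionalEdgeCoverNumber 𝒬) : PolyTimeEvaluableByPlan 𝒬 := by
  refine ⟨Query.plan, fun Q _ => Q.isPlanFor_plan, ?_, polyTime_of_evalTables h
    (f := fun p => p.2) (by fun_prop) fun x _ _ _ ho => ho⟩
  refine PolyReads.polyTime (PolyFun.comp_reads polyFun_planCode PolyReads.readQuery) ?_
  rintro Q w rfl
  refine ⟨_, ⟨Q.1.data, ⟨Q.1, rfl, rfl⟩, rfl⟩, ?_⟩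
  rw [planCode_data]
  exact Q.1.isCode_plan

theorem BoundedFractionalEdgeCoverNumber.hasPolySizeAnswers {𝒬 : Set Query}
    (h : BoundedFractionalEdgeCoverNumber 𝒬) : HasPolySizeAnswers 𝒬 := by
  obtain ⟨c, hc⟩ := h
  refine ⟨⌈c + 1⌉₊ + 1, Nat.succ_pos _, fun Q hQ D => ?_⟩
  obtain ⟨x, hx, hxc⟩ := Q.exists_cover_lt ((hc Q hQ).trans_lt (lt_add_one c))
  have hD : ∀ R, (D R).card ≤ D.size := fun R =>
    Finset.single_le_sum (f := fun R => (D R).card) (fun _ _ => Nat.zero_le _) (Finset.mem_univ R)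
  -- The size bound needs `1 ≤ N`. On the empty instance there are no answers, because a query has
  -- at least one relation.
  rcases Nat.eq_zero_or_pos D.size with h0 | hpos
  · have : Q.answer D = ∅ := by
      rw [Set.eq_empty_iff_forall_notMem]
      intro t ht
      have h1 := ht (Q.names.getLast Q.names_ne_nil)
      have h2 := hD (Q.names.getLast Q.names_ne_nil)
      have h3 := Finset.card_pos.2 ⟨_, h1⟩
      omega
    rw [this, Set.encard_empty]
    exact zero_le
  · have h1 := Query.ncard_eval_prefix_le hpos hD hx (hxc.le.trans (Nat.le_ceil _))
      (List.prefix_refl _) (Plan.finite_eval D _)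
    rw [← Q.isPlanFor_plan.encard_eq, ← (Plan.finite_eval D Q.plan).cast_ncard_eq]
    exact_mod_cast h1

end JoinQuery

theorem mainTheorem2 (𝒬 : Set JoinQuery.Query) :
    List.TFAE [
      JoinQuery.HasPolySizeAnswers 𝒬,
      JoinQuery.PolyTimeEvaluable 𝒬,
      JoinQuery.PolyTimeEvaluableByPlan 𝒬,
      JoinQuery.BoundedFractionalEdgeCoverNumber 𝒬] := by
  tfae_have 1 → 4 := JoinQuery.HasPolySizeAnswers.bounded
  tfae_have 2 → 4 := JoinQuery.PolyTimeEvaluable.bounded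
  tfae_have 3 → 4 := JoinQuery.PolyTimeEvaluableByPlan.bounded
  tfae_have 4 → 1 := JoinQuery.BoundedFractionalEdgeCoverNumber.hasPolySizeAnswers
  tfae_have 4 → 2 := JoinQuery.BoundedFractionalEdgeCoverNumber.polyTimeEvaluable
  tfae_have 4 → 3 := JoinQuery.BoundedFractionalEdgeCoverNumber.polyTimeEvaluableByPlan
  tfae_finish
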